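/- **Setting.** Let $d,m\in\mathbb N$, $r>0$, $\tfrac12<\nu\le 1$, $1-\nu<\beta_0<\beta<\nu$, and $C_r=C([-r,0],\mathbb R^d)$ with the sup norm. For $0<\alpha\le 1$ let $|||y|||_{\alpha,[a,b]}=\sup_{a\le s<t\le b}\|y(t)-y(s)\|/(t-s)^\alpha$, let $C^{\alpha}([a,b])$ be the space of $\alpha$-Hölder paths with norm $\|y\|_{\infty,[a,b]}+|||y|||_{\alpha,[a,b]}$, and let $C^{0,\alpha}([a,b])$ be the closure of the smooth paths in it. Let $\Omega=C^{0,\nu}_0(\mathbb R,\mathbb R^m)$ be the space of paths $x$ with $x(0)=0$ whose restriction to every compact interval lies in $C^{0,\nu}$, with the topology of convergence in $C^{0,\nu}([-n,n])$ for all $n$ and its Borel $\sigma$-algebra, and let $(\theta_t x)(s)=x(t+s)-x(t)$. Let $\mathbb P$ be a probability measure on $\Omega$ (the law of the noise $Z(t,x)=x(t)$) that is invariant under every $\theta_t$ (stationary increments) and ergodic for $(\theta_t)_{t\in\mathbb R}$, with $$\mathbb E\,|||Z|||_{\nu,[-r,r]}^{\frac1{\nu-\beta}}<\infty .$$ Consider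 $$dy(t)=[Ay(t)+f(y_t)]\,dt+g(y_t)\,dZ(t),\qquad y_0=\eta\in S:=C^{0,\beta_0}([-r,0],\mathbb R^d),\qquad y_t(s)=y(t+s),\ s\in[-r,0],$$ solved pathwise, the last term being a Young integral; solutions are paths on $[-r,\infty)$ that are $\beta_0$-Hölder on every $[-r,T]$. **Assumptions.** (H1) All eigenvalues of $A\in\mathbb R^{d\times d}$ have negative real part; $C_A,\lambda>0$ are constants with $\|e^{tA}\|\le C_Ae^{-\lambda t}$ for all $t\ge 0$. (H2) $f:C_r\to\mathbb R^d$ satisfies $\|f(\xi)-f(\eta)\|\le C_f\|\xi-\eta\|_\infty$. (H3) $g:C_r\to\mathbb R^{d\times m}$ is $C^1$, $\|Dg(\xi)\|\le C_g$ for all $\xi$, and for each $M>0$ there is $L_M$ with $\|Dg(\xi)-Dg(\eta)\|\le L_M\|\xi-\eta\|_\infty$ whenever $\|\xi\|_\infty,\|\eta\|_\infty\le M$. Moreover $C_AC_f<\lambda e^{-\lambda r}$, and $g$ is bounded: $\sup_{\eta\in S}\|g(\eta)\|<\infty$. (No smallness of $C_g$ is assumed.) **Theorem.** For every $x\in\Omega$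 and $\eta\in S$ the equation driven by $x$ has exactly one solution $y(\cdot,x,\eta)$, and $\varphi(t,x,\eta)(s)=y(t+s,x,\eta)$ defines a continuous random dynamical system $\varphi:\mathbb R_+\times\Omega\times S\to S$ over the metric dynamical system $(\Omega,\mathbb P,\theta)$ (jointly measurable; continuous in $(t,\eta)$; $\varphi(0,x)=\mathrm{id}$; $\varphi(t+s,x)=\varphi(t,\theta_sx)\circ\varphi(s,x)$). It has a random pullback attractor $\mathcal A$ for the universe of tempered random sets, and $\mathcal A(x)\subset C^{\beta}([-r,0],\mathbb R^d)$ for every $x$. That is: (i) $\mathcal A$ has measurable graph in $\Omega\times S$, each $\mathcal A(x)$ is non-empty and compact, and $x\mapsto d(\eta,\mathcal A(x))$ is measurable for every $\eta\in S$; (ii) for $\mathbb P$-a.e. $x$, $\varphi(t,x)\mathcal A(x)=\mathcal A(\theta_tx)$ for all $t\ge 0$; (iii) for every tempered random set $D$, for $\mathbb P$-a.e. $x$, $$\lim_{t\to\infty}\ \sup_{\eta\in D(\theta_{-t}x)}\ \inf_{\zeta\in\mathcal A(x)}\|\varphi(t,\theta_{-t}x,\eta)-\zeta\|_S=0 .$$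 Here a tempered random set is a family $D(x)\subset S$ with measurable graph for which there is a measurable $\rho:\Omega\to[0,\infty)$ with $\lim_{t\to\pm\infty}\frac1t\log^+\rho(\theta_tx)=0$ for a.e. $x$, such that for a.e. $x$ one has $D(\theta_tx)\subset\{\eta:\|\eta\|_S\le\rho(\theta_tx)\}$ for all $t\in\mathbb R$. -/

import Mathlib

open MeasureTheory Filter Set Topology
open scoped NNReal ENNReal

noncomputable section

namespace YoungDelay

/-! ### Hölder spaces: closure of the smooth paths in the Hölder norm -/

section HolderSpaces

variable {E : Type*} [NormedAddCommGroup E] [NormedSpace ℝ E]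

/-- `y ∈ C^{0,α}([a,b],E)`: `y` is `α`-Hölder and lies in the closure of the smooth paths for the
norm `sup-norm + α-Hölder seminorm` (both parts of the norm of `y - p` can be made at most `ε`). -/
def MemC0 (α : ℝ≥0) (a b : ℝ) (y : Icc a b → E) : Prop :=
  MemHolder α y ∧ ∀ ε : ℝ≥0, 0 < ε → ∃ p : ℝ → E, ContDiff ℝ (⊤ : ℕ∞) p ∧
    (∀ t : Icc a b, ‖y t - p t‖ ≤ ε) ∧ HolderWith ε α (fun t : Icc a b => y t - p t)

lemma MemC0.zero (α : ℝ≥0) (a b : ℝ) : MemC0 α a b (0 : Icc a b → E) := by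
  refine ⟨memHolder_zero, fun ε _ => ⟨fun _ => 0, contDiff_const, fun t => by simp, ?_⟩⟩
  have h : (fun t : Icc a b => (0 : Icc a b → E) t - 0) = fun _ => (0 : E) := by
    funext t; simp
  rw [h]
  exact HolderWith.const

lemma MemC0.add {α : ℝ≥0} {a b : ℝ} {y z : Icc a b → E} (hy : MemC0 α a b y)
    (hz : MemC0 α a b z) : MemC0 α a b (y + z) := by
  refine ⟨hy.1.add hz.1, fun ε hε => ?_⟩
  obtain ⟨p, hp, hp1, hp2⟩ := hy.2 (ε / 2) (half_pos hε)
  obtain ⟨q, hq, hq1, hq2⟩ := hz.2 (ε / 2) (half_pos hε)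
  refine ⟨p + q, hp.add hq, fun t => ?_, ?_⟩
  · have h : (y + z) t - (p + q) t = (y t - p t) + (z t - q t) := by
      simp only [Pi.add_apply]; abel
    rw [h]
    refine (norm_add_le _ _).trans ((add_le_add (hp1 t) (hq1 t)).trans_eq ?_)
    push_cast; ring
  · have h := hp2.add hq2
    rw [add_halves] at h
    have h' : (fun t : Icc a b => (y + z) t - (p + q) t)
        = (fun t : Icc a b => y t - p t) + fun t : Icc a b => z t - q t := by
      funext t
      simp only [Pi.add_apply]; abel
    rw [h']
    exact h

lemma MemC0.smul {α : ℝ≥0} {a b : ℝ} (c : ℝ) {y : Icc a b → E} (hy : MemC0 α a b y) :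
    MemC0 α a b (c • y) := by
  refine ⟨hy.1.smul, fun ε hε => ?_⟩
  obtain ⟨p, hp, hp1, hp2⟩ := hy.2 (ε / (‖c‖₊ + 1)) (by positivity)
  have hle : ε / (‖c‖₊ + 1) * ‖c‖₊ ≤ ε := by
    rw [div_mul_eq_mul_div]
    exact div_le_of_le_mul₀ (by positivity) (by positivity) (by gcongr; exact le_self_add)
  refine ⟨c • p, contDiff_const.smul hp, fun t => ?_, ?_⟩
  · have h : (c • y) t - (c • p) t = c • (y t - p t) := by
      simp only [Pi.smul_apply, smul_sub]
    rw [h, norm_smul, mul_comm]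
    refine (mul_le_mul_of_nonneg_right (hp1 t) (norm_nonneg c)).trans ?_
    exact_mod_cast hle
  · have h := (hp2.smul c).mono hle
    have h' : (fun t : Icc a b => (c • y) t - (c • p) t)
        = c • fun t : Icc a b => y t - p t := by
      funext t
      simp only [Pi.smul_apply, smul_sub]
    rw [h']
    exact h

variable (E) in
/-- The vector space underlying `C^{0,α}([a,b],E)`, inside the continuous functions. -/
def c0Submodule (α : ℝ≥0) (a b : ℝ) : Submodule ℝ C(Icc a b, E) where
  carrier := {y | MemC0 α a b y}
  zero_mem' := MemC0.zero α a b
  add_mem' hy hz := MemC0.add hy hz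
  smul_mem' c _ hy := MemC0.smul c hy

variable (E) in
/-- The space `C^{0,α}([a,b],E)`. Its norm is `‖y‖_∞ + |||y|||_α` (not the sup norm). -/
def C0 (α : ℝ≥0) (a b : ℝ) : Type _ := c0Submodule E α a b

namespace C0

variable {α : ℝ≥0} {a b : ℝ}

instance : AddCommGroup (C0 E α a b) := inferInstanceAs (AddCommGroup (c0Submodule E α a b))

instance : Module ℝ (C0 E α a b) := inferInstanceAs (Module ℝ (c0Submodule E α a b))

/-- The underlying continuous function. -/
def toCM (y : C0 E α a b) : C(Icc a b, E) := y.1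

lemma memC0 (y : C0 E α a b) : MemC0 α a b y.toCM := y.2

/-- The norm `‖y‖_{∞,α,[a,b]} = ‖y‖_{∞,[a,b]} + |||y|||_{α,[a,b]}`. -/
def addGroupNorm (E : Type*) [NormedAddCommGroup E] [NormedSpace ℝ E] (α : ℝ≥0) (a b : ℝ) :
    AddGroupNorm (C0 E α a b) where
  toFun y := ‖y.toCM‖ + nnHolderNorm α y.toCM
  map_zero' := by
    have h : ((0 : C0 E α a b).toCM) = 0 := rfl
    rw [h, norm_zero, ContinuousMap.coe_zero, nnHolderNorm_zero]; simp
  add_le' y z := by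
    have h : (y + z).toCM = y.toCM + z.toCM := rfl
    have h1 := norm_add_le y.toCM z.toCM
    have h2 : (nnHolderNorm α (y.toCM + z.toCM : Icc a b → E) : ℝ)
        ≤ nnHolderNorm α y.toCM + nnHolderNorm α z.toCM :=
      by exact_mod_cast y.memC0.1.nnHolderNorm_add_le z.memC0.1
    rw [h, ContinuousMap.coe_add]
    linarith
  neg' y := by
    have h : (-y).toCM = -y.toCM := rfl
    have h2 : ((-y.toCM : C(Icc a b, E)) : Icc a b → E) = (-1 : ℝ) • (y.toCM : Icc a b → E) := by
      funext t; simp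
    rw [h, h2, y.memC0.1.nnHolderNorm_smul (-1 : ℝ), norm_neg]; simp
  eq_zero_of_map_eq_zero' y hy := by
    have h1 : ‖y.toCM‖ = 0 := by
      have := norm_nonneg y.toCM
      have := (nnHolderNorm α y.toCM).coe_nonneg
      linarith
    exact Subtype.ext (norm_eq_zero.1 h1)

instance : NormedAddCommGroup (C0 E α a b) := (addGroupNorm E α a b).toNormedAddCommGroup

instance : NormedSpace ℝ (C0 E α a b) where
  norm_smul_le c y := by
    have h : (c • y).toCM = c • y.toCM := rfl
    change ‖(c • y).toCM‖ + (nnHolderNorm α (c • y).toCM : ℝ)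
      ≤ ‖c‖ * (‖y.toCM‖ + nnHolderNorm α y.toCM)
    rw [h, ContinuousMap.coe_smul, y.memC0.1.nnHolderNorm_smul c, norm_smul]
    push_cast
    rw [mul_add]

lemma norm_def (y : C0 E α a b) : ‖y‖ = ‖y.toCM‖ + nnHolderNorm α y.toCM := rfl

instance : MeasurableSpace (C0 E α a b) := borel _

instance : BorelSpace (C0 E α a b) := ⟨rfl⟩

end C0

/-! ### The canonical path space `C^{0,ν}_0(ℝ,E)` and the Wiener shift -/

variable (E) in
/-- Paths `x : ℝ → E` with `x 0 = 0` whose restriction to every compact interval is in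
`C^{0,ν}`. -/
def PathSpace (ν : ℝ≥0) : Type _ :=
  {x : C(ℝ, E) // x 0 = 0 ∧ ∀ a b : ℝ, MemC0 ν a b (fun t : Icc a b => x t)}

namespace PathSpace

variable {ν : ℝ≥0}

instance : CoeFun (PathSpace E ν) (fun _ => ℝ → E) := ⟨fun x => x.1⟩

/-- The restriction of a path to `[a,b]`. -/
def restr (a b : ℝ) (x : PathSpace E ν) : C0 E ν a b :=
  ⟨⟨fun t => x t, x.1.continuous.comp continuous_subtype_val⟩, x.2.2 a b⟩

/-- The topology of convergence in `C^{0,ν}([-n,n])` for every `n`, that is, the topology of the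
metric `d(x,y) = ∑ 2⁻ⁿ (‖x - y‖_{∞,ν,[-n,n]} ∧ 1)`. -/
instance : TopologicalSpace (PathSpace E ν) :=
  ⨅ n : ℕ, TopologicalSpace.induced (restr (-(n : ℝ)) n) inferInstance

instance : MeasurableSpace (PathSpace E ν) := borel _

instance : BorelSpace (PathSpace E ν) := ⟨rfl⟩

lemma memC0_shift {x : ℝ → E} (hx : ∀ a b : ℝ, MemC0 ν a b (fun t : Icc a b => x t))
    (t a b : ℝ) : MemC0 ν a b (fun s : Icc a b => x (t + s) - x t) := by
  have hmem : ∀ s : Icc a b, t + (s : ℝ) ∈ Icc (t + a) (t + b) := fun s =>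
    ⟨by linarith [s.2.1], by linarith [s.2.2]⟩
  have key : ∀ (C : ℝ≥0) (u : ℝ → E) (c : E),
      HolderWith C ν (fun s : Icc (t + a) (t + b) => u s) →
      HolderWith C ν (fun s : Icc a b => u (t + s) - c) := by
    intro C u c h s₁ s₂
    have := h ⟨_, hmem s₁⟩ ⟨_, hmem s₂⟩
    simpa [edist_sub_right, Subtype.edist_eq, edist_add_left] using this
  obtain ⟨⟨C, hC⟩, h2⟩ := hx (t + a) (t + b)
  refine ⟨⟨C, key C x (x t) hC⟩, fun ε hε => ?_⟩
  obtain ⟨p, hp, hp1, hp2⟩ := h2 ε hε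
  refine ⟨fun s => p (t + s) - x t, ?_, fun s => ?_, ?_⟩
  · exact (hp.comp (contDiff_const.add contDiff_id)).sub contDiff_const
  · have := hp1 ⟨_, hmem s⟩
    simpa using this
  · have := key ε (fun s => x s - p s) 0 hp2
    simpa using this

/-- The shift `(θ_t x)(s) = x(t+s) - x(t)`. -/
def shift (t : ℝ) (x : PathSpace E ν) : PathSpace E ν :=
  ⟨⟨fun s => x (t + s) - x t,
      (x.1.continuous.comp (continuous_const.add continuous_id)).sub continuous_const⟩,
    by simp, fun a b => memC0_shift x.2.2 t a b⟩

end PathSpace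

end HolderSpaces

/-! ### The Young delay equation -/

section Equation

variable {E F : Type*} [NormedAddCommGroup E] [NormedSpace ℝ E] [NormedAddCommGroup F]
  [NormedSpace ℝ F]

/-- The segment `y_t : [-r,0] → E`, `y_t(s) = y(t+s)`. -/
def segment (r : ℝ) (y : C(ℝ, E)) (t : ℝ) : C(Icc (-r) 0, E) :=
  ⟨fun s => y (t + s), y.continuous.comp (continuous_const.add continuous_subtype_val)⟩

/-- The Young integral `∫_a^b G dx` exists and equals `I`: the Riemann–Stieltjes sums over tagged
partitions of `[a,b]` converge to `I` as the mesh tends to zero. -/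
def IsYoungIntegral (G : ℝ → F →L[ℝ] E) (x : ℝ → F) (a b : ℝ) (I : E) : Prop :=
  ∀ ε : ℝ, 0 < ε → ∃ δ : ℝ, 0 < δ ∧ ∀ (n : ℕ) (t τ : ℕ → ℝ), t 0 = a → t n = b →
    (∀ i < n, t i ≤ τ i ∧ τ i ≤ t (i + 1) ∧ t (i + 1) - t i < δ) →
    ‖∑ i ∈ Finset.range n, G (τ i) (x (t (i + 1)) - x (t i)) - I‖ < ε

/-- `y` solves `dy(t) = [B y(t) + f(y_t)] dt + g(y_t) dx(t)`, `t ≥ 0`, `y_0 = η`, in the class of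
paths that are `β₀`-Hölder on every `[-r,T]`. The values of `y` on `(-∞,-r)` play no role. -/
structure IsSolution (r : ℝ) (β₀ : ℝ≥0) (B : E →L[ℝ] E) (f : C(Icc (-r) 0, E) → E)
    (g : C(Icc (-r) 0, E) → F →L[ℝ] E) (x : ℝ → F) (η : C(Icc (-r) 0, E)) (y : C(ℝ, E)) :
    Prop where
  initial : segment r y 0 = η
  holder : ∀ T : ℝ, MemHolder β₀ (fun t : Icc (-r) T => y t)
  equation : ∀ t : ℝ, 0 ≤ t → IsYoungIntegral (fun u => g (segment r y u)) x 0 t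
    (y t - y 0 - ∫ u in (0 : ℝ)..t, (B (y u) + f (segment r y u)))

/-- `φ` is the solution map of the delay equation: for every driving path `x` and every initial
segment `η` there is exactly one solution `y` on `[-r,∞)`, and `φ(t,x,η)(s) = y(t+s)`. -/
def IsGeneratedBy (r : ℝ) (β₀ ν : ℝ≥0) (B : E →L[ℝ] E) (f : C(Icc (-r) 0, E) → E)
    (g : C(Icc (-r) 0, E) → F →L[ℝ] E)
    (φ : ℝ≥0 → PathSpace F ν → C0 E β₀ (-r) 0 → C0 E β₀ (-r) 0) : Prop :=
  ∀ (x : PathSpace F ν) (η : C0 E β₀ (-r) 0), ∃ y : C(ℝ, E),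
    IsSolution r β₀ B f g x η.toCM y ∧
    (∀ z : C(ℝ, E), IsSolution r β₀ B f g x η.toCM z → EqOn z y (Ici (-r))) ∧
    ∀ t : ℝ≥0, (φ t x η).toCM = segment r y t

end Equation

/-! ### Random dynamical systems and random pullback attractors -/

section RDS

variable {Ω S : Type*} [MeasurableSpace Ω]

/-- A metric dynamical system. -/
structure IsMetricDynamicalSystem (P : Measure Ω) (θ : ℝ → Ω → Ω) : Prop where
  measurable : Measurable (fun p : ℝ × Ω => θ p.1 p.2)
  preserving : ∀ t : ℝ, MeasurePreserving (θ t) P P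
  zero : θ 0 = id
  add : ∀ t s : ℝ, θ (t + s) = θ t ∘ θ s

/-- Ergodicity of the flow: invariant events have probability zero or one. -/
def IsErgodicFlow (P : Measure Ω) (θ : ℝ → Ω → Ω) : Prop :=
  ∀ B : Set Ω, MeasurableSet B → (∀ t : ℝ, θ t ⁻¹' B = B) → P B = 0 ∨ P B = 1

/-- A continuous random dynamical system on `S` over `(Ω, P, θ)`, with time `[0,∞)`. -/
structure IsContinuousRDS [TopologicalSpace S] [MeasurableSpace S] (P : Measure Ω)
    (θ : ℝ → Ω → Ω) (φ : ℝ≥0 → Ω → S → S) : Prop where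
  base : IsMetricDynamicalSystem P θ
  measurable : Measurable (fun p : ℝ≥0 × Ω × S => φ p.1 p.2.1 p.2.2)
  continuous : ∀ ω : Ω, Continuous (fun p : ℝ≥0 × S => φ p.1 ω p.2)
  zero : ∀ ω : Ω, φ 0 ω = id
  cocycle : ∀ (t s : ℝ≥0) (ω : Ω), φ (t + s) ω = φ t (θ s ω) ∘ φ s ω

/-- A tempered random variable `ρ ≥ 0`: `lim_{t → ±∞} (1/t) log⁺ ρ(θ_t ω) = 0` almost surely. -/
structure IsTempered (P : Measure Ω) (θ : ℝ → Ω → Ω) (ρ : Ω → ℝ) : Prop where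
  measurable : Measurable ρ
  nonneg : ∀ ω, 0 ≤ ρ ω
  limit_atTop : ∀ᵐ ω ∂P, Tendsto (fun t : ℝ => t⁻¹ * Real.posLog (ρ (θ t ω))) atTop (𝓝 0)
  limit_atBot : ∀ᵐ ω ∂P, Tendsto (fun t : ℝ => t⁻¹ * Real.posLog (ρ (θ t ω))) atBot (𝓝 0)

/-- A random set: a family of subsets of `S` whose graph is measurable in the product. -/
def IsRandomSet [MeasurableSpace S] (D : Ω → Set S) : Prop :=
  MeasurableSet {p : Ω × S | p.2 ∈ D p.1}

/-- The universe of tempered random sets: those contained in balls `B(0,ρ(ω))` of tempered radius,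
along almost every orbit of `θ`. -/
def temperedUniverse [NormedAddCommGroup S] [MeasurableSpace S] (P : Measure Ω)
    (θ : ℝ → Ω → Ω) : Set (Ω → Set S) :=
  {D | IsRandomSet D ∧ ∃ ρ : Ω → ℝ, IsTempered P θ ρ ∧
    ∀ᵐ ω ∂P, ∀ t : ℝ, D (θ t ω) ⊆ Metric.closedBall 0 (ρ (θ t ω))}

/-- A random set with non-empty compact values and measurable distance functions. -/
structure IsCompactRandomSet [MetricSpace S] [MeasurableSpace S] (M : Ω → Set S) : Prop where
  isRandomSet : IsRandomSet M
  isCompact : ∀ ω, IsCompact (M ω)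
  nonempty : ∀ ω, (M ω).Nonempty
  measurable_dist : ∀ y : S, Measurable (fun ω => Metric.infDist y (M ω))

/-- The semi-distance `d(K|M) = sup_{y ∈ K} inf_{z ∈ M} d(y,z)`. -/
def semiDist [MetricSpace S] (K M : Set S) : ℝ≥0∞ := ⨆ y ∈ K, Metric.infEDist y M

/-- `M` is a random pullback attractor of `φ` for the family `𝒟`. -/
structure IsRandomPullbackAttractor [MetricSpace S] [MeasurableSpace S] (P : Measure Ω)
    (θ : ℝ → Ω → Ω) (φ : ℝ≥0 → Ω → S → S) (𝒟 : Set (Ω → Set S)) (M : Ω → Set S) : Prop where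
  compact : IsCompactRandomSet M
  invariant : ∀ᵐ ω ∂P, ∀ t : ℝ≥0, φ t ω '' M ω = M (θ t ω)
  attracts : ∀ D ∈ 𝒟, ∀ᵐ ω ∂P, Tendsto
    (fun t : ℝ≥0 => semiDist (φ t (θ (-t) ω) '' D (θ (-t) ω)) (M ω)) atTop (𝓝 0)

end RDS

end YoungDelay

end

/-! Analysis of the equation. The germ `G s (x t - x s)` of a Young integral is additive up to an
error of order `α + ν > 1`, so the sewing estimate (`SewnBy.improve`) controls the integral. A
solution is therefore the same thing as a path whose drift-free part is described by this germ up to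
order `β₀ + ν` (`IsDavieSolution`). This local description survives limits, translations and changes
of the driver. On a short interval of length `τ` all terms in the difference of two solutions gain a
factor `τ ^ (ν - β₀)`. Absorbing them and iterating over finitely many intervals yields uniqueness
and local Lipschitz dependence on the initial segment and the driver (`exists_stability_const`).
Smooth drivers are handled by a contraction argument. A general driver lies in the closure of the
smooth ones, and the corresponding solutions form a Cauchy sequence by stability, once they are
uniformly bounded.

The uniform bound is the heart of the matter (`exists_apriori_bound`). Since `g` is bounded by `K`,
interpolating between this bound and the `β₀`-Hölder bound `Cg * h` of `g(y_t)` gives an `α`-Hölder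
constant of order `h ^ γ`, where `1 - ν < α < β₀` and `γ = α / β₀ < 1`. The noise term thus grows
sublinearly in `h` and is at most `ε * h + Cε * (1 + q) ^ p` for every `ε > 0`, with `q` the Hölder
constant of the driver. For this reason no smallness of `Cg` is needed. The rest is variation of
constants in norms weighted by `exp (-μ t)` on a grid of mesh `r`. There `CA * Cf < lam` makes the
nonlinearity `f` a contraction for small `μ`.

Dynamics. After sufficiently many grid cells the flow satisfies `‖φ η‖ ≤ ‖η‖ / 2 + Q x` with `Q`
polynomial in the noise, and its values are bounded in the `ν`-Hölder norm, hence lie in compact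
subsets of `C^{0,β₀}`. Stationarity and the moment condition make the noise grow at an arbitrarily
small exponential rate along almost every orbit, on a measurable shift-invariant set of paths.
Discounted sums of `Q` along the past then converge and give the radius of an absorbing ball. The
attractor is the intersection of the pullback images of these balls. Nested compactness gives
non-emptiness, invariance and attraction, and countable dense families give measurability. On the
exceptional set of paths the attractor is declared to be `{0}`, so that its regularity holds for
every path. -/

set_option linter.unusedSectionVars false

noncomputable section

namespace YoungDelay

/-! ### Hölder bounds with explicit constants on intervals -/

section HolderBound

variable {E : Type*} [NormedAddCommGroup E]

/-- `y` satisfies an `α`-Hölder bound with constant `H` on `[a,b]`. -/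
def HolderBound (α H a b : ℝ) (y : ℝ → E) : Prop :=
  ∀ s t, a ≤ s → s ≤ t → t ≤ b → ‖y t - y s‖ ≤ H * (t - s) ^ α

namespace HolderBound

variable {α H a b : ℝ} {y z : ℝ → E}

lemma mono (h : HolderBound α H a b y) {H' a' b' : ℝ} (hH : H ≤ H') (ha : a ≤ a') (hb : b' ≤ b) :
    HolderBound α H' a' b' y := fun s t hs hst ht =>
  (h s t (ha.trans hs) hst (ht.trans hb)).trans
    (mul_le_mul_of_nonneg_right hH (Real.rpow_nonneg (sub_nonneg.2 hst) _))

lemma congr (h : HolderBound α H a b y) (hz : ∀ t ∈ Icc a b, z t = y t) :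
    HolderBound α H a b z := fun s t hs hst ht => by
  rw [hz t ⟨hs.trans hst, ht⟩, hz s ⟨hs, hst.trans ht⟩]
  exact h s t hs hst ht

lemma const_nonneg (h : HolderBound α H a b y) (hab : a < b) : 0 ≤ H := by
  have h1 := (norm_nonneg _).trans (h a b le_rfl hab.le le_rfl)
  have h2 : 0 < (b - a) ^ α := Real.rpow_pos_of_pos (sub_pos.2 hab) _
  exact nonneg_of_mul_nonneg_left h1 h2

lemma sub (h : HolderBound α H a b y) {H' : ℝ} (h' : HolderBound α H' a b z) :
    HolderBound α (H + H') a b (fun t => y t - z t) := fun s t hs hst ht => by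
  have e : y t - z t - (y s - z s) = (y t - y s) - (z t - z s) := by abel
  simp only [e, add_mul]
  exact (norm_sub_le _ _).trans (add_le_add (h s t hs hst ht) (h' s t hs hst ht))

lemma add (h : HolderBound α H a b y) {H' : ℝ} (h' : HolderBound α H' a b z) :
    HolderBound α (H + H') a b (fun t => y t + z t) := fun s t hs hst ht => by
  have e : y t + z t - (y s + z s) = (y t - y s) + (z t - z s) := by abel
  simp only [e, add_mul]
  exact (norm_add_le _ _).trans (add_le_add (h s t hs hst ht) (h' s t hs hst ht))

/-- Increments across `b` split there, and both pieces of the interval are shorter than the whole,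
so the constants simply add. -/
lemma trans {H' c : ℝ} (h : HolderBound α H a b y) (h' : HolderBound α H' b c y) (hα : 0 ≤ α)
    (hH : 0 ≤ H) (hH' : 0 ≤ H') : HolderBound α (H + H') a c y := fun s t hs hst ht => by
  have hp : 0 ≤ (t - s) ^ α := Real.rpow_nonneg (sub_nonneg.2 hst) _
  rcases le_total t b with htb | hbt
  · exact (h s t hs hst htb).trans (by nlinarith)
  rcases le_total b s with hbs | hsb
  · exact (h' s t hbs hst ht).trans (by nlinarith)
  have e : y t - y s = (y t - y b) + (y b - y s) := by abel
  have h1 : (t - b) ^ α ≤ (t - s) ^ α := Real.rpow_le_rpow (by linarith) (by linarith) hα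
  have h2 : (b - s) ^ α ≤ (t - s) ^ α := Real.rpow_le_rpow (by linarith) (by linarith) hα
  rw [e, add_mul, add_comm (H * _)]
  refine (norm_add_le _ _).trans (add_le_add ((h' b t le_rfl hbt ht).trans ?_)
    ((h s b hs hsb le_rfl).trans ?_)) <;> gcongr

lemma comp_add (h : HolderBound α H a b y) (c : ℝ) :
    HolderBound α H (a - c) (b - c) (fun t => y (c + t)) := fun s t hs hst ht => by
  have := h (c + s) (c + t) (by linarith) (by linarith) (by linarith)
  simpa using this

lemma of_exponent_le (h : HolderBound α H a b y) {β L : ℝ} (hβ0 : 0 < β) (hβ : β ≤ α)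
    (hH : 0 ≤ H) (hL : b - a ≤ L) : HolderBound β (H * L ^ (α - β)) a b y :=
  fun s t hs hst ht => by
  refine (h s t hs hst ht).trans ?_
  rcases hst.eq_or_lt with rfl | hlt
  · rw [sub_self, Real.zero_rpow hβ0.ne', Real.zero_rpow (hβ0.trans_le hβ).ne', mul_zero, mul_zero]
  · have h0 : 0 < t - s := sub_pos.2 hlt
    have e : (t - s) ^ α = (t - s) ^ (α - β) * (t - s) ^ β := by
      rw [← Real.rpow_add h0]; ring_nf
    rw [e, mul_assoc]
    gcongr
    · linarith

lemma norm_le (h : HolderBound α H a b y) {t : ℝ} (ha : a ≤ t) (hb : t ≤ b) :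
    ‖y t‖ ≤ ‖y a‖ + H * (t - a) ^ α := by
  have h1 := h a t le_rfl ha hb
  have h2 := norm_add_le (y t - y a) (y a)
  rw [sub_add_cancel] at h2
  linarith

lemma abs_bound (h : HolderBound α H a b y) {s t : ℝ} (hs : s ∈ Icc a b) (ht : t ∈ Icc a b) :
    ‖y t - y s‖ ≤ H * |t - s| ^ α := by
  rcases le_total s t with hst | hts
  · rw [abs_of_nonneg (sub_nonneg.2 hst)]
    exact h s t hs.1 hst ht.2
  · rw [abs_sub_comm, abs_of_nonneg (sub_nonneg.2 hts), norm_sub_rev]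
    exact h t s ht.1 hts hs.2

lemma continuousOn (h : HolderBound α H a b y) (hα : 0 < α) : ContinuousOn y (Icc a b) := by
  intro s hs
  rw [ContinuousWithinAt, tendsto_iff_norm_sub_tendsto_zero]
  have hlim : Tendsto (fun t : ℝ => H * |t - s| ^ α) (𝓝[Icc a b] s) (𝓝 0) := by
    have hc : Continuous fun t : ℝ => H * |t - s| ^ α :=
      continuous_const.mul ((continuous_id.sub continuous_const).abs.rpow_const
        fun _ => Or.inr hα.le)
    have := (hc.tendsto s).mono_left (nhdsWithin_le_nhds (s := Icc a b))
    simpa [Real.zero_rpow hα.ne'] using this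
  refine squeeze_zero' (Eventually.of_forall fun _ => norm_nonneg _) ?_ hlim
  filter_upwards [self_mem_nhdsWithin] with t ht
  exact h.abs_bound hs ht

end HolderBound

lemma holderBound_of_tendsto {ι : Type*} {l : Filter ι} [l.NeBot] {α H a b : ℝ}
    {u : ι → ℝ → E} {y : ℝ → E} (hu : ∀ᶠ i in l, HolderBound α H a b (u i))
    (hy : ∀ t ∈ Icc a b, Tendsto (fun i => u i t) l (𝓝 (y t))) : HolderBound α H a b y :=
  fun s t hs hst ht => by
  have h1 := (hy t ⟨hs.trans hst, ht⟩).sub (hy s ⟨hs, hst.trans ht⟩)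
  refine le_of_tendsto h1.norm ?_
  filter_upwards [hu] with i hi using hi s t hs hst ht

end HolderBound

/-- A closed property of bounds that improves affinely with rate `κ < 1` holds at the fixed point
of the affine map. -/
lemma of_affine_step {P : ℝ → Prop} {c κ : ℝ} (hκ0 : 0 ≤ κ) (hκ : κ < 1) (hc : 0 ≤ c)
    (hlim : ∀ (u : ℕ → ℝ) (Z : ℝ), Tendsto u atTop (𝓝 Z) → (∀ k, P (u k)) → P Z)
    (h0 : ∃ Z, 0 ≤ Z ∧ P Z) (step : ∀ Z, 0 ≤ Z → P Z → P (c + κ * Z)) : P (c / (1 - κ)) := by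
  obtain ⟨Z₀, hZ₀, hP⟩ := h0
  have h1 : (0 : ℝ) < 1 - κ := sub_pos.2 hκ
  set W := c / (1 - κ) with hW
  have hW' : c + κ * W = W := by rw [hW]; field_simp; ring
  -- Iterating the affine map from `Z₀` produces `W + κ ^ k * (Z₀ - W)`, which converges to the
  -- fixed point `W`. Any finite starting bound, however bad, is thus replaced by `W`.
  have key : ∀ k : ℕ, 0 ≤ W + κ ^ k * (Z₀ - W) ∧ P (W + κ ^ k * (Z₀ - W)) := by
    intro k
    induction k with
    | zero => simpa using ⟨hZ₀, hP⟩
    | succ k ih =>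
      have e : W + κ ^ (k + 1) * (Z₀ - W) = c + κ * (W + κ ^ k * (Z₀ - W)) := by
        rw [pow_succ]; linear_combination -hW'
      rw [e]
      exact ⟨by have := mul_nonneg hκ0 ih.1; linarith, step _ ih.1 ih.2⟩
  refine hlim (fun k => W + κ ^ k * (Z₀ - W)) W ?_ fun k => (key k).2
  have := ((tendsto_pow_atTop_nhds_zero_of_lt_one hκ0 hκ).mul_const (Z₀ - W)).const_add W
  rwa [zero_mul, add_zero] at this

lemma holderBound_of_tendsto_const {E : Type*} [NormedAddCommGroup E] {α a b Z : ℝ} {y : ℝ → E}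
    {u : ℕ → ℝ} (hu : Tendsto u atTop (𝓝 Z)) (h : ∀ k, HolderBound α (u k) a b y) :
    HolderBound α Z a b y := fun s t hs hst ht =>
  ge_of_tendsto' (hu.mul_const _) fun k => h k s t hs hst ht

/-! ### The sewing estimate -/

section Sewing

variable {E : Type*} [NormedAddCommGroup E]

/-- The increments of `J` on `[a,b]` are described by the germ `Ξ` up to order `θ`. -/
def SewnBy (θ C a b : ℝ) (Ξ : ℝ → ℝ → E) (J : ℝ → E) : Prop :=
  ∀ s t, a ≤ s → s ≤ t → t ≤ b → ‖J t - J s - Ξ s t‖ ≤ C * (t - s) ^ θ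

/-- The constant of the sewing lemma. -/
def sewingConst (θ : ℝ) : ℝ := 1 / (1 - 2 * (1 / 2) ^ θ)

lemma two_mul_half_rpow_lt_one {θ : ℝ} (hθ : 1 < θ) : 2 * (1 / 2 : ℝ) ^ θ < 1 := by
  have : (1 / 2 : ℝ) ^ θ < (1 / 2 : ℝ) ^ (1 : ℝ) :=
    Real.rpow_lt_rpow_of_exponent_gt (by norm_num) (by norm_num) hθ
  rw [Real.rpow_one] at this
  linarith

lemma sewingConst_pos {θ : ℝ} (hθ : 1 < θ) : 0 < sewingConst θ :=
  one_div_pos.2 (sub_pos.2 (two_mul_half_rpow_lt_one hθ))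

/-- The sewing estimate: a qualitative remainder bound implies the quantitative one. -/
lemma SewnBy.improve {θ K C a b : ℝ} (hθ : 1 < θ) (hK : 0 ≤ K) {Ξ : ℝ → ℝ → E} {J : ℝ → E}
    (hJ : SewnBy θ C a b Ξ J)
    (hδ : ∀ s u t, a ≤ s → s ≤ u → u ≤ t → t ≤ b →
      ‖Ξ s t - Ξ s u - Ξ u t‖ ≤ K * (t - s) ^ θ) : SewnBy θ (sewingConst θ * K) a b Ξ J := by
  have hκ := two_mul_half_rpow_lt_one hθ
  have main : SewnBy θ (K / (1 - 2 * (1 / 2) ^ θ)) a b Ξ J := by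
    refine of_affine_step (P := fun Z => SewnBy θ Z a b Ξ J) (by positivity) hκ hK
      (fun u Z hu h s t hs hst ht => ge_of_tendsto' (hu.mul_const _) fun k => h k s t hs hst ht)
      ⟨|C|, abs_nonneg _, fun s t hs hst ht => (hJ s t hs hst ht).trans
        (mul_le_mul_of_nonneg_right (le_abs_self C) (Real.rpow_nonneg (sub_nonneg.2 hst) _))⟩
      fun Z hZ hP s t hs hst ht => ?_
    -- Bisection at the midpoint: the two halves contribute `2 * (1 / 2) ^ θ * Z` and the defect
    -- contributes `K`, so the constant improves affinely, with a rate below one because `θ > 1`.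
    have hsu : s ≤ (s + t) / 2 := by linarith
    have hut : (s + t) / 2 ≤ t := by linarith
    have h1 := hP s ((s + t) / 2) hs hsu (hut.trans ht)
    have h2 := hP ((s + t) / 2) t (hs.trans hsu) hut ht
    have h3 := hδ s ((s + t) / 2) t hs hsu hut ht
    have e1 : (s + t) / 2 - s = 1 / 2 * (t - s) := by ring
    have e2 : t - (s + t) / 2 = 1 / 2 * (t - s) := by ring
    rw [e1, Real.mul_rpow (by norm_num) (sub_nonneg.2 hst)] at h1
    rw [e2, Real.mul_rpow (by norm_num) (sub_nonneg.2 hst)] at h2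
    have e : J t - J s - Ξ s t = (J ((s + t) / 2) - J s - Ξ s ((s + t) / 2))
        + (J t - J ((s + t) / 2) - Ξ ((s + t) / 2) t)
        - (Ξ s t - Ξ s ((s + t) / 2) - Ξ ((s + t) / 2) t) := by abel
    rw [e]
    refine (norm_sub_le _ _).trans ((add_le_add ((norm_add_le _ _).trans (add_le_add h1 h2))
      h3).trans_eq ?_)
    ring
  rwa [sewingConst, one_div_mul_eq_div]

lemma SewnBy.mono {θ C C' a b a' b' : ℝ} {Ξ : ℝ → ℝ → E} {J : ℝ → E} (h : SewnBy θ C a b Ξ J)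
    (hC : C ≤ C') (ha : a ≤ a') (hb : b' ≤ b) : SewnBy θ C' a' b' Ξ J := fun s t hs hst ht =>
  (h s t (ha.trans hs) hst (ht.trans hb)).trans
    (mul_le_mul_of_nonneg_right hC (Real.rpow_nonneg (sub_nonneg.2 hst) _))

lemma SewnBy.sub {θ C C' a b : ℝ} {Ξ Ξ' : ℝ → ℝ → E} {J J' : ℝ → E} (h : SewnBy θ C a b Ξ J)
    (h' : SewnBy θ C' a b Ξ' J') :
    SewnBy θ (C + C') a b (fun s t => Ξ s t - Ξ' s t) (fun t => J t - J' t) :=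
  fun s t hs hst ht => by
  have e : J t - J' t - (J s - J' s) - (Ξ s t - Ξ' s t)
      = (J t - J s - Ξ s t) - (J' t - J' s - Ξ' s t) := by abel
  simp only [e, add_mul]
  exact (norm_sub_le _ _).trans (add_le_add (h s t hs hst ht) (h' s t hs hst ht))

/-- Lowering the order of the remainder on a bounded interval. -/
lemma SewnBy.of_order_le {θ θ' C a b : ℝ} {Ξ : ℝ → ℝ → E} {J : ℝ → E} (h : SewnBy θ C a b Ξ J)
    (hC : 0 ≤ C) (hθ' : 0 < θ') (hθ : θ' ≤ θ) :
    SewnBy θ' (C * (b - a) ^ (θ - θ')) a b Ξ J := fun s t hs hst ht => by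
  refine (h s t hs hst ht).trans ?_
  rcases hst.eq_or_lt with rfl | hlt
  · rw [sub_self, Real.zero_rpow hθ'.ne', Real.zero_rpow (hθ'.trans_le hθ).ne', mul_zero, mul_zero]
  · have h0 : 0 < t - s := sub_pos.2 hlt
    have e : (t - s) ^ θ = (t - s) ^ (θ - θ') * (t - s) ^ θ' := by
      rw [← Real.rpow_add h0]; ring_nf
    rw [e, mul_assoc]
    gcongr

end Sewing

end YoungDelay

namespace YoungDelay

/-! ### Translation between the Hölder classes of the statement and real Hölder bounds -/

section Interface

variable {E : Type*} [NormedAddCommGroup E]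

lemma holderWith_iff {α C : ℝ≥0} {a b : ℝ} {u : Icc a b → E} :
    HolderWith C α u ↔ ∀ s t : Icc a b, (s : ℝ) ≤ t → ‖u t - u s‖ ≤ C * ((t : ℝ) - s) ^ (α : ℝ) := by
  constructor
  · intro h s t hst
    have := h.dist_le t s
    rwa [dist_eq_norm, Subtype.dist_eq, Real.dist_eq, abs_of_nonneg (sub_nonneg.2 hst)] at this
  · intro h
    have key : ∀ s t : Icc a b, (s : ℝ) ≤ t → edist (u s) (u t) ≤ C * edist s t ^ (α : ℝ) := by
      intro s t hst
      have h1 := h s t hst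
      rw [← dist_eq_norm, dist_comm] at h1
      rw [edist_dist, edist_dist s t, Subtype.dist_eq, dist_comm (s : ℝ), Real.dist_eq,
        abs_of_nonneg (sub_nonneg.2 hst), ENNReal.ofReal_rpow_of_nonneg (sub_nonneg.2 hst) α.coe_nonneg,
        ← ENNReal.ofReal_coe_nnreal, ← ENNReal.ofReal_mul C.coe_nonneg]
      exact ENNReal.ofReal_le_ofReal h1
    intro s t
    rcases le_total (s : ℝ) t with hst | hst
    · exact key s t hst
    · rw [edist_comm, edist_comm s]
      exact key t s hst

lemma holderWith_iff_holderBound {α C : ℝ≥0} {a b : ℝ} {y : ℝ → E} :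
    HolderWith C α (fun t : Icc a b => y t) ↔ HolderBound α C a b y := by
  rw [holderWith_iff]
  exact ⟨fun h s t hs hst ht => h ⟨s, hs, hst.trans ht⟩ ⟨t, hs.trans hst, ht⟩ hst,
    fun h s t hst => h s t s.2.1 hst t.2.2⟩

lemma memHolder_iff_holderBound {α : ℝ≥0} {a b : ℝ} {y : ℝ → E} :
    MemHolder α (fun t : Icc a b => y t) ↔ ∃ H, 0 ≤ H ∧ HolderBound α H a b y :=
  ⟨fun ⟨C, hC⟩ => ⟨C, C.2, holderWith_iff_holderBound.1 hC⟩,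
    fun ⟨H, hH, h⟩ => ⟨⟨H, hH⟩, holderWith_iff_holderBound.2 h⟩⟩

lemma MemC0.exists_smooth [NormedSpace ℝ E] {α : ℝ≥0} {a b : ℝ} {y : ℝ → E}
    (h : MemC0 α a b (fun t : Icc a b => y t)) {ε : ℝ} (hε : 0 < ε) :
    ∃ p : ℝ → E, ContDiff ℝ (⊤ : ℕ∞) p ∧ (∀ t ∈ Icc a b, ‖y t - p t‖ ≤ ε) ∧
      HolderBound α ε a b (fun t => y t - p t) := by
  obtain ⟨p, hp, h1, h2⟩ := h.2 ⟨ε, hε.le⟩ hε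
  refine ⟨p, hp, fun t ht => h1 ⟨t, ht⟩, ?_⟩
  exact (holderWith_iff_holderBound (C := ⟨ε, hε.le⟩) (y := fun t => y t - p t)).1 h2

end Interface

/-! ### The Young integral: existence, Riemann–Stieltjes sums, uniqueness -/

section Young

variable {E F : Type*} [NormedAddCommGroup E] [NormedSpace ℝ E] [NormedAddCommGroup F]
  [NormedSpace ℝ F]

/-- The germ `G(s)(x(t) - x(s))` of the Young integral. -/
def youngGerm (G : ℝ → F →L[ℝ] E) (x : ℝ → F) (s t : ℝ) : E := G s (x t - x s)

/-- The defect is the product of the increments `G u - G s` and `x t - x u`, so its order is the sum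
of the two Hölder exponents. This is where `α + ν > 1` enters the theory. -/
lemma youngGerm_defect {α ν HG Hx a b : ℝ} (hα : 0 ≤ α) (hν : 0 ≤ ν) (hG0 : 0 ≤ HG)
    {G : ℝ → F →L[ℝ] E} {x : ℝ → F} (hG : HolderBound α HG a b G) (hx : HolderBound ν Hx a b x)
    (s u t : ℝ) (hs : a ≤ s) (hsu : s ≤ u) (hut : u ≤ t) (ht : t ≤ b) :
    ‖youngGerm G x s t - youngGerm G x s u - youngGerm G x u t‖ ≤ HG * Hx * (t - s) ^ (α + ν) := by
  have e : youngGerm G x s t - youngGerm G x s u - youngGerm G x u t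
      = -((G u - G s) (x t - x u)) := by
    simp only [youngGerm, sub_apply, map_sub]; abel
  have hst := hsu.trans hut
  rw [e, norm_neg, Real.rpow_add_of_nonneg (sub_nonneg.2 hst) hα hν]
  have h1 := hG s u hs hsu (hut.trans ht)
  have h2 := hx u t (hs.trans hsu) hut ht
  have h3 : (u - s) ^ α ≤ (t - s) ^ α := Real.rpow_le_rpow (by linarith) (by linarith) hα
  have h4 : (t - u) ^ ν ≤ (t - s) ^ ν := Real.rpow_le_rpow (by linarith) (by linarith) hν
  have hp : 0 ≤ (u - s) ^ α := Real.rpow_nonneg (sub_nonneg.2 hsu) _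
  have hq : 0 ≤ (t - u) ^ ν := Real.rpow_nonneg (sub_nonneg.2 hut) _
  calc _ ≤ ‖G u - G s‖ * ‖x t - x u‖ := ContinuousLinearMap.le_opNorm _ _
    _ ≤ (HG * (u - s) ^ α) * (Hx * (t - u) ^ ν) := by gcongr
    _ = HG * Hx * ((u - s) ^ α * (t - u) ^ ν) := by ring
    _ ≤ HG * Hx * ((t - s) ^ α * (t - s) ^ ν) := by
        -- The constant `Hx` is known to be nonnegative only on a nondegenerate interval, so the
        -- case `s = t` is separated.
        rcases hst.eq_or_lt with rfl | hlt
        · obtain rfl : s = u := le_antisymm hsu hut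
          rfl
        have hH : 0 ≤ Hx := hx.const_nonneg (by linarith)
        gcongr

/-- For a continuously differentiable driver the Riemann integral is sewn by the Young germ. -/
lemma sewnBy_smooth [CompleteSpace E] {α ν HG a b : ℝ} (hα : 0 < α) (hν0 : 0 ≤ ν) (hν : ν ≤ 1)
    (hG0 : 0 ≤ HG) {G : ℝ → F →L[ℝ] E} {p : ℝ → F} (hGc : Continuous G) (hp : ContDiff ℝ 1 p)
    (hG : HolderBound α HG a b G) :
    ∃ C, SewnBy (α + ν) C a b (youngGerm G p) (fun t => ∫ u in a..t, G u (deriv p u)) := by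
  have hp' : Continuous (deriv p) := hp.continuous_deriv le_rfl
  obtain ⟨M, hM⟩ := isCompact_Icc.exists_bound_of_continuousOn (s := Icc a b) hp'.continuousOn
  have hcont : Continuous fun u => G u (deriv p u) := hGc.clm_apply hp'
  -- With a `C¹` driver, freezing `G` at the left endpoint costs order `α + 1`, which is at least `α
  -- + ν` and can be lowered afterwards.
  have key : SewnBy (α + 1) (HG * |M|) a b (youngGerm G p)
      (fun t => ∫ u in a..t, G u (deriv p u)) := by
    intro s t hs hst ht
    have hc2 : Continuous fun u => G s (deriv p u) := (G s).continuous.comp hp'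
    have e1 : youngGerm G p s t = ∫ u in s..t, G s (deriv p u) := by
      rw [youngGerm, map_sub]
      refine (intervalIntegral.integral_eq_sub_of_hasDerivAt (f := fun u => G s (p u))
        (fun u _ => ?_) (hc2.intervalIntegrable _ _)).symm
      exact (G s).hasFDerivAt.comp_hasDerivAt u
        ((hp.differentiable one_ne_zero).differentiableAt.hasDerivAt)
    have e2 : (∫ u in a..t, G u (deriv p u)) - (∫ u in a..s, G u (deriv p u))
        = ∫ u in s..t, G u (deriv p u) :=
      intervalIntegral.integral_interval_sub_left (hcont.intervalIntegrable _ _)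
        (hcont.intervalIntegrable _ _)
    rw [e1, e2, ← intervalIntegral.integral_sub (hcont.intervalIntegrable _ _)
      (hc2.intervalIntegrable _ _)]
    have h := intervalIntegral.norm_integral_le_of_norm_le_const (a := s) (b := t)
      (f := fun u => G u (deriv p u) - G s (deriv p u)) (C := HG * (t - s) ^ α * |M|) ?_
    · refine h.trans_eq ?_
      rw [abs_of_nonneg (sub_nonneg.2 hst), Real.rpow_add_of_nonneg (sub_nonneg.2 hst) hα.le
        zero_le_one, Real.rpow_one]
      ring
    · intro u hu
      rw [uIoc_of_le hst] at hu
      have h1 := hG s u hs hu.1.le (hu.2.trans ht)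
      have h2 := (hM u ⟨hs.trans hu.1.le, hu.2.trans ht⟩).trans (le_abs_self M)
      have h3 : (u - s) ^ α ≤ (t - s) ^ α :=
        Real.rpow_le_rpow (by linarith [hu.1]) (by linarith [hu.2]) hα.le
      rw [← sub_apply]
      calc _ ≤ ‖G u - G s‖ * ‖deriv p u‖ := ContinuousLinearMap.le_opNorm _ _
        _ ≤ (HG * (t - s) ^ α) * |M| := by
          gcongr
          exact h1.trans (by gcongr)
  exact ⟨_, key.of_order_le (by positivity) (by positivity) (by linarith)⟩

lemma sewnBy_of_tendsto {ι : Type*} {l : Filter ι} [l.NeBot] {θ C a b : ℝ} {Ξ : ℝ → ℝ → E}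
    {J : ℝ → E} {Ξn : ι → ℝ → ℝ → E} {Jn : ι → ℝ → E}
    (h : ∀ᶠ i in l, SewnBy θ C a b (Ξn i) (Jn i))
    (hJ : ∀ t ∈ Icc a b, Tendsto (fun i => Jn i t) l (𝓝 (J t)))
    (hΞ : ∀ s ∈ Icc a b, ∀ t ∈ Icc a b, Tendsto (fun i => Ξn i s t) l (𝓝 (Ξ s t))) :
    SewnBy θ C a b Ξ J := fun s t hs hst ht => by
  have ms : s ∈ Icc a b := ⟨hs, hst.trans ht⟩
  have mt : t ∈ Icc a b := ⟨hs.trans hst, ht⟩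
  refine le_of_tendsto (((hJ t mt).sub (hJ s ms)).sub (hΞ s ms t mt)).norm ?_
  filter_upwards [h] with i hi using hi s t hs hst ht

lemma HolderBound.of_smooth_approx {ν H ε a b : ℝ} {x p : ℝ → F} (hx : HolderBound ν H a b x)
    (hp : HolderBound ν ε a b (fun t => x t - p t)) : HolderBound ν (H + ε) a b p := by
  have := hx.sub hp
  simpa using this

/-- Existence of the Young integral against a path in the closure of the smooth paths. -/
theorem exists_sewnBy_youngGerm [CompleteSpace E] {α HG Hx a b : ℝ} {ν : ℝ≥0} (hα : 0 < α)
    (hν : (ν : ℝ) ≤ 1) (hθ : 1 < α + ν) (hG0 : 0 ≤ HG) (hx0 : 0 ≤ Hx) {G : ℝ → F →L[ℝ] E}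
    {x : ℝ → F} (hGc : Continuous G) (hG : HolderBound α HG a b G) (hx : HolderBound ν Hx a b x)
    (hmem : MemC0 ν a b (fun t : Icc a b => x t)) :
    ∃ J : ℝ → E, SewnBy (α + ν) (sewingConst (α + ν) * (HG * Hx)) a b (youngGerm G x) J := by
  have hc0 := sewingConst_pos hθ
  let ε : ℕ → ℝ := fun n => 1 / ((n : ℝ) + 1)
  have hε : ∀ n, 0 < ε n := fun n => by positivity
  have hε1 : ∀ n, ε n ≤ 1 := fun n => by
    simp only [ε]; rw [div_le_one (by positivity)]; linarith [n.cast_nonneg (α := ℝ)]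
  have hεmono : ∀ {N n : ℕ}, N ≤ n → ε n ≤ ε N := fun {N n} h => by simp only [ε]; gcongr
  have hεlim : Tendsto ε atTop (𝓝 0) := tendsto_one_div_add_atTop_nhds_zero_nat
  choose p hp hp1 hp2 using fun n => hmem.exists_smooth (hε n)
  let J : ℕ → ℝ → E := fun n t => ∫ u in a..t, G u (deriv (p n) u)
  have hJ : ∀ n, SewnBy (α + ν) (sewingConst (α + ν) * (HG * (Hx + 1))) a b
      (youngGerm G (p n)) (J n) := fun n => by
    obtain ⟨C, hC⟩ := sewnBy_smooth (ν := ν) hα ν.2 hν hG0 hGc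
      ((hp n).of_le (by exact_mod_cast le_top)) hG
    refine hC.improve hθ (by positivity) (youngGerm_defect hα.le ν.2 hG0 hG ?_)
    exact (hx.of_smooth_approx (hp2 n)).mono (by linarith [hε1 n]) le_rfl le_rfl
  -- The germ is linear in the driver, so the difference of two approximate integrals is sewn by the
  -- germ of `p n - p m`, whose Hölder constant is `ε n + ε m`. Re-running the estimate turns this
  -- into a Cauchy property of `J`.
  have hdiff : ∀ n m, SewnBy (α + ν) (sewingConst (α + ν) * (HG * (ε n + ε m))) a b
      (youngGerm G (fun t => p n t - p m t)) (fun t => J n t - J m t) := fun n m => by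
    have h1 := (hJ n).sub (hJ m)
    have e : (fun s t => youngGerm G (p n) s t - youngGerm G (p m) s t)
        = youngGerm G (fun t => p n t - p m t) := by
      funext s t; simp only [youngGerm, map_sub]; abel
    rw [e] at h1
    refine h1.improve hθ (mul_nonneg hG0 (by linarith [hε n, hε m]))
      (youngGerm_defect hα.le ν.2 hG0 hG ?_)
    have := (hp2 m).sub (hp2 n)
    rw [add_comm] at this
    simpa using this
  have hlim : ∀ t, ∃ ℓ, t ∈ Icc a b → Tendsto (fun n => J n t) atTop (𝓝 ℓ) := by
    intro t
    by_cases ht : t ∈ Icc a b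
    swap
    · exact ⟨0, fun h => (ht h).elim⟩
    set D := sewingConst (α + ν) * HG * (t - a) ^ (α + ν) + 2 * ‖G a‖ with hD
    have hta : 0 ≤ (t - a) ^ (α + (ν : ℝ)) := Real.rpow_nonneg (sub_nonneg.2 ht.1) _
    have hD0 : 0 ≤ D := by positivity
    have hcau : CauchySeq fun n => J n t := by
      refine cauchySeq_of_le_tendsto_0 (fun N => D * (2 * ε N)) (fun n m N hn hm => ?_) ?_
      · have h1 := hdiff n m a t le_rfl ht.1 ht.2
        have e0 : ∀ k, J k a = 0 := fun k => intervalIntegral.integral_same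
        simp only [e0, sub_zero, youngGerm] at h1
        have ha : a ∈ Icc a b := ⟨le_rfl, ht.1.trans ht.2⟩
        have h2 : ‖p n t - p m t - (p n a - p m a)‖ ≤ 2 * (ε n + ε m) := by
          have e : p n t - p m t - (p n a - p m a) = (x t - p m t) - (x t - p n t)
            - ((x a - p m a) - (x a - p n a)) := by abel
          rw [e]
          have := hp1 n t ht; have := hp1 m t ht; have := hp1 n a ha; have := hp1 m a ha
          have := norm_sub_le ((x t - p m t) - (x t - p n t)) ((x a - p m a) - (x a - p n a))
          have := norm_sub_le (x t - p m t) (x t - p n t)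
          have := norm_sub_le (x a - p m a) (x a - p n a)
          linarith
        have h3 := ((G a).le_opNorm (p n t - p m t - (p n a - p m a))).trans
          (mul_le_mul_of_nonneg_left h2 (norm_nonneg _))
        rw [dist_eq_norm]
        have h4 := norm_sub_norm_le (J n t - J m t) (G a (p n t - p m t - (p n a - p m a)))
        have h5 : ε n + ε m ≤ 2 * ε N := by linarith [hεmono hn, hεmono hm]
        calc ‖J n t - J m t‖ ≤ D * (ε n + ε m) := by rw [hD]; linarith
          _ ≤ D * (2 * ε N) := by gcongr
      · simpa using (hεlim.const_mul 2).const_mul D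
    obtain ⟨ℓ, hℓ⟩ := cauchySeq_tendsto_of_complete hcau
    exact ⟨ℓ, fun _ => hℓ⟩
  choose L hL using hlim
  have hpt : ∀ t ∈ Icc a b, Tendsto (fun n => p n t) atTop (𝓝 (x t)) := fun t ht => by
    rw [tendsto_iff_norm_sub_tendsto_zero]
    refine squeeze_zero (fun _ => norm_nonneg _) (fun n => ?_) hεlim
    rw [norm_sub_rev]
    exact hp1 n t ht
  -- The limit inherits the constant containing `Hx + 1`; one further improvement replaces it by the
  -- one containing `Hx`.
  refine ⟨L, (sewnBy_of_tendsto (Eventually.of_forall hJ) (fun t ht => hL t ht)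
    (fun s hs t ht => ?_)).improve hθ (by positivity) (youngGerm_defect hα.le ν.2 hG0 hG hx)⟩
  exact ((G s).continuous.tendsto _).comp ((hpt t ht).sub (hpt s hs))

/-- The Riemann–Stieltjes sums converge to the sewn increments. -/
theorem isYoungIntegral_of_sewnBy {α ν C HG Hx a b : ℝ} (hα : 0 ≤ α) (hν : 0 ≤ ν)
    (hθ : 1 < α + ν) (hG0 : 0 ≤ HG) (hx0 : 0 ≤ Hx) (hC : 0 ≤ C)
    {G : ℝ → F →L[ℝ] E} {x : ℝ → F} {J : ℝ → E}
    (hG : HolderBound α HG a b G) (hx : HolderBound ν Hx a b x)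
    (hJ : SewnBy (α + ν) C a b (youngGerm G x) J) : IsYoungIntegral G x a b (J b - J a) := by
  intro ε hε
  set D := HG * Hx + C with hD
  have hD0 : 0 ≤ D := by positivity
  have hθ1 : 0 < α + ν - 1 := by linarith
  -- A remainder of order `α + ν` on an interval of length `ℓ < δ` is at most `δ ^ (α + ν - 1) * ℓ`.
  -- The lengths `ℓ` add up to `b - a`, so this choice of mesh makes the total error smaller than
  -- `ε`.
  obtain ⟨δ, hδ, hδε⟩ : ∃ δ : ℝ, 0 < δ ∧ D * δ ^ (α + ν - 1) * (b - a) < ε := by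
    have hc : Continuous fun δ : ℝ => D * δ ^ (α + ν - 1) * (b - a) :=
      (continuous_const.mul (continuous_id.rpow_const fun _ => Or.inr hθ1.le)).mul continuous_const
    have h0 := hc.tendsto 0
    simp only [Real.zero_rpow hθ1.ne', mul_zero, zero_mul] at h0
    have h1 := (h0.mono_left (nhdsWithin_le_nhds (s := Ioi 0))).eventually_lt_const hε
    obtain ⟨δ, h2, h3⟩ := (h1.and self_mem_nhdsWithin).exists
    exact ⟨δ, h3, h2⟩
  refine ⟨δ, hδ, fun n t τ ht0 htn hp => ?_⟩
  have hmono : ∀ j, j ≤ n → ∀ i ≤ j, t i ≤ t j := by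
    intro j
    induction j with
    | zero => intro _ i hi; simp only [Nat.le_zero.1 hi, le_refl]
    | succ j ih =>
      intro hj i hi
      rcases Nat.le_succ_iff.1 hi with h | rfl
      · have := hp j (by omega)
        exact (ih (by omega) i h).trans (this.1.trans this.2.1)
      · exact le_rfl
  have e : (∑ i ∈ Finset.range n, G (τ i) (x (t (i + 1)) - x (t i))) - (J b - J a)
      = ∑ i ∈ Finset.range n, (G (τ i) (x (t (i + 1)) - x (t i)) - (J (t (i + 1)) - J (t i))) := by
    rw [Finset.sum_sub_distrib, Finset.sum_range_sub (fun i => J (t i)), ht0, htn]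
  rw [e]
  refine ((norm_sum_le _ _).trans ?_).trans_lt hδε
  have e2 : D * δ ^ (α + ν - 1) * (b - a)
      = ∑ i ∈ Finset.range n, D * δ ^ (α + ν - 1) * (t (i + 1) - t i) := by
    rw [← Finset.mul_sum, Finset.sum_range_sub, ht0, htn]
  rw [e2]
  refine Finset.sum_le_sum fun i hi => ?_
  have hin := Finset.mem_range.1 hi
  obtain ⟨h1, h2, h3⟩ := hp i hin
  have ha : a ≤ t i := ht0 ▸ hmono i hin.le 0 (Nat.zero_le _)
  have hb : t (i + 1) ≤ b := htn ▸ hmono n le_rfl (i + 1) hin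
  set s := t i
  set s' := t (i + 1)
  have hss : s ≤ s' := h1.trans h2
  have hJ' := hJ s s' ha hss hb
  have hG' := hG s (τ i) ha h1 (h2.trans hb)
  have hx' := hx s s' ha hss hb
  have e3 : G (τ i) (x s' - x s) - (J s' - J s)
      = (G (τ i) - G s) (x s' - x s) - (J s' - J s - youngGerm G x s s') := by
    simp only [youngGerm, sub_apply]; abel
  have h4 : (τ i - s) ^ α ≤ (s' - s) ^ α := Real.rpow_le_rpow (by linarith) (by linarith) hα
  have hs0 : 0 ≤ s' - s := sub_nonneg.2 hss
  have h5 : ‖(G (τ i) - G s) (x s' - x s)‖ ≤ HG * Hx * (s' - s) ^ (α + ν) := by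
    rw [Real.rpow_add_of_nonneg hs0 hα hν]
    calc _ ≤ ‖G (τ i) - G s‖ * ‖x s' - x s‖ := ContinuousLinearMap.le_opNorm _ _
      _ ≤ (HG * (s' - s) ^ α) * (Hx * (s' - s) ^ ν) := by
        gcongr
        exact hG'.trans (by gcongr)
      _ = _ := by ring
  have h6 : (s' - s) ^ (α + ν) ≤ δ ^ (α + ν - 1) * (s' - s) := by
    rcases hs0.eq_or_lt with h0 | h0
    · rw [← h0, Real.zero_rpow (by linarith), mul_zero]
    · calc (s' - s) ^ (α + ν) = (s' - s) ^ (α + ν - 1) * (s' - s) := by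
            rw [Real.rpow_sub_one h0.ne']; field_simp
        _ ≤ _ := by
            gcongr
  rw [e3]
  calc _ ≤ HG * Hx * (s' - s) ^ (α + ν) + C * (s' - s) ^ (α + ν) :=
        (norm_sub_le _ _).trans (add_le_add h5 hJ')
    _ = D * (s' - s) ^ (α + ν) := by rw [hD]; ring
    _ ≤ D * (δ ^ (α + ν - 1) * (s' - s)) := by gcongr
    _ = _ := by ring

/-- Uniform partitions have arbitrarily small mesh, so both values are approximated by one and the
same Riemann–Stieltjes sum. -/
lemma IsYoungIntegral.unique {G : ℝ → F →L[ℝ] E} {x : ℝ → F} {a b : ℝ} {I I' : E} (hab : a ≤ b)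
    (h : IsYoungIntegral G x a b I) (h' : IsYoungIntegral G x a b I') : I = I' := by
  by_contra hne
  have hpos : 0 < ‖I - I'‖ / 2 := half_pos (norm_pos_iff.2 (sub_ne_zero.2 hne))
  obtain ⟨δ, hδ, h1⟩ := h _ hpos
  obtain ⟨δ', hδ', h2⟩ := h' _ hpos
  obtain ⟨n, hn⟩ := exists_nat_gt ((b - a) / min δ δ')
  have hm : 0 < min δ δ' := lt_min hδ hδ'
  have hn0 : (0 : ℝ) < n := (div_nonneg (sub_nonneg.2 hab) hm.le).trans_lt hn
  let t : ℕ → ℝ := fun i => a + (b - a) / n * i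
  have hstep : ∀ i, t (i + 1) - t i = (b - a) / n := fun i => by simp only [t]; push_cast; ring
  have hle : 0 ≤ (b - a) / n := div_nonneg (sub_nonneg.2 hab) hn0.le
  have hlt : (b - a) / n < min δ δ' := by
    rw [div_lt_iff₀ hn0]; rw [div_lt_iff₀ hm] at hn; linarith
  have ht0 : t 0 = a := by simp [t]
  have htn : t n = b := by simp only [t]; field_simp; ring
  have a1 := h1 n t t ht0 htn fun i _ =>
    ⟨le_rfl, by linarith [hstep i], by rw [hstep]; exact hlt.trans_le (min_le_left _ _)⟩
  have a2 := h2 n t t ht0 htn fun i _ =>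
    ⟨le_rfl, by linarith [hstep i], by rw [hstep]; exact hlt.trans_le (min_le_right _ _)⟩
  have a3 := norm_sub_le ((∑ i ∈ Finset.range n, G (t i) (x (t (i + 1)) - x (t i))) - I')
    ((∑ i ∈ Finset.range n, G (t i) (x (t (i + 1)) - x (t i))) - I)
  rw [sub_sub_sub_cancel_left] at a3
  linarith

end Young

end YoungDelay

namespace YoungDelay

/-! ### Regularity of the coefficients -/

section Coefficients

variable {E F : Type*} [NormedAddCommGroup E] [NormedSpace ℝ E] [NormedAddCommGroup F]
  [NormedSpace ℝ F]

/-- The regularity of the coefficients: `f` is Lipschitz, `g` is differentiable with bounded and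
locally Lipschitz derivative. -/
structure RegularCoeff (r : ℝ) (f : C(Icc (-r) 0, E) → E) (g : C(Icc (-r) 0, E) → F →L[ℝ] E)
    (Cf : ℝ≥0) (Cg : ℝ) : Prop where
  r_pos : 0 < r
  lip : LipschitzWith Cf f
  diff : Differentiable ℝ g
  bound : ∀ ξ, ‖fderiv ℝ g ξ‖ ≤ Cg
  locLip : ∀ M : ℝ, 0 < M → ∃ L : ℝ, ∀ ξ η, ‖ξ‖ ≤ M → ‖η‖ ≤ M →
      ‖fderiv ℝ g ξ - fderiv ℝ g η‖ ≤ L * ‖ξ - η‖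

/-- The exponents of the Young regime. -/
structure YoungExponents (β₀ ν : ℝ) : Prop where
  pos : 0 < β₀
  lt : β₀ < ν
  le_one : ν ≤ 1
  one_lt : 1 < β₀ + ν

namespace RegularCoeff

variable {r : ℝ} {f : C(Icc (-r) 0, E) → E} {g : C(Icc (-r) 0, E) → F →L[ℝ] E} {Cf : ℝ≥0} {Cg : ℝ}

lemma Cg_nonneg (h : RegularCoeff r f g Cf Cg) : 0 ≤ Cg :=
  le_trans (norm_nonneg (fderiv ℝ g 0)) (h.bound 0)

lemma g_lip (h : RegularCoeff r f g Cf Cg) (ξ η : C(Icc (-r) 0, E)) :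
    ‖g ξ - g η‖ ≤ Cg * ‖ξ - η‖ :=
  convex_univ.norm_image_sub_le_of_norm_fderiv_le (fun ξ _ => h.diff ξ) (fun ξ _ => h.bound ξ)
    (mem_univ η) (mem_univ ξ)

lemma f_lip (h : RegularCoeff r f g Cf Cg) (ξ η : C(Icc (-r) 0, E)) :
    ‖f ξ - f η‖ ≤ Cf * ‖ξ - η‖ := h.lip.norm_sub_le ξ η

/-- Hölder bounds for `g(y_t) - g(z_t)` require second differences of `g`. The mean value inequality
is applied to `τ ↦ g (a τ) - g (b τ)` along the two segments from `η₁` to `ξ₁` and from `η₂` to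
`ξ₂`. The bound on the derivative handles the difference of directions, its local Lipschitz constant
the difference of base points. -/
lemma g_second_diff (h : RegularCoeff r f g Cf Cg) {L M : ℝ} (hL0 : 0 ≤ L)
    (hL : ∀ ξ η, ‖ξ‖ ≤ M → ‖η‖ ≤ M → ‖fderiv ℝ g ξ - fderiv ℝ g η‖ ≤ L * ‖ξ - η‖)
    {ξ₁ η₁ ξ₂ η₂ : C(Icc (-r) 0, E)} (h1 : ‖ξ₁‖ ≤ M) (h2 : ‖η₁‖ ≤ M) (h3 : ‖ξ₂‖ ≤ M)
    (h4 : ‖η₂‖ ≤ M) :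
    ‖(g ξ₁ - g η₁) - (g ξ₂ - g η₂)‖ ≤ Cg * ‖(ξ₁ - η₁) - (ξ₂ - η₂)‖
      + L * ‖ξ₂ - η₂‖ * (‖ξ₁ - ξ₂‖ + ‖η₁ - η₂‖) := by
  let a : ℝ → C(Icc (-r) 0, E) := fun τ => η₁ + τ • (ξ₁ - η₁)
  let b : ℝ → C(Icc (-r) 0, E) := fun τ => η₂ + τ • (ξ₂ - η₂)
  have hconv : ∀ {ξ η : C(Icc (-r) 0, E)} {N τ : ℝ}, ‖ξ‖ ≤ N → ‖η‖ ≤ N → τ ∈ Ico (0 : ℝ) 1 →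
      ‖η + τ • (ξ - η)‖ ≤ N := by
    intro ξ η N τ hξ hη hτ
    have := (convex_closedBall (0 : C(Icc (-r) 0, E)) N).add_smul_sub_mem
      (mem_closedBall_zero_iff.2 hη) (mem_closedBall_zero_iff.2 hξ) ⟨hτ.1, hτ.2.le⟩
    exact mem_closedBall_zero_iff.1 this
  have hda : ∀ τ, HasDerivAt a (ξ₁ - η₁) τ := fun τ => by
    have := ((hasDerivAt_id τ).smul_const (ξ₁ - η₁)).const_add η₁
    rwa [one_smul] at this
  have hdb : ∀ τ, HasDerivAt b (ξ₂ - η₂) τ := fun τ => by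
    have := ((hasDerivAt_id τ).smul_const (ξ₂ - η₂)).const_add η₂
    rwa [one_smul] at this
  have hd : ∀ τ, HasDerivAt (fun τ => g (a τ) - g (b τ))
      (fderiv ℝ g (a τ) (ξ₁ - η₁) - fderiv ℝ g (b τ) (ξ₂ - η₂)) τ := fun τ =>
    ((h.diff (a τ)).hasFDerivAt.comp_hasDerivAt τ (hda τ)).sub
      ((h.diff (b τ)).hasFDerivAt.comp_hasDerivAt τ (hdb τ))
  have hbound : ∀ τ ∈ Ico (0 : ℝ) 1,
      ‖fderiv ℝ g (a τ) (ξ₁ - η₁) - fderiv ℝ g (b τ) (ξ₂ - η₂)‖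
        ≤ Cg * ‖(ξ₁ - η₁) - (ξ₂ - η₂)‖ + L * ‖ξ₂ - η₂‖ * (‖ξ₁ - ξ₂‖ + ‖η₁ - η₂‖) := by
    intro τ hτ
    have e : fderiv ℝ g (a τ) (ξ₁ - η₁) - fderiv ℝ g (b τ) (ξ₂ - η₂)
        = fderiv ℝ g (a τ) ((ξ₁ - η₁) - (ξ₂ - η₂))
          + (fderiv ℝ g (a τ) - fderiv ℝ g (b τ)) (ξ₂ - η₂) := by
      rw [map_sub (fderiv ℝ g (a τ)) (ξ₁ - η₁), sub_apply]; abel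
    have hab : ‖a τ - b τ‖ ≤ ‖ξ₁ - ξ₂‖ + ‖η₁ - η₂‖ := by
      have e2 : a τ - b τ = (η₁ - η₂) + τ • ((ξ₁ - ξ₂) - (η₁ - η₂)) := by
        simp only [a, b, smul_sub]; abel
      rw [e2]
      exact hconv (by linarith [norm_nonneg (η₁ - η₂)]) (by linarith [norm_nonneg (ξ₁ - ξ₂)]) hτ
    have hD := hL (a τ) (b τ) (hconv h1 h2 hτ) (hconv h3 h4 hτ)
    rw [e]
    refine (norm_add_le _ _).trans (add_le_add ?_ ?_)
    · exact (ContinuousLinearMap.le_opNorm _ _).trans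
        (mul_le_mul_of_nonneg_right (h.bound _) (norm_nonneg _))
    · calc _ ≤ ‖fderiv ℝ g (a τ) - fderiv ℝ g (b τ)‖ * ‖ξ₂ - η₂‖ :=
            ContinuousLinearMap.le_opNorm _ _
        _ ≤ (L * (‖ξ₁ - ξ₂‖ + ‖η₁ - η₂‖)) * ‖ξ₂ - η₂‖ := by
            gcongr
            exact hD.trans (by gcongr)
        _ = _ := by ring
  have := norm_image_sub_le_of_norm_deriv_le_segment_01' (fun τ _ => (hd τ).hasDerivWithinAt) hbound
  have e : (g ξ₁ - g η₁) - (g ξ₂ - g η₂) = (g ξ₁ - g ξ₂) - (g η₁ - g η₂) := by abel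
  rw [e]
  simpa only [a, b, one_smul, zero_smul, add_zero, add_sub_cancel] using this

end RegularCoeff

end Coefficients

/-! ### Segments, drift-free parts and the local description of solutions -/

section Segments

variable {E F : Type*} [NormedAddCommGroup E] [NormedSpace ℝ E] [NormedAddCommGroup F]
  [NormedSpace ℝ F] {r : ℝ}

@[simp] lemma segment_apply (y : C(ℝ, E)) (t : ℝ) (s : Icc (-r) 0) :
    segment r y t s = y (t + s) := rfl

lemma segment_sub (y z : C(ℝ, E)) (t : ℝ) :
    segment r y t - segment r z t = segment r (y - z) t := rfl

lemma continuous_segment (y : C(ℝ, E)) : Continuous (segment r y) := by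
  refine ContinuousMap.continuous_of_continuous_uncurry _ ?_
  exact y.continuous.comp (continuous_fst.add (continuous_subtype_val.comp continuous_snd))

lemma norm_segment_le {y : C(ℝ, E)} {t M : ℝ} (hM : 0 ≤ M)
    (h : ∀ u ∈ Icc (t - r) t, ‖y u‖ ≤ M) : ‖segment r y t‖ ≤ M :=
  (ContinuousMap.norm_le _ hM).2 fun s => h _ ⟨by linarith [s.2.1], by linarith [s.2.2]⟩

lemma holderBound_segment {y : C(ℝ, E)} {α H a b : ℝ} (hH : 0 ≤ H)
    (h : HolderBound α H (a - r) b y) : HolderBound α H a b (segment r y) :=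
  fun s t hs hst ht => by
  refine (ContinuousMap.norm_le _ (mul_nonneg hH (Real.rpow_nonneg (sub_nonneg.2 hst) _))).2
    fun u => ?_
  have := h (s + u) (t + u) (by linarith [u.2.1]) (by linarith) (by linarith [u.2.2])
  simpa using this

/-- The drift `B y(u) + f(y_u)`. -/
def drift (r : ℝ) (B : E →L[ℝ] E) (f : C(Icc (-r) 0, E) → E) (y : C(ℝ, E)) (u : ℝ) : E :=
  B (y u) + f (segment r y u)

lemma continuous_drift {B : E →L[ℝ] E} {f : C(Icc (-r) 0, E) → E} (hf : Continuous f)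
    (y : C(ℝ, E)) : Continuous (drift r B f y) :=
  (B.continuous.comp y.continuous).add (hf.comp (continuous_segment y))

/-- The drift-free part `y(t) - ∫₀ᵗ (B y + f(y_u)) du` of a path. -/
def driftFree (r : ℝ) (B : E →L[ℝ] E) (f : C(Icc (-r) 0, E) → E) (y : C(ℝ, E)) (t : ℝ) : E :=
  y t - ∫ u in (0 : ℝ)..t, drift r B f y u

lemma driftFree_sub {B : E →L[ℝ] E} {f : C(Icc (-r) 0, E) → E} (hf : Continuous f)
    (y : C(ℝ, E)) (s t : ℝ) :
    driftFree r B f y t - driftFree r B f y s = y t - y s - ∫ u in s..t, drift r B f y u := by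
  have hc := continuous_drift (B := B) hf y
  rw [driftFree, driftFree, ← intervalIntegral.integral_interval_sub_left
    (hc.intervalIntegrable 0 t) (hc.intervalIntegrable 0 s)]
  abel

/-- Solutions on `[0,T]` described by their local expansion. -/
structure IsDavieSolution (r β₀ ν : ℝ) (B : E →L[ℝ] E) (f : C(Icc (-r) 0, E) → E)
    (g : C(Icc (-r) 0, E) → F →L[ℝ] E) (x : ℝ → F) (T : ℝ) (y : C(ℝ, E)) : Prop where
  holder : ∃ H, 0 ≤ H ∧ HolderBound β₀ H (-r) T y
  expansion : ∃ C, SewnBy (β₀ + ν) C 0 T (youngGerm (fun u => g (segment r y u)) x)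
    (driftFree r B f y)

variable {B : E →L[ℝ] E} {f : C(Icc (-r) 0, E) → E} {g : C(Icc (-r) 0, E) → F →L[ℝ] E}
  {Cf : ℝ≥0} {Cg : ℝ}

lemma IsDavieSolution.mono {β₀ ν T T' : ℝ} {x : ℝ → F} {y : C(ℝ, E)}
    (h : IsDavieSolution r β₀ ν B f g x T y) (hT : T' ≤ T) :
    IsDavieSolution r β₀ ν B f g x T' y := by
  obtain ⟨⟨H, hH, h1⟩, ⟨C, h2⟩⟩ := h
  exact ⟨⟨H, hH, h1.mono le_rfl le_rfl hT⟩, ⟨C, h2.mono le_rfl le_rfl hT⟩⟩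

lemma RegularCoeff.holderBound_g (hc : RegularCoeff r f g Cf Cg) {y : C(ℝ, E)} {α H a b : ℝ}
    (hH : 0 ≤ H) (h : HolderBound α H (a - r) b y) :
    HolderBound α (Cg * H) a b (fun u => g (segment r y u)) := fun s t hs hst ht => by
  refine (hc.g_lip _ _).trans ?_
  rw [mul_assoc]
  exact mul_le_mul_of_nonneg_left (holderBound_segment hH h s t hs hst ht) hc.Cg_nonneg

lemma RegularCoeff.continuous_g (hc : RegularCoeff r f g Cf Cg) (y : C(ℝ, E)) :
    Continuous (fun u => g (segment r y u)) := hc.diff.continuous.comp (continuous_segment y)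

/-- The sewn function `J` also has the Riemann–Stieltjes sums as approximations of its increments.
By uniqueness of the Young integral the drift-free part has the same increments as `J` and inherits
its expansion. -/
theorem IsSolution.isDavieSolution [CompleteSpace E] (hc : RegularCoeff r f g Cf Cg) {β₀ ν : ℝ≥0}
    (he : YoungExponents β₀ ν) {x : ℝ → F} {η : C(Icc (-r) 0, E)} {y : C(ℝ, E)} {T : ℝ}
    (hx : MemC0 ν 0 T (fun t : Icc 0 T => x t))
    (h : IsSolution r β₀ B f g x η y) : IsDavieSolution r β₀ ν B f g x T y := by
  obtain ⟨H, hH0, hH⟩ := memHolder_iff_holderBound.1 (h.holder T)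
  refine ⟨⟨H, hH0, hH⟩, ?_⟩
  obtain ⟨Hx, hHx0, hHx⟩ := memHolder_iff_holderBound.1 hx.1
  have hG : HolderBound β₀ (Cg * H) 0 T (fun u => g (segment r y u)) :=
    hc.holderBound_g hH0 (by simpa using hH)
  have hCg := hc.Cg_nonneg
  obtain ⟨J, hJ⟩ := exists_sewnBy_youngGerm he.pos he.le_one he.one_lt (by positivity) hHx0
    (hc.continuous_g y) hG hHx hx
  have hs0 := sewingConst_pos he.one_lt
  refine ⟨sewingConst (β₀ + ν) * (Cg * H * Hx), fun s t hs hst ht => ?_⟩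
  · have key : ∀ t, 0 ≤ t → t ≤ T → driftFree r B f y t - driftFree r B f y 0 = J t - J 0 := by
      intro t ht0 htT
      rw [driftFree_sub hc.lip.continuous]
      refine (h.equation t ht0).unique ht0 ?_
      exact isYoungIntegral_of_sewnBy he.pos.le ν.coe_nonneg he.one_lt (by positivity) hHx0
        (by positivity) (hG.mono le_rfl le_rfl htT) (hHx.mono le_rfl le_rfl htT)
        (hJ.mono le_rfl le_rfl htT)
    have e : driftFree r B f y t - driftFree r B f y s = J t - J s := by
      have h1 := key t (hs.trans hst) ht
      have h2 := key s hs (hst.trans ht)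
      rw [← sub_sub_sub_cancel_right _ _ (driftFree r B f y 0), h1, h2, sub_sub_sub_cancel_right]
    rw [e]
    exact hJ s t hs hst ht

theorem isSolution_of_isDavieSolution (hc : RegularCoeff r f g Cf Cg) {β₀ ν : ℝ≥0}
    (he : YoungExponents β₀ ν) {x : ℝ → F} {y : C(ℝ, E)}
    (hx : ∀ T : ℝ, MemHolder ν (fun t : Icc 0 T => x t))
    (h : ∀ T : ℝ, 0 ≤ T → IsDavieSolution r β₀ ν B f g x T y) :
    IsSolution r β₀ B f g x (segment r y 0) y := by
  refine ⟨rfl, fun T => ?_, fun t ht => ?_⟩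
  · obtain ⟨H, hH0, hH⟩ := (h (max T 0) (le_max_right _ _)).holder
    exact memHolder_iff_holderBound.2 ⟨H, hH0, hH.mono le_rfl le_rfl (le_max_left _ _)⟩
  · obtain ⟨⟨H, hH0, hH⟩, ⟨C, hC⟩⟩ := h t ht
    obtain ⟨Hx, hHx0, hHx⟩ := memHolder_iff_holderBound.1 (hx t)
    have hCg := hc.Cg_nonneg
    have := isYoungIntegral_of_sewnBy he.pos.le ν.coe_nonneg he.one_lt (by positivity) hHx0
      (abs_nonneg C) (hc.holderBound_g hH0 (by simpa using hH)) hHx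
      (hC.mono (le_abs_self C) le_rfl le_rfl)
    rwa [driftFree_sub hc.lip.continuous] at this

end Segments

end YoungDelay

namespace YoungDelay

/-! ### Stability under perturbation of the initial segment and the driver -/

section Stability

variable {E F : Type*} [NormedAddCommGroup E] [NormedSpace ℝ E] [NormedAddCommGroup F]
  [NormedSpace ℝ F] {r : ℝ}

/-- `D` and its `β`-Hölder quotients are bounded by `Z` on `[a,b]`. -/
def HolderBall (β Z a b : ℝ) (D : ℝ → E) : Prop :=
  (∀ t ∈ Icc a b, ‖D t‖ ≤ Z) ∧ HolderBound β Z a b D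

lemma HolderBall.mono {β Z Z' a b a' b' : ℝ} {D : ℝ → E} (h : HolderBall β Z a b D) (hZ : Z ≤ Z')
    (ha : a ≤ a') (hb : b' ≤ b) : HolderBall β Z' a' b' D :=
  ⟨fun t ht => (h.1 t ⟨ha.trans ht.1, ht.2.trans hb⟩).trans hZ, h.2.mono hZ ha hb⟩

lemma HolderBall.of_affine_step {β a b c κ : ℝ} {D : ℝ → E} (hκ0 : 0 ≤ κ) (hκ : κ < 1)
    (hc : 0 ≤ c) (h0 : ∃ Z, 0 ≤ Z ∧ HolderBall β Z a b D)
    (step : ∀ Z, 0 ≤ Z → HolderBall β Z a b D → HolderBall β (c + κ * Z) a b D) :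
    HolderBall β (c / (1 - κ)) a b D :=
  YoungDelay.of_affine_step (P := fun Z => HolderBall β Z a b D) hκ0 hκ hc
    (fun _ _ hu h => ⟨fun t ht => ge_of_tendsto' hu fun k => (h k).1 t ht,
      holderBound_of_tendsto_const hu fun k => (h k).2⟩) h0 step

lemma HolderBall.const_nonneg {β Z a b : ℝ} {D : ℝ → E} (h : HolderBall β Z a b D) (hab : a ≤ b) :
    0 ≤ Z := (norm_nonneg _).trans (h.1 a ⟨le_rfl, hab⟩)

/-- Prolonging a bound to the right. -/
lemma HolderBall.extend {β N H a b c : ℝ} {D : ℝ → E} (hβ : 0 ≤ β) (h : HolderBall β N a b D)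
    (hab : a ≤ b) (hc1 : c - b ≤ 1) (hH : 0 ≤ H) (h' : HolderBound β H b c D) :
    HolderBall β (N + H) a c D := by
  have hN := h.const_nonneg hab
  refine ⟨fun t ht => ?_, h.2.trans h' hβ hN hH⟩
  rcases le_total t b with htb | hbt
  · exact (h.1 t ⟨ht.1, htb⟩).trans (by linarith)
  · have h1 := h'.norm_le hbt ht.2
    have h2 := h.1 b ⟨hab, le_rfl⟩
    have h3 : (t - b) ^ β ≤ 1 := Real.rpow_le_one (by linarith) (by linarith [ht.2]) hβ
    nlinarith

variable {B : E →L[ℝ] E} {f : C(Icc (-r) 0, E) → E} {g : C(Icc (-r) 0, E) → F →L[ℝ] E}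
  {Cf : ℝ≥0} {Cg : ℝ}

/-- Measuring terms of order at least `ν` in the weaker exponent `β₀` on intervals of length `τ`
leaves the factor `τ ^ (ν - β₀)`, the source of smallness in the stability argument. -/
lemma rpow_le_of_small {h τ β₀ ν e : ℝ} (hh : 0 ≤ h) (hτ : h ≤ τ) (hτ1 : τ ≤ 1) (hβ : 0 < β₀)
    (hν : β₀ < ν) (he : ν ≤ e) : h ^ e ≤ τ ^ (ν - β₀) * h ^ β₀ := by
  rcases hh.eq_or_lt with rfl | h0
  · rw [Real.zero_rpow (by linarith), Real.zero_rpow hβ.ne', mul_zero]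
  · calc h ^ e ≤ h ^ ν := Real.rpow_le_rpow_of_exponent_ge h0 (hτ.trans hτ1) he
      _ = h ^ (ν - β₀) * h ^ β₀ := by rw [← Real.rpow_add h0]; ring_nf
      _ ≤ _ := by
        gcongr

/-- One step of the stability estimate: the increments of the difference of two solutions on a
short interval. -/
lemma holderBound_sub_step (hc : RegularCoeff r f g Cf Cg) {β₀ ν : ℝ}
    (he : YoungExponents β₀ ν) {L M : ℝ} (hL0 : 0 ≤ L) (hM : 0 ≤ M)
    (hL : ∀ ξ η, ‖ξ‖ ≤ M → ‖η‖ ≤ M → ‖fderiv ℝ g ξ - fderiv ℝ g η‖ ≤ L * ‖ξ - η‖)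
    {T τ a b Z Hd : ℝ} {x x' : ℝ → F} {y z : C(ℝ, E)}
    (hy : IsDavieSolution r β₀ ν B f g x T y) (hz : IsDavieSolution r β₀ ν B f g x' T z)
    (hyM : HolderBall β₀ M (-r) T y) (hzM : HolderBall β₀ M (-r) T z)
    (hxM : HolderBound ν M 0 T x) (hd : HolderBound ν Hd 0 T (fun t => x t - x' t))
    (hHd : 0 ≤ Hd) (ha : 0 ≤ a) (hbT : b ≤ T) (hτ : b - a ≤ τ) (hτ1 : τ ≤ 1)
    (hZ : 0 ≤ Z) (hD : HolderBall β₀ Z (-r) b (fun t => y t - z t)) :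
    HolderBound β₀ (τ ^ (ν - β₀) * ((‖B‖ + Cf + Cg * M
        + sewingConst (β₀ + ν) * ((Cg + 2 * L * M) * M)) * Z
      + (‖g 0‖ + Cg * M + sewingConst (β₀ + ν) * (Cg * M)) * Hd)) a b (fun t => y t - z t) := by
  have hr := hc.r_pos
  have hCg := hc.Cg_nonneg
  have hβ := he.pos
  have hν0 : 0 ≤ ν := he.pos.le.trans he.lt.le
  have hs0 := sewingConst_pos he.one_lt
  have hfc := hc.lip.continuous
  set Gy := fun u => g (segment r y u)
  set Gz := fun u => g (segment r z u)
  have hsegM : ∀ {w : C(ℝ, E)}, HolderBall β₀ M (-r) T w → ∀ u, a ≤ u → u ≤ b →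
      ‖segment r w u‖ ≤ M := fun hw u hu1 hu2 =>
    norm_segment_le hM fun s hs => hw.1 s ⟨by linarith [hs.1], by linarith [hs.2]⟩
  have hsegD : ∀ u, a ≤ u → u ≤ b → ‖segment r y u - segment r z u‖ ≤ Z := fun u hu1 hu2 => by
    rw [segment_sub]
    exact norm_segment_le hZ fun s hs => hD.1 s ⟨by linarith [hs.1], by linarith [hs.2]⟩
  -- The local Lipschitz bound on the derivative of `g` is needed here: the Hölder constant of the
  -- difference of coefficients has to be linear in `Z`.
  have hGd : HolderBound β₀ ((Cg + 2 * L * M) * Z) a b (fun u => Gy u - Gz u) := by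
    intro s t hs hst ht
    have h1 := hc.g_second_diff hL0 hL (hsegM hyM t (hs.trans hst) ht)
      (hsegM hzM t (hs.trans hst) ht) (hsegM hyM s hs (hst.trans ht)) (hsegM hzM s hs (hst.trans ht))
    refine h1.trans ?_
    have h2 := holderBound_segment (r := r) (y := y) (a := a) (b := b) hM
      (hyM.2.mono le_rfl (by linarith) hbT) s t hs hst ht
    have h3 := holderBound_segment (r := r) (y := z) (a := a) (b := b) hM
      (hzM.2.mono le_rfl (by linarith) hbT) s t hs hst ht
    have h4 := holderBound_segment (r := r) (y := y - z) (a := a) (b := b) hZ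
      (hD.2.mono le_rfl (by linarith) le_rfl) s t hs hst ht
    rw [← segment_sub, ← segment_sub] at h4
    have h5 := hsegD s hs (hst.trans ht)
    have hp : 0 ≤ (t - s) ^ β₀ := Real.rpow_nonneg (sub_nonneg.2 hst) _
    calc _ ≤ Cg * (Z * (t - s) ^ β₀) + L * Z * (M * (t - s) ^ β₀ + M * (t - s) ^ β₀) := by gcongr
      _ = _ := by ring
  have hGz : HolderBound β₀ (Cg * M) a b Gz :=
    hc.holderBound_g hM (hzM.2.mono le_rfl (by linarith) hbT)
  have hxab : HolderBound ν M a b x := hxM.mono le_rfl ha hbT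
  have hdab : HolderBound ν Hd a b (fun t => x t - x' t) := hd.mono le_rfl ha hbT
  obtain ⟨C₁, hC₁⟩ := hy.expansion
  obtain ⟨C₂, hC₂⟩ := hz.expansion
  have hsub := (hC₁.sub hC₂).mono le_rfl ha hbT
  -- Leibniz splitting: the first germ is controlled by the difference of the solutions, the second
  -- by the difference of the drivers.
  have eΞ : (fun s t => youngGerm Gy x s t - youngGerm Gz x' s t)
      = fun s t => youngGerm (fun u => Gy u - Gz u) x s t
        + youngGerm Gz (fun t => x t - x' t) s t := by
    funext s t
    simp only [youngGerm, sub_apply, map_sub]; abel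
  rw [eΞ] at hsub
  have himp := hsub.improve he.one_lt (K := (Cg + 2 * L * M) * Z * M + Cg * M * Hd) (by positivity)
    (fun s u t hs hsu hut ht => by
      have h1 := youngGerm_defect hβ.le hν0 (by positivity) hGd hxab s u t hs hsu hut ht
      have h2 := youngGerm_defect hβ.le hν0 (by positivity) hGz hdab s u t hs hsu hut ht
      rw [add_sub_add_comm, add_sub_add_comm, add_mul]
      exact (norm_add_le _ _).trans (add_le_add h1 h2))
  intro s t hs hst ht
  have hst0 : 0 ≤ t - s := sub_nonneg.2 hst
  have h1 := himp s t hs hst ht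
  have hdy := continuous_drift (B := B) hfc y
  have hdz := continuous_drift (B := B) hfc z
  have h2 : ‖∫ u in s..t, (drift r B f y u - drift r B f z u)‖ ≤ ((‖B‖ + Cf) * Z) * (t - s) := by
    have := intervalIntegral.norm_integral_le_of_norm_le_const (a := s) (b := t)
      (f := fun u => drift r B f y u - drift r B f z u) (C := (‖B‖ + Cf) * Z) ?_
    · rwa [abs_of_nonneg hst0] at this
    · intro u hu
      rw [uIoc_of_le hst] at hu
      have hu1 : a ≤ u := hs.trans hu.1.le
      have hu2 : u ≤ b := hu.2.trans ht
      have e : drift r B f y u - drift r B f z u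
          = B (y u - z u) + (f (segment r y u) - f (segment r z u)) := by
        simp only [drift, map_sub]; abel
      have h3 := hD.1 u ⟨by linarith, hu2⟩
      rw [e, add_mul]
      refine (norm_add_le _ _).trans (add_le_add ((B.le_opNorm _).trans ?_)
        ((hc.f_lip _ _).trans ?_))
      · gcongr
      · have := hsegD u hu1 hu2
        gcongr
  have hGs : ‖Gy s - Gz s‖ ≤ Cg * Z := (hc.g_lip _ _).trans (by
    have := hsegD s hs (hst.trans ht)
    gcongr)
  have hGzs : ‖Gz s‖ ≤ ‖g 0‖ + Cg * M := by
    have h3 := hc.g_lip (segment r z s) 0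
    have h4 := hsegM hzM s hs (hst.trans ht)
    rw [sub_zero] at h3
    have h5 := norm_le_norm_add_norm_sub' (g (segment r z s)) (g 0)
    have h6 : Cg * ‖segment r z s‖ ≤ Cg * M := by gcongr
    simp only [Gz]
    linarith
  have h3 : ‖youngGerm (fun u => Gy u - Gz u) x s t + youngGerm Gz (fun t => x t - x' t) s t‖
      ≤ (Cg * M * Z + (‖g 0‖ + Cg * M) * Hd) * (t - s) ^ ν := by
    have h4 := hxab s t hs hst ht
    have h5 := hdab s t hs hst ht
    have hp : 0 ≤ (t - s) ^ ν := Real.rpow_nonneg hst0 _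
    calc _ ≤ ‖Gy s - Gz s‖ * ‖x t - x s‖ + ‖Gz s‖ * ‖x t - x' t - (x s - x' s)‖ :=
          (norm_add_le _ _).trans (add_le_add (ContinuousLinearMap.le_opNorm _ _)
            (ContinuousLinearMap.le_opNorm _ _))
      _ ≤ (Cg * Z) * (M * (t - s) ^ ν) + (‖g 0‖ + Cg * M) * (Hd * (t - s) ^ ν) := by gcongr
      _ = _ := by ring
  have e : y t - z t - (y s - z s)
      = (driftFree r B f y t - driftFree r B f z t - (driftFree r B f y s - driftFree r B f z s)
          - (youngGerm (fun u => Gy u - Gz u) x s t + youngGerm Gz (fun t => x t - x' t) s t))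
        + (∫ u in s..t, (drift r B f y u - drift r B f z u))
        + (youngGerm (fun u => Gy u - Gz u) x s t + youngGerm Gz (fun t => x t - x' t) s t) := by
    have e1 : driftFree r B f y t - driftFree r B f z t
        - (driftFree r B f y s - driftFree r B f z s)
        = (driftFree r B f y t - driftFree r B f y s)
          - (driftFree r B f z t - driftFree r B f z s) := by abel
    rw [e1, driftFree_sub hfc, driftFree_sub hfc,
      intervalIntegral.integral_sub (hdy.intervalIntegrable _ _) (hdz.intervalIntegrable _ _)]
    abel
  have q1 : (t - s) ≤ τ ^ (ν - β₀) * (t - s) ^ β₀ := by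
    have := rpow_le_of_small hst0 (by linarith : t - s ≤ τ) hτ1 hβ he.lt he.le_one
    rwa [Real.rpow_one] at this
  have q2 := rpow_le_of_small hst0 (by linarith : t - s ≤ τ) hτ1 hβ he.lt le_rfl
  have q3 := rpow_le_of_small hst0 (by linarith : t - s ≤ τ) hτ1 hβ he.lt
    (by linarith : ν ≤ β₀ + ν)
  rw [e]
  calc _ ≤ sewingConst (β₀ + ν) * ((Cg + 2 * L * M) * Z * M + Cg * M * Hd) * (t - s) ^ (β₀ + ν)
        + (‖B‖ + Cf) * Z * (t - s) + (Cg * M * Z + (‖g 0‖ + Cg * M) * Hd) * (t - s) ^ ν :=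
        (norm_add_le _ _).trans (add_le_add ((norm_add_le _ _).trans (add_le_add h1 h2)) h3)
    _ ≤ sewingConst (β₀ + ν) * ((Cg + 2 * L * M) * Z * M + Cg * M * Hd)
          * (τ ^ (ν - β₀) * (t - s) ^ β₀)
        + (‖B‖ + Cf) * Z * (τ ^ (ν - β₀) * (t - s) ^ β₀)
        + (Cg * M * Z + (‖g 0‖ + Cg * M) * Hd) * (τ ^ (ν - β₀) * (t - s) ^ β₀) := by gcongr
    _ = _ := by ring

/-- Stability of solutions with respect to the initial segment and the driving path, on bounded
sets. -/
theorem exists_stability_const (hc : RegularCoeff r f g Cf Cg) {β₀ ν : ℝ}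
    (he : YoungExponents β₀ ν) (B : E →L[ℝ] E) {T M : ℝ} (hT : 0 ≤ T) (hM : 0 ≤ M) :
    ∃ C, 0 ≤ C ∧ ∀ (x x' : ℝ → F) (y z : C(ℝ, E)) (N Hd : ℝ),
      IsDavieSolution r β₀ ν B f g x T y → IsDavieSolution r β₀ ν B f g x' T z →
      HolderBall β₀ M (-r) T y → HolderBall β₀ M (-r) T z → HolderBound ν M 0 T x →
      HolderBound ν Hd 0 T (fun t => x t - x' t) → 0 ≤ Hd →
      HolderBall β₀ N (-r) 0 (fun t => y t - z t) →
      HolderBall β₀ (C * (N + Hd)) (-r) T (fun t => y t - z t) := by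
  have hr := hc.r_pos
  have hCg := hc.Cg_nonneg
  have hs0 := sewingConst_pos he.one_lt
  -- The local Lipschitz property is only available for positive radii, and `M` may vanish.
  obtain ⟨L', hL'⟩ := hc.locLip (M + 1) (by linarith)
  set L := |L'|
  have hL : ∀ ξ η, ‖ξ‖ ≤ M → ‖η‖ ≤ M → ‖fderiv ℝ g ξ - fderiv ℝ g η‖ ≤ L * ‖ξ - η‖ :=
    fun ξ η h1 h2 => (hL' ξ η (by linarith) (by linarith)).trans
      (mul_le_mul_of_nonneg_right (le_abs_self _) (norm_nonneg _))
  set c₁ := ‖B‖ + Cf + Cg * M + sewingConst (β₀ + ν) * ((Cg + 2 * L * M) * M) with hc₁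
  set c₂ := ‖g 0‖ + Cg * M + sewingConst (β₀ + ν) * (Cg * M) with hc₂
  have hc₁0 : 0 ≤ c₁ := by positivity
  have hc₂0 : 0 ≤ c₂ := by positivity
  obtain ⟨τ, hτ0, hτ1, hτc⟩ : ∃ τ : ℝ, 0 < τ ∧ τ ≤ 1 ∧ τ ^ (ν - β₀) * c₁ ≤ 1 / 2 := by
    have hpos : 0 < ν - β₀ := sub_pos.2 he.lt
    have hcont : Continuous fun τ : ℝ => τ ^ (ν - β₀) * c₁ :=
      (continuous_id.rpow_const fun _ => Or.inr hpos.le).mul continuous_const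
    have h0 := hcont.tendsto 0
    simp only [Real.zero_rpow hpos.ne', zero_mul] at h0
    have h1 := (h0.mono_left (nhdsWithin_le_nhds (s := Ioi 0))).eventually_lt_const
      (by norm_num : (0 : ℝ) < 1 / 2)
    have h2 : ∀ᶠ τ : ℝ in 𝓝[>] 0, τ ≤ 1 :=
      (eventually_le_nhds (by norm_num : (0 : ℝ) < 1)).filter_mono nhdsWithin_le_nhds
    obtain ⟨τ, ⟨h3, h4⟩, h5⟩ := ((h1.and h2).and self_mem_nhdsWithin).exists
    exact ⟨τ, h5, h4, h3.le⟩
  -- Induction over time steps of length `τ`. Since `τ` depends only on `M` and the coefficients,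
  -- finitely many steps reach `T` with a constant independent of the solutions.
  have main : ∀ k : ℕ, ∃ C, 1 ≤ C ∧ ∀ (x x' : ℝ → F) (y z : C(ℝ, E)) (N Hd : ℝ),
      IsDavieSolution r β₀ ν B f g x T y → IsDavieSolution r β₀ ν B f g x' T z →
      HolderBall β₀ M (-r) T y → HolderBall β₀ M (-r) T z → HolderBound ν M 0 T x →
      HolderBound ν Hd 0 T (fun t => x t - x' t) → 0 ≤ Hd →
      HolderBall β₀ N (-r) 0 (fun t => y t - z t) →
      HolderBall β₀ (C * (N + Hd)) (-r) (min (k * τ) T) (fun t => y t - z t) := by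
    intro k
    induction k with
    | zero =>
      refine ⟨1, le_rfl, fun x x' y z N Hd _ _ _ _ _ _ hHd hN => ?_⟩
      exact hN.mono (by linarith) le_rfl (by simp)
    | succ k ih =>
      obtain ⟨C, hC1, hC⟩ := ih
      refine ⟨2 * (C + c₂), by linarith, fun x x' y z N Hd hy hz hyM hzM hxM hd hHd hN => ?_⟩
      have hprev := hC x x' y z N Hd hy hz hyM hzM hxM hd hHd hN
      have hN0 := hN.const_nonneg (by linarith)
      set a := min (k * τ) T with ha
      set b := min ((k + 1 : ℕ) * τ) T with hb
      have ha0 : 0 ≤ a := le_min (by positivity) hT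
      have hbT : b ≤ T := min_le_right _ _
      have hab : a ≤ b := by
        refine min_le_min ?_ le_rfl
        push_cast; nlinarith
      have hba : b - a ≤ τ := by
        rw [ha, hb, sub_le_iff_le_add, ← min_add_add_left]
        refine le_min ((min_le_left _ _).trans ?_) ((min_le_right _ _).trans (by linarith))
        push_cast; linarith
      -- The unknown bound `Z` on `[-r, b]` returns with factor `1 / 2`. The qualitative bound `M +
      -- M` starts the iteration, and the fixed point accounts for the factor `2` in the new
      -- constant.
      have hstep := HolderBall.of_affine_step (β := β₀) (a := -r) (b := b)
        (c := C * (N + Hd) + c₂ * Hd) (κ := 1 / 2) (D := fun t => y t - z t) (by norm_num)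
        (by norm_num) (by positivity) ⟨M + M, by linarith, ?_, ?_⟩ ?_
      · refine hstep.mono ?_ le_rfl le_rfl
        have : c₂ * Hd ≤ c₂ * (N + Hd) := by gcongr; linarith
        have e : ∀ X : ℝ, X / (1 - 1 / 2) = 2 * X := fun X => by ring
        rw [e]
        linarith
      · intro t ht
        have h1 := hyM.1 t ⟨ht.1, ht.2.trans hbT⟩
        have h2 := hzM.1 t ⟨ht.1, ht.2.trans hbT⟩
        exact (norm_sub_le _ _).trans (add_le_add h1 h2)
      · exact (hyM.2.sub hzM.2).mono le_rfl le_rfl hbT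
      · intro Z hZ hD
        have h1 := holderBound_sub_step hc he (abs_nonneg L') hM hL hy hz hyM hzM hxM hd hHd ha0
          hbT hba hτ1 hZ hD
        have hp : τ ^ (ν - β₀) ≤ 1 := Real.rpow_le_one hτ0.le hτ1 (sub_nonneg.2 he.lt.le)
        have hp0 : 0 ≤ τ ^ (ν - β₀) := Real.rpow_nonneg hτ0.le _
        have h2 : HolderBound β₀ (c₂ * Hd + 1 / 2 * Z) a b (fun t => y t - z t) := by
          refine h1.mono ?_ le_rfl le_rfl
          rw [← hc₁, ← hc₂, mul_add, ← mul_assoc]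
          have := mul_le_mul_of_nonneg_right hτc hZ
          have := mul_le_mul_of_nonneg_right hp (mul_nonneg hc₂0 hHd)
          linarith
        have h3 := hprev.extend he.pos.le (by linarith) (by linarith) (by positivity) h2
        exact h3.mono (by linarith) le_rfl le_rfl
  obtain ⟨k, hk⟩ := exists_nat_ge (T / τ)
  obtain ⟨C, hC1, hC⟩ := main k
  rw [div_le_iff₀ hτ0] at hk
  refine ⟨C, by linarith, fun x x' y z N Hd hy hz hyM hzM hxM hd hHd hN => ?_⟩
  have := hC x x' y z N Hd hy hz hyM hzM hxM hd hHd hN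
  rwa [min_eq_right hk] at this

end Stability

end YoungDelay

namespace YoungDelay

/-! ### Solutions for smooth drivers by a weighted contraction -/

section SmoothDriver

variable {E F : Type*} [NormedAddCommGroup E] [NormedSpace ℝ E] [NormedAddCommGroup F]
  [NormedSpace ℝ F] {r : ℝ}

/-- The path with initial segment `η` and continuation `η(0) + e^{Λt} v(t) - v(0)` on `[0,T]`. -/
def prolong {T : ℝ} (hr : 0 < r) (hT : 0 ≤ T) (Λ : ℝ) (η : C(Icc (-r) 0, E))
    (v : C(Icc 0 T, E)) : C(ℝ, E) where
  toFun t := η (projIcc (-r) 0 (by linarith) t)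
    + (Real.exp (Λ * projIcc 0 T hT t) • v (projIcc 0 T hT t) - v ⟨0, le_rfl, hT⟩)
  continuous_toFun := by
    have h1 := (continuous_projIcc (h := (by linarith : -r ≤ 0)))
    have h2 := (continuous_projIcc (h := hT))
    exact (η.continuous.comp h1).add (((Real.continuous_exp.comp
      (continuous_const.mul (continuous_subtype_val.comp h2))).smul
      (v.continuous.comp h2)).sub continuous_const)

variable {T : ℝ} (hr : 0 < r) (hT : 0 ≤ T) (Λ : ℝ) (η : C(Icc (-r) 0, E))

lemma prolong_of_nonpos (v : C(Icc 0 T, E)) {t : ℝ} (ht : t ∈ Icc (-r) 0) :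
    prolong hr hT Λ η v t = η ⟨t, ht⟩ := by
  have h1 : projIcc (-r) 0 (by linarith) t = ⟨t, ht⟩ := projIcc_of_mem _ ht
  have h2 : projIcc 0 T hT t = ⟨0, le_rfl, hT⟩ := projIcc_of_le_left _ ht.2
  simp [prolong, h1, h2]

lemma prolong_of_mem (v : C(Icc 0 T, E)) {t : ℝ} (ht : t ∈ Icc 0 T) :
    prolong hr hT Λ η v t = η ⟨0, by linarith, le_rfl⟩
      + (Real.exp (Λ * t) • v ⟨t, ht⟩ - v ⟨0, le_rfl, hT⟩) := by
  have h1 : projIcc (-r) 0 (by linarith) t = ⟨0, by linarith, le_rfl⟩ :=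
    projIcc_of_right_le _ ht.1
  have h2 : projIcc 0 T hT t = ⟨t, ht⟩ := projIcc_of_mem _ ht
  simp [prolong, h1, h2]

/-- Distances at all times up to `u`, the whole past included, are controlled by one exponential
weight. The factor `2` comes from the term `v(0)`, which is subtracted to make `prolong` continuous
for every `v`. -/
lemma norm_prolong_sub_le {Λ : ℝ} (hΛ : 0 ≤ Λ) (v w : C(Icc 0 T, E)) {u s : ℝ} (hu : 0 ≤ u)
    (hs : s ≤ u) :
    ‖prolong hr hT Λ η v s - prolong hr hT Λ η w s‖ ≤ 2 * Real.exp (Λ * u) * ‖v - w‖ := by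
  have e : prolong hr hT Λ η v s - prolong hr hT Λ η w s
      = Real.exp (Λ * projIcc 0 T hT s) • (v - w) (projIcc 0 T hT s)
        - (v - w) ⟨0, le_rfl, hT⟩ := by
    simp only [prolong, ContinuousMap.coe_mk, ContinuousMap.sub_apply, smul_sub]
    abel
  have h1 := (v - w).norm_coe_le_norm (projIcc 0 T hT s)
  have h2 := (v - w).norm_coe_le_norm ⟨0, le_rfl, hT⟩
  have h3 : Real.exp (Λ * projIcc 0 T hT s) ≤ Real.exp (Λ * u) := by
    gcongr
    rw [coe_projIcc]
    exact max_le hu ((min_le_right _ _).trans hs)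
  have h4 : 1 ≤ Real.exp (Λ * u) := Real.one_le_exp (by positivity)
  rw [e]
  refine (norm_sub_le _ _).trans ?_
  rw [norm_smul, Real.norm_of_nonneg (Real.exp_pos _).le]
  have h5 : Real.exp (Λ * projIcc 0 T hT s) * ‖(v - w) (projIcc 0 T hT s)‖
      ≤ Real.exp (Λ * u) * ‖v - w‖ := by gcongr
  nlinarith [norm_nonneg (v - w)]

variable {B : E →L[ℝ] E} {f : C(Icc (-r) 0, E) → E} {g : C(Icc (-r) 0, E) → F →L[ℝ] E}
  {Cf : ℝ≥0} {Cg : ℝ}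

/-- The right-hand side `B y(u) + f(y_u) + g(y_u) p'(u)` for a smooth driver `p`. -/
def smoothRhs (r : ℝ) (B : E →L[ℝ] E) (f : C(Icc (-r) 0, E) → E)
    (g : C(Icc (-r) 0, E) → F →L[ℝ] E) (p : ℝ → F) (y : C(ℝ, E)) (u : ℝ) : E :=
  drift r B f y u + g (segment r y u) (deriv p u)

lemma RegularCoeff.continuous_smoothRhs (hc : RegularCoeff r f g Cf Cg) {p : ℝ → F}
    (hp : ContDiff ℝ 1 p) (y : C(ℝ, E)) : Continuous (smoothRhs r B f g p y) :=
  (continuous_drift hc.lip.continuous y).add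
    ((hc.continuous_g y).clm_apply (hp.continuous_deriv le_rfl))

lemma RegularCoeff.smoothRhs_lip (hc : RegularCoeff r f g Cf Cg) {p : ℝ → F} {M δ u : ℝ}
    (hM : ‖deriv p u‖ ≤ M) (hδ : 0 ≤ δ) {y z : C(ℝ, E)}
    (h : ∀ s ∈ Icc (u - r) u, ‖y s - z s‖ ≤ δ) :
    ‖smoothRhs r B f g p y u - smoothRhs r B f g p z u‖ ≤ (‖B‖ + Cf + Cg * M) * δ := by
  have hCg := hc.Cg_nonneg
  have hseg : ‖segment r y u - segment r z u‖ ≤ δ := by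
    rw [segment_sub]
    exact norm_segment_le hδ h
  have e : smoothRhs r B f g p y u - smoothRhs r B f g p z u
      = B (y u - z u) + (f (segment r y u) - f (segment r z u))
        + (g (segment r y u) - g (segment r z u)) (deriv p u) := by
    simp only [smoothRhs, drift, map_sub, sub_apply]; abel
  have h0 := h u ⟨by linarith [hc.r_pos], le_rfl⟩
  have hM0 := (norm_nonneg _).trans hM
  rw [e]
  calc _ ≤ ‖B‖ * ‖y u - z u‖ + Cf * ‖segment r y u - segment r z u‖
        + (Cg * ‖segment r y u - segment r z u‖) * ‖deriv p u‖ := by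
        refine (norm_add_le _ _).trans (add_le_add ((norm_add_le _ _).trans
          (add_le_add (B.le_opNorm _) (hc.f_lip _ _))) ((ContinuousLinearMap.le_opNorm _ _).trans ?_))
        gcongr
        exact hc.g_lip _ _
    _ ≤ ‖B‖ * δ + Cf * δ + (Cg * δ) * M := by gcongr
    _ = _ := by ring

/-- The delay equation driven by a continuously differentiable path has a solution. -/
theorem exists_solution_smooth [CompleteSpace E] (hc : RegularCoeff r f g Cf Cg) {β₀ ν : ℝ≥0}
    (he : YoungExponents β₀ ν) (B : E →L[ℝ] E) {p : ℝ → F} (hp : ContDiff ℝ 1 p)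
    {η : C(Icc (-r) 0, E)} (hη : MemHolder β₀ η) (T : ℝ) (hT : 0 ≤ T) :
    ∃ y : C(ℝ, E), segment r y 0 = η ∧ IsDavieSolution r β₀ ν B f g p T y := by
  have hr := hc.r_pos
  have hCg := hc.Cg_nonneg
  obtain ⟨M', hM'⟩ := isCompact_Icc.exists_bound_of_continuousOn (s := Icc 0 T)
    (hp.continuous_deriv le_rfl).continuousOn
  set M := |M'|
  have hM : ∀ u ∈ Icc 0 T, ‖deriv p u‖ ≤ M := fun u hu => (hM' u hu).trans (le_abs_self _)
  set ℓ := ‖B‖ + Cf + Cg * M with hℓ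
  have hℓ0 : 0 ≤ ℓ := by positivity
  -- The contraction rate comes out as `2 * ℓ / Λ`, which is at most `1 / 2`; the summand `1` keeps
  -- `Λ` positive when `ℓ = 0`.
  set Λ := 4 * ℓ + 1 with hΛ
  have hΛ0 : 0 < Λ := by positivity
  let Y := prolong hr hT Λ η
  have hrhs : ∀ v, Continuous (smoothRhs r B f g p (Y v)) := fun v => hc.continuous_smoothRhs hp _
  let Ψ : C(Icc 0 T, E) → C(Icc 0 T, E) := fun v =>
    ⟨fun t => Real.exp (-(Λ * t)) • ∫ u in (0 : ℝ)..t, smoothRhs r B f g p (Y v) u, by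
      refine Continuous.smul (by fun_prop) ?_
      exact (intervalIntegral.continuous_primitive
        (fun a b => (hrhs v).intervalIntegrable a b) 0).comp continuous_subtype_val⟩
  have hΨ : ContractingWith (1 / 2) Ψ := by
    refine ⟨by
      rw [← NNReal.coe_lt_coe]; norm_num, LipschitzWith.of_dist_le_mul fun v w => ?_⟩
    rw [dist_eq_norm, dist_eq_norm, ContinuousMap.norm_le _ (by positivity)]
    intro t
    have hi := intervalIntegral.norm_integral_le_of_norm_le (a := 0) (b := t) (μ := volume)
      (f := fun u => smoothRhs r B f g p (Y v) u - smoothRhs r B f g p (Y w) u)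
      (g := fun u => (2 * ℓ * ‖v - w‖ / Λ) * (Real.exp (Λ * u) * Λ)) t.2.1
      (Eventually.of_forall fun u hu => ?_) (Continuous.intervalIntegrable (by fun_prop) _ _)
    · have hint : ∫ u in (0 : ℝ)..t, (2 * ℓ * ‖v - w‖ / Λ) * (Real.exp (Λ * u) * Λ)
          = (2 * ℓ * ‖v - w‖ / Λ) * (Real.exp (Λ * t) - 1) := by
        rw [intervalIntegral.integral_const_mul,
          intervalIntegral.integral_eq_sub_of_hasDerivAt (f := fun u => Real.exp (Λ * u))]
        · simp
        · intro u _
          simpa using (((hasDerivAt_id u).const_mul Λ).exp)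
        · exact Continuous.intervalIntegrable (by fun_prop) _ _
      rw [hint, intervalIntegral.integral_sub ((hrhs v).intervalIntegrable _ _)
        ((hrhs w).intervalIntegrable _ _)] at hi
      have e : (Ψ v - Ψ w) t = Real.exp (-(Λ * t)) •
          ((∫ u in (0 : ℝ)..t, smoothRhs r B f g p (Y v) u)
            - ∫ u in (0 : ℝ)..t, smoothRhs r B f g p (Y w) u) := by
        rw [smul_sub]; rfl
      rw [e, norm_smul, Real.norm_of_nonneg (Real.exp_pos _).le]
      have h1 : 2 * ℓ * ‖v - w‖ / Λ ≤ 1 / 2 * ‖v - w‖ := by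
        rw [div_le_iff₀ hΛ0, hΛ]
        nlinarith [norm_nonneg (v - w)]
      calc _ ≤ Real.exp (-(Λ * t)) * ((2 * ℓ * ‖v - w‖ / Λ) * (Real.exp (Λ * t) - 1)) := by gcongr
        _ ≤ Real.exp (-(Λ * t)) * ((1 / 2 * ‖v - w‖) * Real.exp (Λ * t)) := by
            gcongr
            · have := Real.one_le_exp (mul_nonneg hΛ0.le t.2.1)
              linarith
            · linarith
        _ = 1 / 2 * ‖v - w‖ * (Real.exp (-(Λ * t)) * Real.exp (Λ * t)) := by ring
        _ = _ := by rw [← Real.exp_add]; simp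
    · have hu1 : u ∈ Icc 0 T := ⟨hu.1.le, hu.2.trans t.2.2⟩
      have := hc.smoothRhs_lip (B := B) (hM u hu1) (δ := 2 * Real.exp (Λ * u) * ‖v - w‖)
        (by positivity) (y := Y v) (z := Y w) fun s hs =>
          norm_prolong_sub_le hr hT η hΛ0.le v w hu1.1 hs.2
      refine this.trans_eq ?_
      rw [← hℓ]
      field_simp
  obtain ⟨v, hv⟩ : ∃ v, Ψ v = v := ⟨_, hΨ.fixedPoint_isFixedPt⟩
  set y := Y v
  have hv' : ∀ t (ht : t ∈ Icc 0 T), v ⟨t, ht⟩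
      = Real.exp (-(Λ * t)) • ∫ u in (0 : ℝ)..t, smoothRhs r B f g p y u := fun t ht => by
    conv_lhs => rw [← hv]
    rfl
  have hseg : segment r y 0 = η := by
    ext s
    rw [segment_apply, zero_add]
    exact prolong_of_nonpos hr hT Λ η v s.2
  have hy : ∀ t ∈ Icc 0 T, y t = y 0 + ∫ u in (0 : ℝ)..t, smoothRhs r B f g p y u := by
    intro t ht
    have e0 : v ⟨0, le_rfl, hT⟩ = 0 := by simp [hv' 0 ⟨le_rfl, hT⟩]
    have e1 := prolong_of_mem hr hT Λ η v ht
    have e2 := prolong_of_nonpos hr hT Λ η v (t := 0) ⟨by linarith, le_rfl⟩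
    change Y v t = Y v 0 + _
    rw [e1, e2, e0, hv' t ht, smul_smul, ← Real.exp_add]
    simp
  have hyc : Continuous (smoothRhs r B f g p y) := hrhs v
  have hH : ∃ H, 0 ≤ H ∧ HolderBound β₀ H (-r) T y := by
    obtain ⟨C, hC⟩ := hη
    have h1 : HolderBound β₀ C (-r) 0 y := fun s t hs hst ht => by
      have := holderWith_iff.1 hC ⟨s, hs, hst.trans ht⟩ ⟨t, hs.trans hst, ht⟩ hst
      rw [← hseg] at this
      simpa using this
    obtain ⟨K, hK⟩ := isCompact_Icc.exists_bound_of_continuousOn (s := Icc 0 T) hyc.continuousOn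
    have h2 : HolderBound 1 |K| 0 T y := fun s t hs hst ht => by
      rw [hy t ⟨hs.trans hst, ht⟩, hy s ⟨hs, hst.trans ht⟩, add_sub_add_left_eq_sub,
        intervalIntegral.integral_interval_sub_left (hyc.intervalIntegrable _ _)
          (hyc.intervalIntegrable _ _), Real.rpow_one]
      have := intervalIntegral.norm_integral_le_of_norm_le_const (a := s) (b := t) (C := |K|)
        (f := smoothRhs r B f g p y) fun u hu => by
          rw [uIoc_of_le hst] at hu
          exact (hK u ⟨hs.trans hu.1.le, hu.2.trans ht⟩).trans (le_abs_self _)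
      rwa [abs_of_nonneg (sub_nonneg.2 hst)] at this
    have h3 := h2.of_exponent_le he.pos (he.lt.le.trans he.le_one) (abs_nonneg K)
      (L := T) (by linarith)
    have h4 : 0 ≤ |K| * T ^ (1 - (β₀ : ℝ)) := by positivity
    exact ⟨_, by positivity, h1.trans h3 β₀.coe_nonneg C.coe_nonneg h4⟩
  obtain ⟨H, hH0, hH⟩ := hH
  refine ⟨y, hseg, ⟨H, hH0, hH⟩, ?_⟩
  obtain ⟨C, hC⟩ := sewnBy_smooth (ν := (ν : ℝ)) he.pos ν.coe_nonneg he.le_one (by positivity)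
    (hc.continuous_g y) hp (hc.holderBound_g (a := 0) (b := T) hH0 (by simpa using hH))
  refine ⟨C, fun s t hs hst ht => ?_⟩
  have hdc := continuous_drift (B := B) hc.lip.continuous y
  have hgc : Continuous fun u => g (segment r y u) (deriv p u) :=
    (hc.continuous_g y).clm_apply (hp.continuous_deriv le_rfl)
  have e : ∀ t ∈ Icc 0 T, driftFree r B f y t
      = y 0 + ∫ u in (0 : ℝ)..t, g (segment r y u) (deriv p u) := fun t ht => by
    rw [driftFree, hy t ht]
    simp only [smoothRhs]
    rw [intervalIntegral.integral_add (hdc.intervalIntegrable _ _) (hgc.intervalIntegrable _ _)]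
    abel
  rw [e t ⟨hs.trans hst, ht⟩, e s ⟨hs, hst.trans ht⟩, add_sub_add_left_eq_sub]
  exact hC s t hs hst ht

end SmoothDriver

end YoungDelay

namespace YoungDelay

/-! ### Variation of constants and the residual of a solution -/

section VariationOfConstants

variable {E : Type*} [NormedAddCommGroup E] [NormedSpace ℝ E] [CompleteSpace E] {r : ℝ}

/-- The semigroup `e^{tB}`. -/
def linFlow (B : E →L[ℝ] E) (t : ℝ) : E →L[ℝ] E := NormedSpace.exp (t • B)

variable (B : E →L[ℝ] E)

lemma hasDerivAt_linFlow (t : ℝ) : HasDerivAt (linFlow B) (linFlow B t * B) t :=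
  hasDerivAt_exp_smul_const B t

lemma continuous_linFlow : Continuous (linFlow B) :=
  continuous_iff_continuousAt.2 fun t => (hasDerivAt_linFlow B t).continuousAt

lemma linFlow_zero : linFlow B 0 = 1 := by simp [linFlow]

lemma linFlow_add (s t : ℝ) : linFlow B (s + t) = linFlow B s * linFlow B t := by
  let _ : NormedAlgebra ℚ (E →L[ℝ] E) := NormedAlgebra.restrictScalars ℚ ℝ _
  rw [linFlow, add_smul, linFlow, linFlow]
  exact NormedSpace.exp_add_of_commute (((Commute.refl B).smul_left s).smul_right t)

/-- Variation of constants for `z' = B z + F`. -/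
lemma variation_of_constants {z F : ℝ → E} (hF : Continuous F)
    (hz : ∀ u, HasDerivAt z (B (z u) + F u) u) (a t : ℝ) :
    z t = linFlow B (t - a) (z a) + ∫ u in a..t, linFlow B (t - u) (F u) := by
  have hd : ∀ u, HasDerivAt (fun u => linFlow B (t - u) (z u)) (linFlow B (t - u) (F u)) u := by
    intro u
    have h1 : HasDerivAt (fun u => linFlow B (t - u)) (-(linFlow B (t - u) * B)) u := by
      have h0 := (hasDerivAt_linFlow B (t - u)).scomp u ((hasDerivAt_id u).const_sub t)
      rw [neg_smul, one_smul] at h0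
      exact h0
    have h2 := h1.clm_apply (hz u)
    convert h2 using 1
    simp [map_add]
  have hc : Continuous fun u => linFlow B (t - u) (F u) :=
    ((continuous_linFlow B).comp (continuous_const.sub continuous_id)).clm_apply hF
  rw [intervalIntegral.integral_eq_sub_of_hasDerivAt (fun u _ => hd u) (hc.intervalIntegrable _ _),
    sub_self, linFlow_zero]
  simp

variable {B} {f : C(Icc (-r) 0, E) → E}

lemma continuous_driftFree (hf : Continuous f) (y : C(ℝ, E)) : Continuous (driftFree r B f y) :=
  y.continuous.sub (intervalIntegral.continuous_primitive
    (fun a b => (continuous_drift hf y).intervalIntegrable a b) 0)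

/-- The contribution of the increments of the drift-free part from time `a` on. -/
def forcing (r : ℝ) (B : E →L[ℝ] E) (f : C(Icc (-r) 0, E) → E) (y : C(ℝ, E)) (a t : ℝ) : E :=
  (driftFree r B f y t - driftFree r B f y a)
    + ∫ u in a..t, linFlow B (t - u) (B (driftFree r B f y u - driftFree r B f y a))

/-- The path `y` itself need not be differentiable, but after subtracting the increments `w` of its
drift-free part it solves a linear equation with the continuous inhomogeneity `f (segment r y u) + B
(w u)`. Variation of constants applies to `y - w`, and no stochastic convolution is needed. -/
lemma eq_linFlow_add_forcing (hf : Continuous f) (y : C(ℝ, E)) (a t : ℝ) :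
    y t = linFlow B (t - a) (y a) + (∫ u in a..t, linFlow B (t - u) (f (segment r y u)))
      + forcing r B f y a t := by
  set w := fun u => driftFree r B f y u - driftFree r B f y a
  have hwc : Continuous w := (continuous_driftFree hf y).sub continuous_const
  have hdc := continuous_drift (B := B) hf y
  have hfc : Continuous fun u => f (segment r y u) := hf.comp (continuous_segment y)
  have hBw : Continuous fun u => B (w u) := B.continuous.comp hwc
  have hz : ∀ u, HasDerivAt (fun u => y u - w u)
      (B (y u - w u) + (f (segment r y u) + B (w u))) u := by
    intro u
    have e1 : (fun u => y u - w u)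
        = fun u => driftFree r B f y a + ∫ v in (0 : ℝ)..u, drift r B f y v := by
      funext u
      simp only [w, driftFree]; abel
    have e2 : B (y u - w u) + (f (segment r y u) + B (w u)) = drift r B f y u := by
      simp only [drift, map_sub]; abel
    rw [e1, e2]
    exact (intervalIntegral.integral_hasDerivAt_right (hdc.intervalIntegrable _ _)
      (hdc.stronglyMeasurableAtFilter _ _) hdc.continuousAt).const_add _
  have h := variation_of_constants B (hfc.add hBw) hz a t
  have hl : Continuous fun u => linFlow B (t - u) :=
    (continuous_linFlow B).comp (continuous_const.sub continuous_id)
  have hwa : w a = 0 := sub_self _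
  simp only [Pi.add_apply, map_add, hwa, sub_zero] at h
  rw [intervalIntegral.integral_add ((hl.clm_apply hfc).intervalIntegrable _ _)
    ((hl.clm_apply hBw).intervalIntegrable _ _)] at h
  have e : y t = (y t - w t) + w t := by abel
  rw [e, h]
  change _ + w t = _ + (w t + ∫ u in a..t, linFlow B (t - u) (B (w u)))
  abel

/-- The part of the path that is not explained by the initial value and the nonlinearity `f`. -/
def residual (r : ℝ) (B : E →L[ℝ] E) (f : C(Icc (-r) 0, E) → E) (y : C(ℝ, E)) (t : ℝ) : E :=
  y t - linFlow B t (y 0) - ∫ u in (0 : ℝ)..t, linFlow B (t - u) (f (segment r y u))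

/-- The semigroup property cancels the initial value and the nonlinearity, which leaves a linear
recursion driven by the increments of the drift-free part on a single grid cell. -/
lemma residual_step (hf : Continuous f) (y : C(ℝ, E)) (a t : ℝ) :
    residual r B f y t = linFlow B (t - a) (residual r B f y a) + forcing r B f y a t := by
  have hfc : Continuous fun u => f (segment r y u) := hf.comp (continuous_segment y)
  have hl : ∀ t, Continuous fun u => linFlow B (t - u) (f (segment r y u)) := fun t =>
    ((continuous_linFlow B).comp (continuous_const.sub continuous_id)).clm_apply hfc
  have e1 : linFlow B (t - a) (∫ u in (0 : ℝ)..a, linFlow B (a - u) (f (segment r y u)))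
      = ∫ u in (0 : ℝ)..a, linFlow B (t - u) (f (segment r y u)) := by
    rw [← ContinuousLinearMap.intervalIntegral_comp_comm _ ((hl a).intervalIntegrable _ _)]
    congr 1
    funext u
    rw [← mul_apply_eq_comp, ← linFlow_add]
    congr 2; ring
  have e2 : linFlow B (t - a) (linFlow B a (y 0)) = linFlow B t (y 0) := by
    rw [← mul_apply_eq_comp, ← linFlow_add, sub_add_cancel]
  have e3 := eq_linFlow_add_forcing (B := B) hf y a t
  have e4 := intervalIntegral.integral_add_adjacent_intervals
    ((hl t).intervalIntegrable (μ := volume) 0 a) ((hl t).intervalIntegrable a t)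
  rw [residual, residual, map_sub, map_sub, e1, e2, ← e4, e3]
  abel

lemma residual_zero (y : C(ℝ, E)) : residual r B f y 0 = 0 := by
  simp [residual, linFlow_zero]

lemma norm_forcing_le {CA lam : ℝ} (hlam : 0 ≤ lam) (hCA : 0 ≤ CA)
    (hB : ∀ t, 0 ≤ t → ‖linFlow B t‖ ≤ CA * Real.exp (-lam * t)) {y : C(ℝ, E)} {ν W a b t : ℝ}
    (hν : 0 ≤ ν) (hW : 0 ≤ W) (ht : t ∈ Icc a b) (hba : b - a ≤ r)
    (h : HolderBound ν W a b (driftFree r B f y)) :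
    ‖forcing r B f y a t‖ ≤ r ^ ν * (1 + CA * ‖B‖ * r) * W := by
  have hw : ∀ u, a ≤ u → u ≤ t → ‖driftFree r B f y u - driftFree r B f y a‖ ≤ W * r ^ ν :=
    fun u h1 h2 => (h a u le_rfl h1 (h2.trans ht.2)).trans (by
      have h3 : (u - a) ^ ν ≤ r ^ ν :=
        Real.rpow_le_rpow (by linarith) (by linarith [ht.2]) hν
      gcongr)
  have hr : 0 ≤ r := by linarith [ht.1, ht.2]
  have h1 := intervalIntegral.norm_integral_le_of_norm_le_const (a := a) (b := t)
    (f := fun u => linFlow B (t - u) (B (driftFree r B f y u - driftFree r B f y a)))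
    (C := CA * (‖B‖ * (W * r ^ ν))) fun u hu => by
      rw [uIoc_of_le ht.1] at hu
      have h2 : ‖linFlow B (t - u)‖ ≤ CA := (hB _ (by linarith [hu.2])).trans
        (mul_le_of_le_one_right hCA (Real.exp_le_one_iff.2 (by nlinarith [hu.2])))
      have h3 := hw u hu.1.le hu.2
      calc _ ≤ ‖linFlow B (t - u)‖ * (‖B‖ * ‖driftFree r B f y u - driftFree r B f y a‖) :=
            (ContinuousLinearMap.le_opNorm _ _).trans
              (mul_le_mul_of_nonneg_left (B.le_opNorm _) (norm_nonneg _))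
        _ ≤ _ := by gcongr
  rw [abs_of_nonneg (by linarith [ht.1])] at h1
  have h4 : t - a ≤ r := by linarith [ht.2]
  rw [forcing]
  calc _ ≤ W * r ^ ν + CA * (‖B‖ * (W * r ^ ν)) * (t - a) :=
        (norm_add_le _ _).trans (add_le_add (hw t ht.1 le_rfl) h1)
    _ ≤ W * r ^ ν + CA * (‖B‖ * (W * r ^ ν)) * r := by gcongr
    _ = _ := by ring

/-- Geometrically weighted increments of the drift-free part produce a geometrically weighted
residual. -/
lemma norm_residual_le (hf : Continuous f) {CA lam μ ν : ℝ} (hμ : 0 < μ) (hμl : μ < lam)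
    (hCA : 0 ≤ CA) (hB : ∀ t, 0 ≤ t → ‖linFlow B t‖ ≤ CA * Real.exp (-lam * t)) (hν : 0 ≤ ν)
    (hr : 0 < r) :
    ∃ Ch, 0 ≤ Ch ∧ ∀ (n : ℕ) (y : C(ℝ, E)) (W : ℝ), 0 ≤ W →
      (∀ j < n, HolderBound ν (Real.exp (-μ * (r * j)) * W) (j * r) ((j + 1) * r)
        (driftFree r B f y)) →
      ∀ j < n, ∀ t ∈ Icc (j * r) ((j + 1) * r),
        ‖residual r B f y t‖ ≤ Ch * (Real.exp (-μ * (r * j)) * W) := by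
  set cw := r ^ ν * (1 + CA * ‖B‖ * r) with hcw
  have hcw0 : 0 ≤ cw := by positivity
  set ρ := Real.exp (-(lam - μ) * r) with hρ
  have hρ1 : ρ < 1 := (Real.exp_lt_exp.2 (by nlinarith : _ < (0 : ℝ))).trans_eq Real.exp_zero
  -- `Y` is the fixed point of the recursion for the weighted residual; `ρ < 1` because `μ < lam`.
  set Y := CA * cw * Real.exp (μ * r) / (1 - ρ) with hY
  have hY0 : 0 ≤ Y := div_nonneg (by positivity) (by linarith)
  have hYeq : ρ * Y + CA * cw * Real.exp (μ * r) = Y := by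
    rw [hY]; field_simp [(by linarith : (1 : ℝ) - ρ ≠ 0)]; ring
  have hlam : 0 ≤ lam := (hμ.trans hμl).le
  refine ⟨Y + cw, by positivity, fun n y W hW hinc => ?_⟩
  have hforce : ∀ j < n, ∀ t ∈ Icc (j * r) ((j + 1) * r),
      ‖forcing r B f y (j * r) t‖ ≤ cw * (Real.exp (-μ * (r * j)) * W) := fun j hj t ht =>
    norm_forcing_le hlam hCA hB hν (by positivity) ht (by linarith) (hinc j hj)
  -- The induction bounds the residual after a further linear flow of arbitrary duration `s`. In
  -- this form each forcing term meets the semigroup once, and `CA` is not multiplied from cell to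
  -- cell.
  have hgrid : ∀ j ≤ n, ∀ s, 0 ≤ s → ‖linFlow B s (residual r B f y (j * r))‖
      ≤ Real.exp (-lam * s) * (Y * (Real.exp (-μ * (r * j)) * W)) := by
    intro j
    induction j with
    | zero =>
      intro _ s _
      simp only [Nat.cast_zero, zero_mul, residual_zero, map_zero, norm_zero]
      positivity
    | succ j ih =>
      intro hj s hs
      have h1 := ih (by omega) (s + r) (by linarith)
      have h2 := hforce j (by omega) ((j + 1) * r) ⟨by nlinarith, le_rfl⟩
      have e : linFlow B s (residual r B f y ((j + 1 : ℕ) * r))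
          = linFlow B (s + r) (residual r B f y (j * r))
            + linFlow B s (forcing r B f y (j * r) ((j + 1) * r)) := by
        rw [residual_step hf y (j * r) ((j + 1 : ℕ) * r), map_add, ← mul_apply_eq_comp,
          ← linFlow_add]
        push_cast
        congr 3; ring_nf
      rw [e]
      have e1 : Real.exp (-lam * (s + r)) * (Y * (Real.exp (-μ * (r * j)) * W))
          = Real.exp (-lam * s) * ((ρ * Y) * (Real.exp (-μ * (r * (j + 1 : ℕ))) * W)) := by
        rw [hρ]
        have : Real.exp (-lam * (s + r)) * Real.exp (-μ * (r * j)) = Real.exp (-lam * s)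
            * Real.exp (-(lam - μ) * r) * Real.exp (-μ * (r * (j + 1 : ℕ))) := by
          rw [← Real.exp_add, ← Real.exp_add, ← Real.exp_add]; push_cast; ring_nf
        linear_combination Y * W * this
      have e2 : Real.exp (-μ * (r * j)) = Real.exp (μ * r) * Real.exp (-μ * (r * (j + 1 : ℕ))) := by
        rw [← Real.exp_add]; push_cast; ring_nf
      rw [e1] at h1
      rw [e2] at h2
      have h3 := hB s hs
      calc _ ≤ Real.exp (-lam * s) * ((ρ * Y) * (Real.exp (-μ * (r * (j + 1 : ℕ))) * W))
            + (CA * Real.exp (-lam * s)) * (cw * (Real.exp (μ * r)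
              * Real.exp (-μ * (r * (j + 1 : ℕ))) * W)) := by
            refine (norm_add_le _ _).trans (add_le_add h1 ((ContinuousLinearMap.le_opNorm _ _).trans ?_))
            gcongr
        _ = Real.exp (-lam * s) * ((ρ * Y + CA * cw * Real.exp (μ * r))
              * (Real.exp (-μ * (r * (j + 1 : ℕ))) * W)) := by ring
        _ = _ := by rw [hYeq]
  intro j hj t ht
  have h1 := hgrid j hj.le (t - j * r) (by linarith [ht.1])
  have h2 := hforce j hj t ht
  have h3 : Real.exp (-lam * (t - j * r)) ≤ 1 :=
    Real.exp_le_one_iff.2 (by nlinarith [ht.1])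
  rw [residual_step hf y (j * r) t, add_mul]
  refine (norm_add_le _ _).trans (add_le_add (h1.trans ?_) h2)
  exact mul_le_of_le_one_left (by positivity) h3

end VariationOfConstants

end YoungDelay

namespace YoungDelay

/-! ### Sublinear dependence of the noise term on the solution -/

section Increments

variable {E F : Type*} [NormedAddCommGroup E] [NormedSpace ℝ E] [NormedAddCommGroup F]
  [NormedSpace ℝ F] {r : ℝ} {B : E →L[ℝ] E} {f : C(Icc (-r) 0, E) → E}
  {g : C(Icc (-r) 0, E) → F →L[ℝ] E} {Cf : ℝ≥0} {Cg : ℝ}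

/-- Interpolation between a bound and a Hölder bound. -/
lemma HolderBound.interpolate {G : ℝ → E} {K H β γ a b : ℝ} (hK : 0 ≤ K) (hH : 0 ≤ H)
    (hγ0 : 0 ≤ γ) (hγ1 : γ ≤ 1) (hG : ∀ t ∈ Icc a b, ‖G t‖ ≤ K) (h : HolderBound β H a b G) :
    HolderBound (γ * β) ((2 * K) ^ (1 - γ) * H ^ γ) a b G := fun s t hs hst ht => by
  have h0 : 0 ≤ t - s := sub_nonneg.2 hst
  have h1 : ‖G t - G s‖ ≤ 2 * K := (norm_sub_le _ _).trans (by
    linarith [hG t ⟨hs.trans hst, ht⟩, hG s ⟨hs, hst.trans ht⟩])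
  have h2 := h s t hs hst ht
  have e : ‖G t - G s‖ = ‖G t - G s‖ ^ (1 - γ) * ‖G t - G s‖ ^ γ := by
    rw [← Real.rpow_add_of_nonneg (norm_nonneg _) (sub_nonneg.2 hγ1) hγ0, sub_add_cancel,
      Real.rpow_one]
  rw [e, mul_assoc]
  have h3 : ‖G t - G s‖ ^ (1 - γ) ≤ (2 * K) ^ (1 - γ) :=
    Real.rpow_le_rpow (norm_nonneg _) h1 (sub_nonneg.2 hγ1)
  have h4 : ‖G t - G s‖ ^ γ ≤ H ^ γ * (t - s) ^ (γ * β) := by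
    refine (Real.rpow_le_rpow (norm_nonneg _) h2 hγ0).trans_eq ?_
    rw [Real.mul_rpow hH (Real.rpow_nonneg h0 _), ← Real.rpow_mul h0, mul_comm β]
  gcongr

/-- Sublinear growth is absorbed by a small linear term. -/
lemma exists_absorb {γ c ε : ℝ} (hγ0 : 0 < γ) (hγ1 : γ < 1) (hc : 0 ≤ c) (hε : 0 < ε) :
    ∃ C, 0 ≤ C ∧ ∀ h q : ℝ, 0 ≤ h → 0 ≤ q →
      c * h ^ γ * q ≤ ε * h + C * (1 + q) ^ (1 / (1 - γ)) := by
  have h1 : 0 < 1 - γ := sub_pos.2 hγ1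
  -- Weighted arithmetic–geometric mean inequality with weights `γ` and `1 - γ`, applied to `ε * h`
  -- and a power of `c * ε ^ (-γ) * q`.
  refine ⟨(1 - γ) * (c * ε ^ (-γ)) ^ (1 / (1 - γ)), by positivity, fun h q hh hq => ?_⟩
  have key := Real.geom_mean_le_arith_mean2_weighted hγ0.le h1.le (mul_nonneg hε.le hh)
    (Real.rpow_nonneg (by positivity : 0 ≤ c * ε ^ (-γ) * q) (1 / (1 - γ))) (by ring)
  have e1 : ((c * ε ^ (-γ) * q) ^ (1 / (1 - γ))) ^ (1 - γ) = c * ε ^ (-γ) * q := by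
    rw [← Real.rpow_mul (by positivity), one_div_mul_cancel h1.ne', Real.rpow_one]
  have e2 : (ε * h) ^ γ * (c * ε ^ (-γ) * q) = c * h ^ γ * q := by
    rw [Real.mul_rpow hε.le hh]
    have : ε ^ γ * ε ^ (-γ) = 1 := by rw [← Real.rpow_add hε]; simp
    linear_combination c * h ^ γ * q * this
  rw [e1, e2] at key
  have h2 : (c * ε ^ (-γ) * q) ^ (1 / (1 - γ))
      ≤ (c * ε ^ (-γ)) ^ (1 / (1 - γ)) * (1 + q) ^ (1 / (1 - γ)) := by
    rw [Real.mul_rpow (by positivity) hq]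
    gcongr
    linarith
  have h3 : γ * (ε * h) ≤ ε * h := mul_le_of_le_one_left (by positivity) hγ1.le
  have h4 := mul_le_mul_of_nonneg_left h2 h1.le
  linarith

/-- For a bounded diffusion coefficient the increments of the drift-free part depend sublinearly
on the Hölder bound of the solution. -/
lemma exists_driftFree_bound (hc : RegularCoeff r f g Cf Cg) {β₀ ν : ℝ}
    (he : YoungExponents β₀ ν) {K : ℝ} (hK : ∀ ξ, ‖g ξ‖ ≤ K) :
    ∃ p : ℝ, 1 ≤ p ∧ ∀ ε : ℝ, 0 < ε → ∃ Cε, 0 ≤ Cε ∧ ∀ (x : ℝ → F) (y : C(ℝ, E)) (T a b h q : ℝ),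
      IsDavieSolution r β₀ ν B f g x T y → 0 ≤ a → b ≤ T → b - a ≤ r → 0 ≤ h → 0 ≤ q →
      HolderBound β₀ h (a - r) b y → HolderBound ν q 0 T x →
      HolderBound ν (ε * h + Cε * (1 + q) ^ p) a b (driftFree r B f y) := by
  have hr := hc.r_pos
  have hCg := hc.Cg_nonneg
  have hβ := he.pos
  have hβ1 : β₀ < 1 := he.lt.trans_le he.le_one
  have hone := he.one_lt
  have hν0 : 0 ≤ ν := he.pos.le.trans he.lt.le
  have hK0 : 0 ≤ K := (norm_nonneg _).trans (hK 0)
  -- Halfway between `1 - ν` and `β₀`: large enough for the Young integral to exist at exponent `α`,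
  -- small enough that the interpolation exponent `γ = α / β₀` is below one.
  set α := (1 - ν + β₀) / 2 with hα
  have hα0 : 0 < α := by have := he.le_one; rw [hα]; linarith
  have hαβ : α < β₀ := by rw [hα]; linarith
  have hαν : 1 < α + ν := by rw [hα]; linarith
  set γ := α / β₀ with hγ
  have hγ0 : 0 < γ := div_pos hα0 hβ
  have hγ1 : γ < 1 := (div_lt_one hβ).2 hαβ
  have hγβ : γ * β₀ = α := div_mul_cancel₀ _ hβ.ne'
  have hs0 := sewingConst_pos hαν
  have h1γ : 0 < 1 - γ := sub_pos.2 hγ1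
  have hp1 : 1 ≤ 1 / (1 - γ) := by rw [le_div_iff₀ h1γ]; linarith
  refine ⟨1 / (1 - γ), hp1, fun ε hε => ?_⟩
  set c := sewingConst (α + ν) * ((2 * K) ^ (1 - γ) * Cg ^ γ) * r ^ α with hcdef
  have hc0 : 0 ≤ c := by positivity
  obtain ⟨C, hC0, hC⟩ := exists_absorb hγ0 hγ1 hc0 hε
  refine ⟨K + C, by positivity, fun x y T a b h q hy ha hbT hba hh hq hyh hxq => ?_⟩
  obtain ⟨D, hD⟩ := hy.expansion
  have hG : HolderBound α ((2 * K) ^ (1 - γ) * (Cg * h) ^ γ) a b (fun u => g (segment r y u)) := by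
    have := (hc.holderBound_g hh hyh).interpolate hK0 (by positivity) hγ0.le hγ1.le
      (fun t _ => hK _)
    rwa [hγβ] at this
  have hx : HolderBound ν q a b x := hxq.mono le_rfl ha hbT
  -- The expansion is known at order `β₀ + ν` with an uncontrolled constant. Lowering the order to
  -- `α + ν` allows the improvement to use the interpolated, sublinear Hölder constant of `g(y_t)`.
  have hJ := ((hD.mono (le_abs_self D) ha hbT).of_order_le (abs_nonneg D)
    (θ' := α + ν) (by linarith) (by linarith)).improve hαν (by positivity)
    (youngGerm_defect hα0.le hν0 (by positivity) hG hx)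
  intro s t hs hst ht
  have hst0 : 0 ≤ t - s := sub_nonneg.2 hst
  have h1 := hJ s t hs hst ht
  have h2 : ‖youngGerm (fun u => g (segment r y u)) x s t‖ ≤ K * (q * (t - s) ^ ν) := by
    refine (ContinuousLinearMap.le_opNorm _ _).trans ?_
    have := hx s t hs hst ht
    have := hK (segment r y s)
    gcongr
  have h3 : (t - s) ^ (α + ν) ≤ r ^ α * (t - s) ^ ν := by
    rw [Real.rpow_add_of_nonneg hst0 hα0.le hν0]
    gcongr
    linarith
  have h4 : q ≤ (1 + q) ^ (1 / (1 - γ)) :=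
    calc q ≤ (1 + q) ^ (1 : ℝ) := by rw [Real.rpow_one]; linarith
      _ ≤ _ := Real.rpow_le_rpow_of_exponent_le (by linarith) hp1
  have h5 := hC h q hh hq
  have h6 := norm_le_norm_add_norm_sub' (driftFree r B f y t - driftFree r B f y s)
    (youngGerm (fun u => g (segment r y u)) x s t)
  have h7 : 0 ≤ (t - s) ^ ν := Real.rpow_nonneg hst0 _
  calc _ ≤ K * (q * (t - s) ^ ν) + sewingConst (α + ν)
          * ((2 * K) ^ (1 - γ) * (Cg * h) ^ γ * q) * (r ^ α * (t - s) ^ ν) :=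
        h6.trans (add_le_add h2 (h1.trans (by gcongr)))
    _ = (K * q + c * h ^ γ * q) * (t - s) ^ ν := by
        rw [Real.mul_rpow hCg hh, hcdef]; ring
    _ ≤ _ := by
        have := mul_le_mul_of_nonneg_left h4 hK0
        exact mul_le_mul_of_nonneg_right (by linarith) h7

/-- Increments of the drift part. -/
lemma holderBound_of_driftFree [CompleteSpace E] (hf : Continuous f) {y : C(ℝ, E)}
    {ν W D a b : ℝ} (hD : ∀ u ∈ Icc a b, ‖drift r B f y u‖ ≤ D)
    (h : HolderBound ν W a b (driftFree r B f y)) {e L : ℝ} (he : 0 < e) (heν : e ≤ ν)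
    (hν : ν ≤ 1) (hW : 0 ≤ W) (hab : a ≤ b) (hba : b - a ≤ L) :
    HolderBound e (D * L ^ (1 - e) + W * L ^ (ν - e)) a b y := by
  have hD0 : 0 ≤ D := (norm_nonneg _).trans (hD a ⟨le_rfl, hab⟩)
  have h1 : HolderBound 1 D a b (fun t => ∫ u in (0 : ℝ)..t, drift r B f y u) := by
    intro s t hs hst ht
    have hdc := continuous_drift (B := B) hf y
    rw [intervalIntegral.integral_interval_sub_left (hdc.intervalIntegrable _ _)
      (hdc.intervalIntegrable _ _), Real.rpow_one, ← abs_of_nonneg (sub_nonneg.2 hst)]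
    refine intervalIntegral.norm_integral_le_of_norm_le_const fun u hu => ?_
    rw [uIoc_of_le hst] at hu
    exact hD u ⟨hs.trans hu.1.le, hu.2.trans ht⟩
  have h2 := (h1.of_exponent_le he (heν.trans hν) hD0 hba).add (h.of_exponent_le he heν hW hba)
  refine h2.congr fun t _ => ?_
  simp only [driftFree]; abel

end Increments

end YoungDelay

namespace YoungDelay

/-! ### The a priori bound in exponentially weighted norms -/

section Apriori

variable {E F : Type*} [NormedAddCommGroup E] [NormedSpace ℝ E] [NormedAddCommGroup F]
  [NormedSpace ℝ F] {r : ℝ} {B : E →L[ℝ] E} {f : C(Icc (-r) 0, E) → E}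
  {g : C(Icc (-r) 0, E) → F →L[ℝ] E} {Cf : ℝ≥0} {Cg : ℝ}

/-- Exponentially weighted bounds for `y` and, up to the factor `δ`, for its Hölder quotients on
the intervals of a grid of mesh `r`. -/
def WeightedBall (β r μ δ : ℝ) (n : ℕ) (Z : ℝ) (y : ℝ → E) : Prop :=
  (∀ t ∈ Icc (-r) (n * r), ‖y t‖ ≤ Z * Real.exp (-μ * t)) ∧ HolderBound β (Z / δ) (-r) 0 y ∧
    ∀ j < n, HolderBound β (Real.exp (-μ * (r * j)) * (Z / δ)) (j * r) ((j + 1) * r) y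

lemma natCast_succ_mul_le {r : ℝ} (hr : 0 ≤ r) {j n : ℕ} (h : j < n) :
    ((j : ℝ) + 1) * r ≤ n * r := by
  have : ((j : ℝ) + 1) ≤ n := by exact_mod_cast h
  gcongr

lemma exp_neg_mul_le {μ r t : ℝ} {j : ℕ} (hμ : 0 ≤ μ) (h : j * r ≤ t) :
    Real.exp (-μ * t) ≤ Real.exp (-μ * (r * j)) :=
  Real.exp_le_exp.2 (by nlinarith)

namespace WeightedBall

variable {β μ δ Z : ℝ} {n : ℕ}

/-- Segments at times in cell `j` look back into cell `j - 1`, or into the initial interval when `j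
= 0`. Expressing that bound with the weight of cell `j` costs a factor `exp (μ * r)`. -/
lemma holderBound_past {y : ℝ → E} (h : WeightedBall β r μ δ n Z y) (hr : 0 < r) (hμ : 0 < μ)
    (hδ : 0 < δ) (hβ : 0 ≤ β) (hZ : 0 ≤ Z) {j : ℕ} (hj : j < n) :
    HolderBound β (Real.exp (-μ * (r * j)) * ((1 + Real.exp (μ * r)) * (Z / δ))) (j * r - r)
      ((j + 1) * r) y := by
  have hZδ : 0 ≤ Z / δ := by positivity
  rcases j with _ | j
  · have h1 := h.2.2 0 hj
    have h2 := h.2.1.trans (by simpa using h1) hβ hZδ hZδ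
    refine h2.mono ?_ (by simp) (by simp)
    have := Real.one_le_exp (mul_pos hμ hr).le
    simp only [Nat.cast_zero, mul_zero, Real.exp_zero, one_mul, add_mul]
    nlinarith
  · have h1 := h.2.2 (j + 1) hj
    have h2 := h.2.2 j (by omega)
    have e1 : ((j + 1 : ℕ) : ℝ) * r - r = j * r := by push_cast; ring
    have e2 : ((j + 1 : ℕ) : ℝ) * r = (j + 1) * r := by push_cast; ring
    have e3 : Real.exp (-μ * (r * j)) = Real.exp (-μ * (r * (j + 1 : ℕ))) * Real.exp (μ * r) := by
      rw [← Real.exp_add]; push_cast; ring_nf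
    rw [e1]
    rw [e2] at h1
    refine (h2.trans h1 hβ (by positivity) (by positivity)).mono (le_of_eq ?_) le_rfl le_rfl
    rw [e3]; ring

lemma norm_segment_le {y : C(ℝ, E)} (h : WeightedBall β r μ δ n Z y) (hμ : 0 < μ)
    (hZ : 0 ≤ Z) {u : ℝ} (hu : u ∈ Icc 0 (n * r)) :
    ‖segment r y u‖ ≤ Real.exp (μ * r) * Z * Real.exp (-μ * u) := by
  refine YoungDelay.norm_segment_le (by positivity) fun s hs => ?_
  refine (h.1 s ⟨by linarith [hs.1, hu.1], hs.2.trans hu.2⟩).trans ?_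
  have : Real.exp (-μ * s) ≤ Real.exp (μ * r) * Real.exp (-μ * u) := by
    rw [← Real.exp_add]
    exact Real.exp_le_exp.2 (by nlinarith [hs.1])
  nlinarith

/-- A constant does not decay. The hypothesis on `X` says that `X` dominates the inverse weight, so
that the inhomogeneity `f 0` fits into the weighted bound. -/
lemma norm_f_le (hc : RegularCoeff r f g Cf Cg) {y : C(ℝ, E)}
    (h : WeightedBall β r μ δ n Z y) (hμ : 0 < μ) (hZ : 0 ≤ Z) {X u : ℝ}
    (hu : u ∈ Icc 0 (n * r)) (hX : 1 ≤ X * Real.exp (-μ * u)) :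
    ‖f (segment r y u)‖ ≤ (Cf * Real.exp (μ * r) * Z + ‖f 0‖ * X) * Real.exp (-μ * u) := by
  have h1 := hc.f_lip (segment r y u) 0
  rw [sub_zero] at h1
  have h2 := norm_le_norm_add_norm_sub' (f (segment r y u)) (f 0)
  have h3 := mul_le_mul_of_nonneg_left (h.norm_segment_le hμ hZ hu) Cf.coe_nonneg
  have h4 := mul_le_mul_of_nonneg_left hX (norm_nonneg (f 0))
  linarith

lemma norm_drift_le (hc : RegularCoeff r f g Cf Cg) {y : C(ℝ, E)}
    (h : WeightedBall β r μ δ n Z y) (hμ : 0 < μ) (hZ : 0 ≤ Z) {X u : ℝ}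
    (hu : u ∈ Icc 0 (n * r)) (hX : 1 ≤ X * Real.exp (-μ * u)) :
    ‖drift r B f y u‖
      ≤ ((‖B‖ + Cf * Real.exp (μ * r)) * Z + ‖f 0‖ * X) * Real.exp (-μ * u) := by
  have h1 := h.norm_f_le hc hμ hZ hu hX
  have h2 := h.1 u ⟨by linarith [hu.1, hc.r_pos], hu.2⟩
  have h3 := mul_le_mul_of_nonneg_left h2 (norm_nonneg B)
  have h4 := B.le_opNorm (y u)
  have h5 := norm_add_le (B (y u)) (f (segment r y u))
  rw [drift]
  linarith

/-- Convolving the decay rate `lam` with the slower rate `μ` preserves the rate `μ` at the cost of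
the factor `1 / (lam - μ)`. -/
lemma norm_integral_le [CompleteSpace E] (hc : RegularCoeff r f g Cf Cg) {CA lam : ℝ}
    (hCA : 0 ≤ CA) (hμl : μ < lam)
    (hB : ∀ t, 0 ≤ t → ‖linFlow B t‖ ≤ CA * Real.exp (-lam * t)) {y : C(ℝ, E)}
    (h : WeightedBall β r μ δ n Z y) (hμ : 0 < μ) (hZ : 0 ≤ Z) {X t : ℝ} (hX0 : 0 ≤ X)
    (ht : t ∈ Icc 0 (n * r)) (hX : ∀ u ∈ Icc 0 (n * r), 1 ≤ X * Real.exp (-μ * u)) :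
    ‖∫ u in (0 : ℝ)..t, linFlow B (t - u) (f (segment r y u))‖
      ≤ CA * (Cf * Real.exp (μ * r) * Z + ‖f 0‖ * X) / (lam - μ) * Real.exp (-μ * t) := by
  have hd : 0 < lam - μ := sub_pos.2 hμl
  set c := CA * (Cf * Real.exp (μ * r) * Z + ‖f 0‖ * X) / (lam - μ) with hcdef
  have hc0 : 0 ≤ c := by positivity
  have hi := intervalIntegral.norm_integral_le_of_norm_le (a := 0) (b := t) (μ := volume)
    (f := fun u => linFlow B (t - u) (f (segment r y u)))
    (g := fun u => (c * Real.exp (-lam * t)) * (Real.exp ((lam - μ) * u) * (lam - μ))) ht.1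
    (Eventually.of_forall fun u hu => ?_) (Continuous.intervalIntegrable (by fun_prop) _ _)
  · refine hi.trans ?_
    rw [intervalIntegral.integral_const_mul,
      intervalIntegral.integral_eq_sub_of_hasDerivAt (f := fun u => Real.exp ((lam - μ) * u))]
    · have e : Real.exp (-lam * t) * Real.exp ((lam - μ) * t) = Real.exp (-μ * t) := by
        rw [← Real.exp_add]; ring_nf
      have h0 : 0 ≤ c * Real.exp (-lam * t) := by positivity
      rw [mul_zero, Real.exp_zero, ← e]
      linarith
    · intro u _
      simpa using ((hasDerivAt_id u).const_mul (lam - μ)).exp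
    · exact Continuous.intervalIntegrable (by fun_prop) _ _
  · have hu' : u ∈ Icc 0 (n * r) := ⟨hu.1.le, hu.2.trans ht.2⟩
    have h1 := h.norm_f_le hc hμ hZ hu' (hX u hu')
    have h2 := hB (t - u) (sub_nonneg.2 hu.2)
    have e : Real.exp (-lam * (t - u)) * Real.exp (-μ * u)
        = Real.exp (-lam * t) * Real.exp ((lam - μ) * u) := by
      rw [← Real.exp_add, ← Real.exp_add]; ring_nf
    calc _ ≤ (CA * Real.exp (-lam * (t - u))) * ((Cf * Real.exp (μ * r) * Z + ‖f 0‖ * X)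
          * Real.exp (-μ * u)) := (ContinuousLinearMap.le_opNorm _ _).trans (by gcongr)
      _ = CA * (Cf * Real.exp (μ * r) * Z + ‖f 0‖ * X)
          * (Real.exp (-lam * (t - u)) * Real.exp (-μ * u)) := by ring
      _ = _ := by rw [e, hcdef]; field_simp

end WeightedBall

/-- At `μ = 0` the inequality reads `a < lam`, and continuity leaves room for a small positive rate.
This is where `CA * Cf < lam` turns into a contraction constant. -/
lemma exists_rate {a r lam : ℝ} (h : a < lam) (hlam : 0 < lam) :
    ∃ μ, 0 < μ ∧ μ < lam ∧ a * Real.exp (μ * r) / (lam - μ) < 1 := by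
  have hcont : Continuous fun μ : ℝ => a * Real.exp (μ * r) - (lam - μ) := by fun_prop
  have h0 := hcont.tendsto 0
  simp only [zero_mul, Real.exp_zero, mul_one, sub_zero] at h0
  have h1 := (h0.mono_left (nhdsWithin_le_nhds (s := Ioi 0))).eventually_lt_const (sub_neg.2 h)
  have h2 : ∀ᶠ μ : ℝ in 𝓝[>] 0, μ < lam := (eventually_lt_nhds hlam).filter_mono nhdsWithin_le_nhds
  obtain ⟨μ, ⟨h3, h4⟩, h5⟩ := ((h1.and h2).and self_mem_nhdsWithin).exists
  refine ⟨μ, h5, h4, ?_⟩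
  rw [div_lt_one (sub_pos.2 h4)]
  linarith

/-- Every solution satisfies some weighted bound. -/
lemma IsDavieSolution.exists_weightedBall {β₀ ν μ δ : ℝ} {x : ℝ → F} {y : C(ℝ, E)} {n : ℕ}
    (hr : 0 < r) (hδ : 0 < δ) (hδ1 : δ ≤ 1)
    (hy : IsDavieSolution r β₀ ν B f g x (n * r) y) (hμ : 0 < μ) :
    ∃ Z, 0 ≤ Z ∧ WeightedBall β₀ r μ δ n Z y := by
  obtain ⟨H, hH0, hH⟩ := hy.holder
  obtain ⟨M, hM⟩ := isCompact_Icc.exists_bound_of_continuousOn (s := Icc (-r) (n * r))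
    y.continuous.continuousOn
  set w := Real.exp (μ * (n * r)) with hw
  have hw1 : 1 ≤ w := Real.one_le_exp (by positivity)
  have hexp : ∀ t, t ≤ n * r → 1 ≤ w * Real.exp (-μ * t) := fun t ht => by
    rw [hw, ← Real.exp_add]
    exact Real.one_le_exp (by nlinarith)
  set Z := (|M| + H) * w with hZ
  have hHZ : H ≤ Z / δ := by
    rw [le_div_iff₀ hδ, hZ]
    have := abs_nonneg M
    have h1 : H * δ ≤ H * 1 := by gcongr
    nlinarith
  refine ⟨Z, by positivity, fun t ht => ?_, hH.mono hHZ le_rfl (by positivity), fun j hj => ?_⟩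
  · have h1 := (hM t ht).trans (le_abs_self M)
    have h2 := hexp t ht.2
    have h3 := abs_nonneg M
    rw [hZ, mul_assoc]
    nlinarith
  · refine hH.mono ?_ (by linarith [mul_nonneg (Nat.cast_nonneg (α := ℝ) j) hr.le])
      (natCast_succ_mul_le hr.le hj)
    have hjn : (j : ℝ) ≤ n := by exact_mod_cast hj.le
    have h2 := hexp (r * j) (by nlinarith)
    have h3 : H ≤ (|M| + H) / δ := by
      rw [le_div_iff₀ hδ]
      have := abs_nonneg M
      nlinarith
    calc H ≤ (|M| + H) / δ * 1 := by rwa [mul_one]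
      _ ≤ (|M| + H) / δ * (w * Real.exp (-μ * (r * j))) := by gcongr
      _ = _ := by rw [hZ]; ring

lemma exists_mem_grid {r t : ℝ} {n : ℕ} (hr : 0 < r) (hn : 0 < n) (ht : t ∈ Icc 0 (n * r)) :
    ∃ j < n, t ∈ Icc (j * r) ((j + 1) * r) := by
  rcases ht.2.lt_or_eq with hlt | heq
  · have h0 : 0 ≤ t / r := div_nonneg ht.1 hr.le
    refine ⟨⌊t / r⌋₊, (Nat.floor_lt h0).2 ((div_lt_iff₀ hr).2 hlt), ?_, ?_⟩
    · exact (le_div_iff₀ hr).1 (Nat.floor_le h0)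
    · exact ((div_lt_iff₀ hr).1 (Nat.lt_floor_add_one (t / r))).le
  · refine ⟨n - 1, by omega, ?_⟩
    rw [Nat.cast_sub hn, heq, Nat.cast_one, sub_add_cancel]
    exact ⟨by nlinarith, le_rfl⟩

/-- The supremum bound obtained from the variation of constants formula. -/
lemma WeightedBall.norm_le_of_residual [CompleteSpace E] (hc : RegularCoeff r f g Cf Cg)
    {CA lam β μ δ Z : ℝ} {n : ℕ} (hCA : 0 ≤ CA) (hμl : μ < lam)
    (hB : ∀ t, 0 ≤ t → ‖linFlow B t‖ ≤ CA * Real.exp (-lam * t)) {y : C(ℝ, E)}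
    (h : WeightedBall β r μ δ n Z y) (hμ : 0 < μ) (hZ : 0 ≤ Z) {X Ch W : ℝ} (hX0 : 0 ≤ X)
    (hX : ∀ u ∈ Icc 0 (n * r), 1 ≤ X * Real.exp (-μ * u)) (hy0 : ‖y 0‖ ≤ X) (hChW : 0 ≤ Ch * W)
    (hres : ∀ j < n, ∀ t ∈ Icc (j * r) ((j + 1) * r),
      ‖residual r B f y t‖ ≤ Ch * (Real.exp (-μ * (r * j)) * W)) {t : ℝ}
    (ht : t ∈ Icc 0 (n * r)) :
    ‖y t‖ ≤ (CA * X + CA * (Cf * Real.exp (μ * r) * Z + ‖f 0‖ * X) / (lam - μ)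
      + Ch * W * Real.exp (μ * r)) * Real.exp (-μ * t) := by
  have hr := hc.r_pos
  have h2 := h.norm_integral_le hc hCA hμl hB hμ hZ hX0 ht hX
  have h3 : ‖linFlow B t (y 0)‖ ≤ CA * X * Real.exp (-μ * t) := by
    have h4 := hB t ht.1
    have h6 : Real.exp (-lam * t) ≤ Real.exp (-μ * t) :=
      Real.exp_le_exp.2 (by nlinarith [ht.1])
    have h7 := h4.trans (mul_le_mul_of_nonneg_left h6 hCA)
    calc _ ≤ (CA * Real.exp (-μ * t)) * X := (ContinuousLinearMap.le_opNorm _ _).trans (by gcongr)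
      _ = _ := by ring
  have h5 : ‖residual r B f y t‖ ≤ Ch * W * Real.exp (μ * r) * Real.exp (-μ * t) := by
    rcases Nat.eq_zero_or_pos n with rfl | hn
    · have : t = 0 := le_antisymm (by simpa using ht.2) ht.1
      rw [this, residual_zero, norm_zero]
      positivity
    obtain ⟨j, hj, htj⟩ := exists_mem_grid hr hn ht
    have h4 : Real.exp (-μ * (r * j)) ≤ Real.exp (μ * r) * Real.exp (-μ * t) := by
      rw [← Real.exp_add]
      exact Real.exp_le_exp.2 (by nlinarith [htj.2])
    have h6 := mul_le_mul_of_nonneg_left h4 hChW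
    have h7 := hres j hj t htj
    linarith
  have e : y t = linFlow B t (y 0)
      + (∫ u in (0 : ℝ)..t, linFlow B (t - u) (f (segment r y u))) + residual r B f y t := by
    rw [residual]; abel
  have h7 := norm_add_le (linFlow B t (y 0)
    + ∫ u in (0 : ℝ)..t, linFlow B (t - u) (f (segment r y u))) (residual r B f y t)
  have h8 := norm_add_le (linFlow B t (y 0))
    (∫ u in (0 : ℝ)..t, linFlow B (t - u) (f (segment r y u)))
  rw [← e] at h7
  linarith

/-- The order of choice matters: `δ` first, to tame the drift in the Hölder quotients, and then `ε`,
small enough to survive the division by `δ`. -/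
lemma exists_small_constants {κ a b c : ℝ} (hκ : κ < 1) (ha : 0 ≤ a) (hb : 0 ≤ b) (hc : 0 ≤ c) :
    ∃ δ ε : ℝ, 0 < δ ∧ δ ≤ 1 ∧ 0 < ε ∧ δ * a ≤ 1 / 4 ∧ ε * b ≤ (1 - κ) / 4 ∧
      ε * (c / δ) ≤ (1 - κ) / 4 := by
  have hδ0 : 0 < 1 / (1 + 4 * a) := by positivity
  have h1 : 0 < 1 - κ := sub_pos.2 hκ
  have hd : 0 ≤ c / (1 / (1 + 4 * a)) := by positivity
  have hs : 0 < 1 + b + c / (1 / (1 + 4 * a)) := by positivity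
  refine ⟨1 / (1 + 4 * a), (1 - κ) / 4 / (1 + b + c / (1 / (1 + 4 * a))), hδ0, ?_, by positivity,
    ?_, ?_, ?_⟩
  · rw [div_le_one (by positivity)]; linarith
  · rw [one_div_mul_eq_div, div_le_iff₀ (by positivity)]; linarith
  · rw [div_mul_eq_mul_div, div_le_iff₀ hs]
    exact mul_le_mul_of_nonneg_left (by linarith) (by linarith)
  · rw [div_mul_eq_mul_div, div_le_iff₀ hs]
    exact mul_le_mul_of_nonneg_left (by linarith) (by linarith)

set_option maxHeartbeats 1000000 in
/-- Solutions decay at an exponential rate up to a polynomial of the Hölder bound of the driving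
path. -/
theorem exists_apriori_bound [CompleteSpace E] (hc : RegularCoeff r f g Cf Cg) {β₀ ν : ℝ}
    (he : YoungExponents β₀ ν) {K CA lam : ℝ} (hK : ∀ ξ, ‖g ξ‖ ≤ K) (hCA : 0 ≤ CA)
    (hlam : 0 < lam) (hB : ∀ t, 0 ≤ t → ‖linFlow B t‖ ≤ CA * Real.exp (-lam * t))
    (hsmall : CA * Cf < lam) :
    ∃ Γ μ p : ℝ, 0 < Γ ∧ 0 < μ ∧ 1 ≤ p ∧ ∀ (n : ℕ) (x : ℝ → F) (y : C(ℝ, E)) (q X : ℝ),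
      IsDavieSolution r β₀ ν B f g x (n * r) y → 0 ≤ q → HolderBound ν q 0 (n * r) x →
      HolderBall β₀ X (-r) 0 y → Real.exp (μ * (n * r)) * (1 + q) ^ p ≤ X →
      WeightedBall β₀ r μ 1 n (Γ * X) y ∧
      ∀ j < n, HolderBound ν (Real.exp (-μ * (r * j)) * (Γ * X)) (j * r) ((j + 1) * r) y := by
  have hr := hc.r_pos
  have hβ := he.pos
  have hν0 : 0 ≤ ν := he.pos.le.trans he.lt.le
  have hfc := hc.lip.continuous
  obtain ⟨μ, hμ, hμl, hκ₀⟩ := exists_rate (r := r) hsmall hlam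
  obtain ⟨p, hp1, hp⟩ := exists_driftFree_bound (B := B) hc he hK
  obtain ⟨Ch, hCh0, hCh⟩ := norm_residual_le hfc hμ hμl hCA hB hν0 hr
  have hd : 0 < lam - μ := sub_pos.2 hμl
  obtain ⟨κ₀, hκ₀def⟩ : ∃ κ₀, κ₀ = CA * Cf * Real.exp (μ * r) / (lam - μ) := ⟨_, rfl⟩
  obtain ⟨D₁, hD₁⟩ : ∃ D₁, D₁ = ‖B‖ + Cf * Real.exp (μ * r) := ⟨_, rfl⟩
  obtain ⟨E₁, hE₁⟩ : ∃ E₁, E₁ = 1 + Real.exp (μ * r) := ⟨_, rfl⟩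
  obtain ⟨R₁, hR₁⟩ : ∃ R₁, R₁ = r ^ (1 - β₀) := ⟨_, rfl⟩
  obtain ⟨R₂, hR₂⟩ : ∃ R₂, R₂ = r ^ (ν - β₀) := ⟨_, rfl⟩
  obtain ⟨R₃, hR₃⟩ : ∃ R₃, R₃ = r ^ (1 - ν) := ⟨_, rfl⟩
  obtain ⟨f₀, hf₀⟩ : ∃ f₀, f₀ = ‖f 0‖ := ⟨_, rfl⟩
  obtain ⟨C₁, hC₁⟩ : ∃ C₁, C₁ = Ch * Real.exp (μ * r) := ⟨_, rfl⟩
  have hκ₀0 : 0 ≤ κ₀ := by rw [hκ₀def]; positivity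
  have hD₁0 : 0 ≤ D₁ := by rw [hD₁]; positivity
  have hE₁0 : 0 ≤ E₁ := by rw [hE₁]; positivity
  have hR₁0 : 0 ≤ R₁ := hR₁ ▸ Real.rpow_nonneg hr.le _
  have hR₂0 : 0 ≤ R₂ := hR₂ ▸ Real.rpow_nonneg hr.le _
  have hR₃0 : 0 ≤ R₃ := hR₃ ▸ Real.rpow_nonneg hr.le _
  have hf₀0 : 0 ≤ f₀ := hf₀ ▸ norm_nonneg _
  have hC₁0 : 0 ≤ C₁ := by rw [hC₁]; positivity
  rw [← hκ₀def] at hκ₀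
  -- Hölder quotients are weighted by `δ` because the drift contributes to them with the factor `R₁
  -- * D₁`, which need not be small. The noise feeds these quotients back into the supremum with
  -- factor `ε / δ`.
  obtain ⟨δ, ε, hδ0, hδ1, hε0, hδD, hε1, hε2⟩ := exists_small_constants hκ₀
    (mul_nonneg hR₁0 hD₁0) (mul_nonneg hR₂0 hE₁0) (mul_nonneg hC₁0 hE₁0)
  obtain ⟨Cε, hCε0, hCε⟩ := hp ε hε0
  -- Half of the gap `1 - κ₀` is spent on the noise. Both `κ₀ + (1 - κ₀) / 4` (supremum) and `1 / 4
  -- + (1 - κ₀) / 4` (Hölder quotients) are at most `κ`.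
  obtain ⟨κ, hκ⟩ : ∃ κ, κ = (1 + κ₀) / 2 := ⟨_, rfl⟩
  have hκ1 : κ < 1 := by rw [hκ]; linarith
  have hκ0 : 0 ≤ κ := by rw [hκ]; linarith
  obtain ⟨f₁, hf₁⟩ : ∃ f₁, f₁ = CA * f₀ / (lam - μ) := ⟨_, rfl⟩
  have hf₁0 : 0 ≤ f₁ := by rw [hf₁]; positivity
  obtain ⟨c₁, hc₁⟩ : ∃ c₁, c₁ = 1 + CA + f₁ + C₁ * Cε := ⟨_, rfl⟩
  obtain ⟨c₂, hc₂⟩ : ∃ c₂, c₂ = R₁ * f₀ + R₂ * Cε := ⟨_, rfl⟩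
  have hc₁1 : 1 ≤ c₁ := by
    have : 0 ≤ C₁ * Cε := by positivity
    linarith
  have hc₂0 : 0 ≤ c₂ := by rw [hc₂]; positivity
  obtain ⟨Γ₀, hΓ₀⟩ : ∃ Γ₀, Γ₀ = (c₁ + c₂) / (1 - κ) := ⟨_, rfl⟩
  have hΓ₀0 : 0 < Γ₀ := hΓ₀ ▸ div_pos (by linarith) (by linarith)
  obtain ⟨Γ₁, hΓ₁⟩ : ∃ Γ₁, Γ₁ = R₃ * (D₁ * Γ₀ + f₀) + (ε * (E₁ * (Γ₀ / δ)) + Cε) := ⟨_, rfl⟩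
  have hΓ₁0 : 0 ≤ Γ₁ := by rw [hΓ₁]; positivity
  refine ⟨Γ₀ / δ + Γ₁, μ, p, by positivity, hμ, hp1, fun n x y q X hy hq hx hη hX => ?_⟩
  have hq1 : 1 ≤ (1 + q) ^ p := Real.one_le_rpow (by linarith) (by linarith)
  -- The lower bound on `X` contains the inverse of the smallest weight on `[0, n * r]`, so that
  -- noise terms and constants are dominated by the decaying bound `X * exp (-μ * t)`.
  have hqX : ∀ t, t ≤ n * r → (1 + q) ^ p ≤ X * Real.exp (-μ * t) := fun t ht => by
    have h1 : 1 ≤ Real.exp (μ * (n * r)) * Real.exp (-μ * t) := by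
      rw [← Real.exp_add]; exact Real.one_le_exp (by nlinarith)
    calc (1 + q) ^ p ≤ (1 + q) ^ p * (Real.exp (μ * (n * r)) * Real.exp (-μ * t)) :=
          le_mul_of_one_le_right (by linarith) h1
      _ = Real.exp (μ * (n * r)) * (1 + q) ^ p * Real.exp (-μ * t) := by ring
      _ ≤ _ := mul_le_mul_of_nonneg_right hX (Real.exp_pos _).le
  have h1X : ∀ t, t ≤ n * r → 1 ≤ X * Real.exp (-μ * t) := fun t ht => hq1.trans (hqX t ht)
  have hX0 : 0 ≤ X := hη.const_nonneg (by linarith)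
  have hdrift : ∀ Z, 0 ≤ Z → WeightedBall β₀ r μ δ n Z y → ∀ j < n,
      ∀ u ∈ Icc (j * r) ((j + 1) * r),
        ‖drift r B f y u‖ ≤ Real.exp (-μ * (r * j)) * (D₁ * Z + f₀ * X) := by
    intro Z hZ hW j hj u hu
    have hj0 : (0 : ℝ) ≤ j * r := by positivity
    have hu' : u ∈ Icc 0 (n * r) := ⟨hj0.trans hu.1, hu.2.trans (natCast_succ_mul_le hr.le hj)⟩
    refine (hW.norm_drift_le hc hμ hZ hu' (h1X u hu'.2)).trans ?_
    rw [mul_comm, hD₁, hf₀]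
    exact mul_le_mul_of_nonneg_right (exp_neg_mul_le hμ.le hu.1) (by positivity)
  have hinc : ∀ Z, 0 ≤ Z → WeightedBall β₀ r μ δ n Z y → ∀ j < n,
      HolderBound ν (Real.exp (-μ * (r * j)) * (ε * (E₁ * (Z / δ)) + Cε * X)) (j * r)
        ((j + 1) * r) (driftFree r B f y) := by
    intro Z hZ hW j hj
    have hjn := natCast_succ_mul_le hr.le hj
    have hpast := hW.holderBound_past hr hμ hδ0 hβ.le hZ hj
    rw [← hE₁] at hpast
    have h1 := hCε x y (n * r) (j * r) ((j + 1) * r) _ q hy (by positivity) hjn (by linarith)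
      (by positivity) hq hpast hx
    refine h1.mono ?_ le_rfl le_rfl
    have h2 : (1 + q) ^ p ≤ X * Real.exp (-μ * (r * j)) := hqX _ (by linarith)
    have h3 := mul_le_mul_of_nonneg_left h2 hCε0
    linarith
  -- A weighted bound with constant `Z` implies one with constant `(c₁ + c₂) * X + κ * Z`. Starting
  -- from any qualitative bound, the iteration reaches the fixed point.
  have hfinal : WeightedBall β₀ r μ δ n ((c₁ + c₂) * X / (1 - κ)) y := by
    refine of_affine_step (P := fun Z => WeightedBall β₀ r μ δ n Z y) hκ0 hκ1
      (mul_nonneg (by linarith) hX0)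
      (fun u Z hu h => ⟨fun t ht => ge_of_tendsto' (hu.mul_const _) fun k => (h k).1 t ht,
        holderBound_of_tendsto_const (hu.div_const δ) fun k => (h k).2.1,
        fun j hj => holderBound_of_tendsto_const ((hu.div_const δ).const_mul _)
          fun k => (h k).2.2 j hj⟩)
      (hy.exists_weightedBall hr hδ0 hδ1 hμ) fun Z hZ hW => ?_
    have hκZ : 0 ≤ κ * Z := mul_nonneg hκ0 hZ
    have hκ₀Z : 0 ≤ κ₀ * Z := mul_nonneg hκ₀0 hZ
    have hcX : X ≤ (c₁ + c₂) * X + κ * Z := by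
      have h2 : X ≤ (c₁ + c₂) * X := le_mul_of_one_le_left hX0 (by linarith)
      linarith
    have h10 : 0 ≤ (1 - κ₀) * Z := mul_nonneg (by linarith) hZ
    have h9 : 0 ≤ c₂ * X := mul_nonneg hc₂0 hX0
    obtain ⟨W, hWdef⟩ : ∃ W, W = ε * (E₁ * (Z / δ)) + Cε * X := ⟨_, rfl⟩
    have hincW := hinc Z hZ hW
    rw [← hWdef] at hincW
    have hW0 : 0 ≤ W := by rw [hWdef]; positivity
    have hchW : C₁ * W ≤ (1 - κ₀) / 4 * Z + C₁ * Cε * X := by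
      have h1 := mul_le_mul_of_nonneg_right hε2 hZ
      have h2 : C₁ * W = ε * (C₁ * E₁ / δ) * Z + C₁ * Cε * X := by rw [hWdef]; ring
      rw [h2]
      linarith
    refine ⟨fun t ht => ?_, ?_, fun j hj => ?_⟩
    · rcases le_total t 0 with ht0 | ht0
      · have h1 := hη.1 t ⟨ht.1, ht0⟩
        have h2 : 1 ≤ Real.exp (-μ * t) := Real.one_le_exp (by nlinarith)
        exact h1.trans (hcX.trans (le_mul_of_one_le_right (hX0.trans hcX) h2))
      have h1 := hW.norm_le_of_residual hc hCA hμl hB hμ hZ hX0 (fun u hu => h1X u hu.2)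
        (hη.1 0 ⟨by linarith, le_rfl⟩) (mul_nonneg hCh0 hW0) (hCh n y W hW0 hincW) ⟨ht0, ht.2⟩
      refine h1.trans (mul_le_mul_of_nonneg_right ?_ (Real.exp_pos _).le)
      have h6 : CA * (Cf * Real.exp (μ * r) * Z + f₀ * X) / (lam - μ)
          = κ₀ * Z + f₁ * X := by rw [hκ₀def, hf₁]; ring
      have h7 : Ch * W * Real.exp (μ * r) = C₁ * W := by rw [hC₁]; ring
      rw [← hf₀, h6, h7]
      rw [hc₁, hκ]
      linarith
    · exact hη.2.mono (hcX.trans (le_div_self (hX0.trans hcX) hδ0 hδ1)) le_rfl le_rfl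
    · have h1 := holderBound_of_driftFree (B := B) hfc (hdrift Z hZ hW j hj) (hincW j hj)
        hβ he.lt.le he.le_one (mul_nonneg (Real.exp_pos _).le hW0) (by linarith) (L := r)
        (by linarith)
      refine h1.mono ?_ le_rfl le_rfl
      rw [mul_assoc, mul_assoc, ← mul_add, ← hR₁, ← hR₂]
      refine mul_le_mul_of_nonneg_left ?_ (Real.exp_pos _).le
      rw [le_div_iff₀ hδ0]
      have h2 := mul_le_mul_of_nonneg_right hδD hZ
      have h3 := mul_le_mul_of_nonneg_right hε1 hZ
      have h4 : δ * (c₂ * X) ≤ c₂ * X := mul_le_of_le_one_left h9 hδ1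
      have h5 : 0 ≤ c₁ * X := mul_nonneg (by linarith) hX0
      have h6 : ((D₁ * Z + f₀ * X) * R₁ + W * R₂) * δ
          = δ * (R₁ * D₁) * Z + ε * (R₂ * E₁) * Z + δ * (c₂ * X) := by
        rw [hc₂, hWdef]; field_simp; ring
      rw [h6, hκ]
      linarith
  have hZ0 : 0 ≤ Γ₀ * X := mul_nonneg hΓ₀0.le hX0
  have eZ : (c₁ + c₂) * X / (1 - κ) = Γ₀ * X := by rw [hΓ₀]; ring
  rw [eZ] at hfinal
  have hΓ₁X : 0 ≤ Γ₁ * X := mul_nonneg hΓ₁0 hX0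
  have hle : Γ₀ * X / δ ≤ (Γ₀ / δ + Γ₁) * X := by
    have : Γ₀ * X / δ = Γ₀ / δ * X := by ring
    linarith
  have hle' : Γ₀ * X ≤ (Γ₀ / δ + Γ₁) * X := (le_div_self hZ0 hδ0 hδ1).trans hle
  refine ⟨⟨fun t ht => (hfinal.1 t ht).trans
    (mul_le_mul_of_nonneg_right hle' (Real.exp_pos _).le), ?_, fun j hj => ?_⟩, fun j hj => ?_⟩
  · exact hfinal.2.1.mono (by rwa [div_one]) le_rfl le_rfl
  · refine (hfinal.2.2 j hj).mono ?_ le_rfl le_rfl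
    rw [div_one]
    exact mul_le_mul_of_nonneg_left hle (Real.exp_pos _).le
  · have hW1 : 0 ≤ ε * (E₁ * (Γ₀ * X / δ)) + Cε * X := by positivity
    have h1 := holderBound_of_driftFree (B := B) hfc (hdrift _ hZ0 hfinal j hj)
      (hinc _ hZ0 hfinal j hj) (he.pos.trans he.lt) le_rfl he.le_one
      (mul_nonneg (Real.exp_pos _).le hW1) (by linarith) (L := r) (by linarith)
    refine h1.mono ?_ le_rfl le_rfl
    rw [sub_self, Real.rpow_zero, mul_one, mul_assoc, ← mul_add, ← hR₃]
    refine mul_le_mul_of_nonneg_left ?_ (Real.exp_pos _).le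
    have h2 : (D₁ * (Γ₀ * X) + f₀ * X) * R₃ + (ε * (E₁ * (Γ₀ * X / δ)) + Cε * X) = Γ₁ * X := by
      rw [hΓ₁]; ring
    have h3 : 0 ≤ Γ₀ / δ * X := by positivity
    rw [h2]
    linarith

end Apriori

end YoungDelay

namespace YoungDelay

/-! ### Uniqueness and existence for general drivers -/

section Existence

variable {E F : Type*} [NormedAddCommGroup E] [NormedSpace ℝ E] [NormedAddCommGroup F]
  [NormedSpace ℝ F] {r : ℝ} {B : E →L[ℝ] E} {f : C(Icc (-r) 0, E) → E}
  {g : C(Icc (-r) 0, E) → F →L[ℝ] E} {Cf : ℝ≥0} {Cg : ℝ}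

lemma IsDavieSolution.exists_holderBall {β₀ ν T : ℝ} {x : ℝ → F} {y : C(ℝ, E)}
    (hy : IsDavieSolution r β₀ ν B f g x T y) : ∃ M, 0 ≤ M ∧ HolderBall β₀ M (-r) T y := by
  obtain ⟨H, hH0, hH⟩ := hy.holder
  obtain ⟨M, hM⟩ := isCompact_Icc.exists_bound_of_continuousOn (s := Icc (-r) T)
    y.continuous.continuousOn
  refine ⟨|M| + H, by positivity, fun t ht => ?_, hH.mono (by linarith [abs_nonneg M]) le_rfl le_rfl⟩
  linarith [hM t ht, le_abs_self M]

/-- Solutions with the same initial segment coincide. -/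
theorem IsDavieSolution.eqOn (hc : RegularCoeff r f g Cf Cg) {β₀ ν : ℝ}
    (he : YoungExponents β₀ ν) {T : ℝ} (hT : 0 ≤ T) {x : ℝ → F} {y z : C(ℝ, E)}
    (hy : IsDavieSolution r β₀ ν B f g x T y) (hz : IsDavieSolution r β₀ ν B f g x T z)
    (hx : ∃ H, 0 ≤ H ∧ HolderBound ν H 0 T x) (h0 : segment r y 0 = segment r z 0) :
    EqOn y z (Icc (-r) T) := by
  obtain ⟨M₁, hM₁, h1⟩ := hy.exists_holderBall
  obtain ⟨M₂, hM₂, h2⟩ := hz.exists_holderBall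
  obtain ⟨H, hH0, hH⟩ := hx
  obtain ⟨C, -, hC⟩ := exists_stability_const hc he B hT
    (by positivity : 0 ≤ M₁ + M₂ + H)
  have hyz : ∀ t ∈ Icc (-r) 0, y t = z t := fun t ht => by
    have := DFunLike.congr_fun h0 ⟨t, ht⟩
    simpa using this
  have := hC x x y z 0 0 hy hz (h1.mono (by linarith) le_rfl le_rfl)
    (h2.mono (by linarith) le_rfl le_rfl) (hH.mono (by linarith) le_rfl le_rfl)
    (fun s t _ hst _ => by simp) le_rfl
    ⟨fun t ht => by simp [hyz t ht], fun s t hs hst ht => by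
      simp [hyz t ⟨hs.trans hst, ht⟩, hyz s ⟨hs, hst.trans ht⟩]⟩
  intro t ht
  have h3 := this.1 t ht
  rw [add_zero, mul_zero] at h3
  exact sub_eq_zero.1 (norm_le_zero_iff.1 h3)

/-- The standing assumptions: regular coefficients in the Young regime, a bounded diffusion
coefficient, and a linear part that dominates the nonlinearity `f`. -/
structure IsDissipative (r β₀ ν : ℝ) (B : E →L[ℝ] E) (f : C(Icc (-r) 0, E) → E)
    (g : C(Icc (-r) 0, E) → F →L[ℝ] E) (Cf : ℝ≥0) (Cg K CA lam : ℝ) : Prop where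
  reg : RegularCoeff r f g Cf Cg
  exps : YoungExponents β₀ ν
  g_le : ∀ ξ, ‖g ξ‖ ≤ K
  CA_nonneg : 0 ≤ CA
  lam_pos : 0 < lam
  decay : ∀ t, 0 ≤ t → ‖linFlow B t‖ ≤ CA * Real.exp (-lam * t)
  small : CA * Cf < lam

lemma WeightedBall.holderBall {β μ Z : ℝ} {n : ℕ} {y : ℝ → E} (hr : 0 < r) (hβ : 0 ≤ β)
    (hμ : 0 < μ) (hZ : 0 ≤ Z) (h : WeightedBall β r μ 1 n Z y) :
    HolderBall β ((Real.exp (μ * r) + (n + 1)) * Z) (-r) (n * r) y := by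
  have hH : ∀ k ≤ n, HolderBound β ((k + 1) * Z) (-r) (k * r) y := by
    intro k
    induction k with
    | zero =>
      intro _
      have := h.2.1
      rw [div_one] at this
      simpa using this
    | succ k ih =>
      intro hk
      have h1 := h.2.2 k (by omega)
      rw [div_one] at h1
      have h2 := (ih (by omega)).trans h1 hβ (by positivity) (by positivity)
      have h3 : Real.exp (-μ * (r * k)) ≤ 1 := Real.exp_le_one_iff.2 (by
        have : 0 ≤ μ * (r * k) := by positivity
        linarith)
      push_cast
      exact h2.mono (by nlinarith) le_rfl le_rfl
  have hn := hH n le_rfl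
  have he : 0 ≤ Real.exp (μ * r) * Z := by positivity
  have hn0 : 0 ≤ ((n : ℝ) + 1) * Z := by positivity
  refine ⟨fun t ht => (h.1 t ht).trans ?_, hn.mono (by linarith) le_rfl le_rfl⟩
  have h1 : Real.exp (-μ * t) ≤ Real.exp (μ * r) := Real.exp_le_exp.2 (by nlinarith [ht.1])
  have h2 := mul_le_mul_of_nonneg_left h1 hZ
  linarith

variable {β₀ ν : ℝ≥0} {K CA lam : ℝ}

/-- Uniform bounds for the solutions on compact time intervals. -/
lemma IsDissipative.exists_holderBall_bound [CompleteSpace E]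
    (h : IsDissipative r β₀ ν B f g Cf Cg K CA lam) (n : ℕ) (q X : ℝ) (hq : 0 ≤ q) :
    ∃ M, 0 ≤ M ∧ ∀ (x : ℝ → F) (y : C(ℝ, E)), IsDavieSolution r β₀ ν B f g x (n * r) y →
      HolderBound ν q 0 (n * r) x → HolderBall β₀ X (-r) 0 y → HolderBall β₀ M (-r) (n * r) y := by
  obtain ⟨Γ, μ, p, hΓ, hμ, -, hap⟩ := exists_apriori_bound h.reg h.exps h.g_le h.CA_nonneg
    h.lam_pos h.decay h.small
  have hr := h.reg.r_pos
  set X' := |X| + Real.exp (μ * (n * r)) * (1 + q) ^ p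
  have hX' : 0 ≤ X' := by positivity
  refine ⟨(Real.exp (μ * r) + (n + 1)) * (Γ * X'), by positivity, fun x y hy hx hη => ?_⟩
  have h1 : 0 ≤ Real.exp (μ * (n * r)) * (1 + q) ^ p := by positivity
  refine (hap n x y q X' hy hq hx (hη.mono ?_ le_rfl le_rfl) ?_).1.holderBall hr β₀.coe_nonneg hμ
    (by positivity)
  · linarith [le_abs_self X]
  · linarith [abs_nonneg X]

/-- Existence of solutions of the Young delay equation. -/
theorem IsDissipative.exists_solution [CompleteSpace E]
    (h : IsDissipative r β₀ ν B f g Cf Cg K CA lam) {x : ℝ → F}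
    (hx : ∀ a b : ℝ, MemC0 ν a b (fun t : Icc a b => x t)) {η : C(Icc (-r) 0, E)}
    (hη : MemHolder β₀ η) :
    ∃ y : C(ℝ, E), segment r y 0 = η ∧ ∀ T, IsDavieSolution r β₀ ν B f g x T y := by
  have hc := h.reg
  have hr := hc.r_pos
  have hfc := hc.lip.continuous
  have hCg := hc.Cg_nonneg
  have hs0 := sewingConst_pos h.exps.one_lt
  let ε : ℕ → ℝ := fun n => 1 / ((n : ℝ) + 1)
  have hε : ∀ n, 0 < ε n := fun n => by positivity
  have hε1 : ∀ n, ε n ≤ 1 := fun n => by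
    simp only [ε]; rw [div_le_one (by positivity)]; linarith [n.cast_nonneg (α := ℝ)]
  have hεmono : ∀ {N n : ℕ}, N ≤ n → ε n ≤ ε N := fun {N n} h => by simp only [ε]; gcongr
  have hεlim : Tendsto ε atTop (𝓝 0) := tendsto_one_div_add_atTop_nhds_zero_nat
  -- The `k`-th smooth driver is `ε k`-close to `x` on `[0, k * r]` only. On a fixed interval `[0, n
  -- * r]` just the indices `k ≥ n` are used.
  choose p hp hp1 hp2 using fun k : ℕ => (hx 0 (k * r)).exists_smooth (hε k)
  choose u hu0 hu using fun k : ℕ => exists_solution_smooth (ν := ν) hc h.exps B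
    ((hp k).of_le (by exact_mod_cast le_top)) hη (k * r) (by positivity)
  have hkn : ∀ {n k : ℕ}, n ≤ k → (n : ℝ) * r ≤ k * r := fun {n k} hnk => by gcongr
  obtain ⟨X, -, hX⟩ := (hu 0).exists_holderBall
  have huη : ∀ k, ∀ t ∈ Icc (-r) 0, u k t = u 0 t := fun k t ht => by
    have := DFunLike.congr_fun ((hu0 k).trans (hu0 0).symm) ⟨t, ht⟩
    simpa using this
  have huX : ∀ k, HolderBall β₀ X (-r) 0 (u k) := fun k => by
    have h1 := hX.mono le_rfl le_rfl (by simp : (0 : ℝ) ≤ (0 : ℕ) * r)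
    exact ⟨fun t ht => by rw [huη k t ht]; exact h1.1 t ht, h1.2.congr (huη k)⟩
  have hbound : ∀ n : ℕ, ∃ M, 0 ≤ M ∧ (∀ k, n ≤ k → HolderBall β₀ M (-r) (n * r) (u k)) ∧
      (∀ k, n ≤ k → HolderBound ν M 0 (n * r) (p k)) := fun n => by
    obtain ⟨q, hq0, hq⟩ := memHolder_iff_holderBound.1 (hx 0 (n * r)).1
    have hpq : ∀ k, n ≤ k → HolderBound ν (q + 1) 0 (n * r) (p k) := fun k hk =>
      (hq.of_smooth_approx ((hp2 k).mono le_rfl le_rfl (hkn hk))).mono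
        (by linarith [hε1 k]) le_rfl le_rfl
    obtain ⟨M, hM0, hM⟩ := h.exists_holderBall_bound n (q + 1) X (by positivity)
    refine ⟨M + (q + 1), by positivity, fun k hk => ?_, fun k hk => ?_⟩
    · exact (hM (p k) (u k) ((hu k).mono (hkn hk)) (hpq k hk) (huX k)).mono (by linarith) le_rfl
        le_rfl
    · exact (hpq k hk).mono (by linarith) le_rfl le_rfl
  choose M hM0 hMu hMp using hbound
  -- The a priori bound puts all approximate solutions into one ball, on which stability has a
  -- common constant; with equal initial segments only the distance of the drivers remains.
  have hdiff : ∀ n : ℕ, ∃ C, 0 ≤ C ∧ ∀ k l N, n ≤ N → N ≤ k → N ≤ l → ∀ t ∈ Icc (-r) (n * r),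
      ‖u k t - u l t‖ ≤ C * ε N := fun n => by
    obtain ⟨C, hC0, hC⟩ := exists_stability_const hc h.exps B (T := n * r) (by positivity) (hM0 n)
    refine ⟨C * 2, by positivity, fun k l N hn hk hl t ht => ?_⟩
    have hk' := hn.trans hk
    have hl' := hn.trans hl
    have hd : HolderBound ν (ε l + ε k) 0 (n * r) (fun t => p k t - p l t) := by
      have := ((hp2 l).mono le_rfl le_rfl (hkn hl')).sub ((hp2 k).mono le_rfl le_rfl (hkn hk'))
      simpa using this
    have h1 := hC (p k) (p l) (u k) (u l) 0 (ε l + ε k) ((hu k).mono (hkn hk'))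
      ((hu l).mono (hkn hl')) (hMu n k hk') (hMu n l hl') (hMp n k hk') hd
      (by linarith [hε k, hε l])
      ⟨fun t ht => by simp [huη k t ht, huη l t ht], fun s t hs hst ht => by
        simp [huη k t ⟨hs.trans hst, ht⟩, huη k s ⟨hs, hst.trans ht⟩, huη l t ⟨hs.trans hst, ht⟩,
          huη l s ⟨hs, hst.trans ht⟩]⟩
    refine (h1.1 t ht).trans ?_
    have h2 : 0 + (ε l + ε k) ≤ 2 * ε N := by linarith [hεmono hk, hεmono hl]
    rw [mul_assoc]
    gcongr
  choose C hC0 hC using hdiff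
  have hgrid : ∀ t : ℝ, ∃ n : ℕ, t < n * r := fun t => by
    obtain ⟨n, hn⟩ := exists_nat_gt (t / r)
    exact ⟨n, (div_lt_iff₀ hr).1 hn⟩
  have hlim : ∀ t : ℝ, ∃ ℓ, -r ≤ t → Tendsto (fun k => u k t) atTop (𝓝 ℓ) := fun t => by
    by_cases ht : -r ≤ t
    swap
    · exact ⟨0, fun h => (ht h).elim⟩
    obtain ⟨n, hn⟩ := hgrid t
    have hcau : CauchySeq fun k => u (k + n) t := by
      refine cauchySeq_of_le_tendsto_0 (fun N => C n * ε (N + n)) (fun k l N hk hl => ?_) ?_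
      · rw [dist_eq_norm]
        exact hC n _ _ (N + n) (by omega) (by omega) (by omega) t ⟨ht, hn.le⟩
      · simpa using ((tendsto_add_atTop_iff_nat n).2 hεlim).const_mul (C n)
    obtain ⟨ℓ, hℓ⟩ := cauchySeq_tendsto_of_complete hcau
    exact ⟨ℓ, fun _ => (tendsto_add_atTop_iff_nat n).1 hℓ⟩
  choose Y₀ hY₀ using hlim
  have hY₀H : ∀ n : ℕ, HolderBound β₀ (M n) (-r) (n * r) Y₀ := fun n =>
    holderBound_of_tendsto (l := atTop) (u := fun k => u k)
      (by filter_upwards [eventually_ge_atTop n] with k hk using (hMu n k hk).2)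
      fun t ht => hY₀ t ht.1
  have hYcont : Continuous fun t => Y₀ (max t (-r)) := by
    refine continuous_iff_continuousAt.2 fun t => ?_
    obtain ⟨n, hn⟩ := hgrid t
    have h1 : ContinuousOn (fun t => Y₀ (max t (-r))) (Iic (n * r)) :=
      ((hY₀H n).continuousOn h.exps.pos).comp (continuous_id.max continuous_const).continuousOn
        fun s hs => ⟨le_max_right _ _, max_le hs (by
          have : 0 ≤ (n : ℝ) * r := by positivity
          linarith)⟩
    exact h1.continuousAt (Iic_mem_nhds hn)
  let Y : C(ℝ, E) := ⟨fun t => Y₀ (max t (-r)), hYcont⟩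
  have hYeq : ∀ t, -r ≤ t → Y t = Y₀ t := fun t ht => by
    change Y₀ (max t (-r)) = _
    rw [max_eq_left ht]
  have hYlim : ∀ t, -r ≤ t → Tendsto (fun k => u k t) atTop (𝓝 (Y t)) := fun t ht => by
    rw [hYeq t ht]; exact hY₀ t ht
  have hYu : ∀ n k : ℕ, n ≤ k → ∀ t ∈ Icc (-r) (n * r), ‖u k t - Y t‖ ≤ C n * ε k :=
    fun n k hk t ht => by
      refine le_of_tendsto ((hYlim t ht.1).const_sub (u k t)).norm ?_
      filter_upwards [eventually_ge_atTop k] with l hl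
      exact hC n k l k hk le_rfl hl t ht
  refine ⟨Y, ?_, fun T => ?_⟩
  · ext s
    rw [segment_apply, zero_add]
    refine tendsto_nhds_unique (hYlim s s.2.1) ?_
    have e : ∀ k, u k s = η s := fun k => by rw [← hu0 k]; simp
    simp [e]
  obtain ⟨n, hn⟩ := hgrid T
  refine IsDavieSolution.mono (T := n * r) ⟨⟨M n, hM0 n, (hY₀H n).congr fun t ht => hYeq t ht.1⟩,
    sewingConst (β₀ + ν) * (Cg * M n * M n), ?_⟩ hn.le
  have hnr : 0 ≤ (n : ℝ) * r := by positivity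
  have hεn : Tendsto (fun k => C n * ε k) atTop (𝓝 0) := by simpa using hεlim.const_mul (C n)
  have hseg : ∀ s ∈ Icc 0 ((n : ℝ) * r), ∀ k, n ≤ k →
      ‖segment r (u k) s - segment r Y s‖ ≤ C n * ε k := fun s hs k hk => by
    rw [segment_sub]
    exact norm_segment_le (mul_nonneg (hC0 n) (hε k).le) fun v hv =>
      hYu n k hk v ⟨by linarith [hv.1, hs.1], hv.2.trans hs.2⟩
  -- The expansions of the approximate solutions are first improved to a constant independent of
  -- `k`; only then does the local description pass to the limit.
  refine sewnBy_of_tendsto (l := atTop) (Jn := fun k => driftFree r B f (u k))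
    (Ξn := fun k => youngGerm (fun s => g (segment r (u k) s)) (p k)) ?_ ?_ ?_
  · filter_upwards [eventually_ge_atTop n] with k hk
    obtain ⟨D, hD⟩ := ((hu k).mono (hkn hk)).expansion
    exact hD.improve h.exps.one_lt (mul_nonneg (mul_nonneg hCg (hM0 n)) (hM0 n))
      (youngGerm_defect β₀.coe_nonneg ν.coe_nonneg (mul_nonneg hCg (hM0 n))
        (hc.holderBound_g (hM0 n) (by simpa using (hMu n k hk).2)) (hMp n k hk))
  · intro t ht
    refine (hYlim t (by linarith [ht.1])).sub ?_
    rw [tendsto_iff_norm_sub_tendsto_zero]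
    have hb : ∀ᶠ k in atTop, ‖(∫ v in (0 : ℝ)..t, drift r B f (u k) v)
        - ∫ v in (0 : ℝ)..t, drift r B f Y v‖ ≤ (‖B‖ + Cf) * (C n * ε k) * t := by
      filter_upwards [eventually_ge_atTop n] with k hk
      rw [← intervalIntegral.integral_sub ((continuous_drift hfc _).intervalIntegrable _ _)
        ((continuous_drift hfc _).intervalIntegrable _ _)]
      have := intervalIntegral.norm_integral_le_of_norm_le_const (a := 0) (b := t)
        (f := fun v => drift r B f (u k) v - drift r B f Y v) (C := (‖B‖ + Cf) * (C n * ε k))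
        fun v hv => by
          rw [uIoc_of_le ht.1] at hv
          have hv' : v ∈ Icc 0 ((n : ℝ) * r) := ⟨hv.1.le, hv.2.trans ht.2⟩
          have e : drift r B f (u k) v - drift r B f Y v
              = B (u k v - Y v) + (f (segment r (u k) v) - f (segment r Y v)) := by
            simp only [drift, map_sub]; abel
          rw [e, add_mul]
          refine (norm_add_le _ _).trans (add_le_add ((B.le_opNorm _).trans ?_)
            ((hc.f_lip _ _).trans ?_))
          · exact mul_le_mul_of_nonneg_left (hYu n k hk v ⟨by linarith [hv'.1], hv'.2⟩)
              (norm_nonneg _)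
          · exact mul_le_mul_of_nonneg_left (hseg v hv' k hk) Cf.coe_nonneg
      rwa [sub_zero, abs_of_nonneg ht.1] at this
    refine squeeze_zero' (Eventually.of_forall fun _ => norm_nonneg _) hb ?_
    simpa using (hεn.const_mul (‖B‖ + Cf)).mul_const t
  · intro s hs t ht
    have hpt : ∀ v ∈ Icc 0 ((n : ℝ) * r), Tendsto (fun k => p k v) atTop (𝓝 (x v)) :=
      fun v hv => by
        rw [tendsto_iff_norm_sub_tendsto_zero]
        refine squeeze_zero' (Eventually.of_forall fun _ => norm_nonneg _) ?_ hεlim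
        filter_upwards [eventually_ge_atTop n] with k hk
        rw [norm_sub_rev]
        exact hp1 k v ⟨hv.1, hv.2.trans (hkn hk)⟩
    have hG : Tendsto (fun k => g (segment r (u k) s)) atTop (𝓝 (g (segment r Y s))) := by
      refine (hc.diff.continuous.tendsto _).comp ?_
      rw [tendsto_iff_norm_sub_tendsto_zero]
      refine squeeze_zero' (Eventually.of_forall fun _ => norm_nonneg _) ?_ hεn
      filter_upwards [eventually_ge_atTop n] with k hk using hseg s hs k hk
    exact ((isBoundedBilinearMap_apply (𝕜 := ℝ) (E := F) (F := E)).continuous.tendsto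
      (g (segment r Y s), x t - x s)).comp (hG.prodMk_nhds ((hpt t ht).sub (hpt s hs)))

end Existence

end YoungDelay

namespace YoungDelay

/-! ### Mollification, gluing and translation in `C^{0,α}` -/

section SmoothApprox

variable {E : Type*} [NormedAddCommGroup E]

/-- Freezing a path outside `[a,b]` preserves Hölder bounds. -/
lemma HolderBound.comp_clamp {α H a b : ℝ} {y : ℝ → E} (h : HolderBound α H a b y) (hα : 0 ≤ α)
    (hab : a ≤ b) (hH : 0 ≤ H) (c d : ℝ) :
    HolderBound α H c d (fun t => y (max a (min b t))) := fun s t _ hst _ => by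
  have h1 : max a (min b s) ≤ max a (min b t) := max_le_max le_rfl (min_le_min le_rfl hst)
  refine (h _ _ (le_max_left _ _) h1 (max_le hab (min_le_left _ _))).trans ?_
  have h2 : max a (min b t) - max a (min b s) ≤ t - s := by
    simp only [max_def, min_def]
    split_ifs <;> linarith
  exact mul_le_mul_of_nonneg_left (Real.rpow_le_rpow (sub_nonneg.2 h1) h2 hα) hH

lemma clamp_of_mem {a b t : ℝ} (ht : t ∈ Icc a b) : max a (min b t) = t := by
  rw [min_eq_right ht.2, max_eq_right ht.1]

variable [NormedSpace ℝ E]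

/-- Mollification: uniform approximation by smooth paths with the same Hölder constant. -/
lemma HolderBound.exists_contDiff [CompleteSpace E] {ν H a b : ℝ} {y : ℝ → E} (hν : 0 < ν)
    (hab : a ≤ b) (hH : 0 ≤ H) (h : HolderBound ν H a b y) {ρ : ℝ} (hρ : 0 < ρ) :
    ∃ p : ℝ → E, ContDiff ℝ (⊤ : ℕ∞) p ∧ (∀ t ∈ Icc a b, ‖y t - p t‖ ≤ ρ) ∧
      HolderBound ν H a b p := by
  set w : ℝ → E := fun t => y (max a (min b t)) with hw
  have hwH : ∀ c d, HolderBound ν H c d w := h.comp_clamp hν.le hab hH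
  have hwc : Continuous w := continuous_iff_continuousAt.2 fun t =>
    ((hwH (t - 1) (t + 1)).continuousOn hν).continuousAt
      (Icc_mem_nhds (by linarith) (by linarith))
  obtain ⟨δ, hδ, hδρ⟩ : ∃ δ : ℝ, 0 < δ ∧ H * δ ^ ν ≤ ρ := by
    refine ⟨(ρ / (H + 1)) ^ (1 / ν), by positivity, ?_⟩
    rw [← Real.rpow_mul (by positivity), one_div_mul_cancel hν.ne', Real.rpow_one, mul_div_assoc',
      div_le_iff₀ (by positivity)]
    nlinarith
  let φ : ContDiffBump (0 : ℝ) := ⟨δ / 2, δ, by positivity, by linarith⟩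
  let p : ℝ → E := convolution (φ.normed volume) w (ContinuousLinearMap.lsmul ℝ ℝ) volume
  have hint : ∀ u : ℝ → E, Continuous u → ∀ t,
      Integrable (fun v => φ.normed volume v • u (t - v)) volume := fun u hu t =>
    (φ.hasCompactSupport_normed.convolutionExists_left (ContinuousLinearMap.lsmul ℝ ℝ)
      φ.continuous_normed hu.locallyIntegrable) t
  have happ : ∀ (u : ℝ → E) (t : ℝ) (c : E) (ε : ℝ), Continuous u → 0 ≤ ε →
      (∀ v ∈ Metric.ball t δ, ‖u v - c‖ ≤ ε) →
      ‖(∫ v, φ.normed volume v • u (t - v)) - c‖ ≤ ε := fun u t c ε hu hε hb => by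
    have := dist_convolution_le (μ := volume) (g := u) (x₀ := t) (z₀ := c) hε
      φ.support_normed_eq.subset φ.nonneg_normed φ.integral_normed hu.aestronglyMeasurable
      (fun v hv => by rw [dist_eq_norm]; exact hb v hv)
    rwa [dist_eq_norm] at this
  refine ⟨p, ?_, fun t ht => ?_, fun s t hs hst ht => ?_⟩
  · exact φ.hasCompactSupport_normed.contDiff_convolution_left _ φ.contDiff_normed
      hwc.locallyIntegrable
  · rw [norm_sub_rev, ← clamp_of_mem ht]
    rw [show p (max a (min b t)) = p t by rw [clamp_of_mem ht]]
    refine happ w t _ ρ hwc hρ.le fun v hv => ?_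
    rw [Metric.mem_ball, Real.dist_eq] at hv
    refine ((hwH (t - δ) (t + δ)).abs_bound (s := t) (t := v) ⟨by linarith, by linarith⟩
      ⟨by linarith [(abs_lt.1 hv).1], by linarith [(abs_lt.1 hv).2]⟩).trans (le_trans ?_ hδρ)
    gcongr
  -- An increment of the mollified path is an average of increments of `w` over the same length, so
  -- the Hölder constant does not grow.
  · have e : p t - p s = ∫ v, φ.normed volume v • (fun z => w (z + (t - s)) - w z) (s - v) := by
      have e1 : ∀ v, s - v + (t - s) = t - v := fun v => by ring
      simp only [p, convolution_lsmul, smul_sub, e1]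
      exact (integral_sub (hint w hwc t) (hint w hwc s)).symm
    have hst0 : 0 ≤ t - s := sub_nonneg.2 hst
    rw [e, ← sub_zero (∫ v, _)]
    refine happ _ s 0 _ ((hwc.comp (continuous_id.add continuous_const)).sub hwc) (by positivity)
      fun v _ => ?_
    have := hwH v (v + (t - s)) v (v + (t - s)) le_rfl (by linarith) le_rfl
    simpa using this

lemma memC0_of_forall {α : ℝ≥0} {a b : ℝ} {y : ℝ → E}
    (hy : MemHolder α (fun t : Icc a b => y t))
    (h : ∀ ε : ℝ, 0 < ε → ∃ z : ℝ → E, MemC0 α a b (fun t : Icc a b => z t) ∧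
      HolderBall α ε a b (fun t => y t - z t)) : MemC0 α a b (fun t : Icc a b => y t) := by
  refine ⟨hy, fun ε hε => ?_⟩
  obtain ⟨z, hz, hyz⟩ := h (ε / 2) (by positivity)
  obtain ⟨p, hp, hp1, hp2⟩ := hz.exists_smooth (ε := ε / 2) (by positivity)
  refine ⟨p, hp, fun t => ?_, ?_⟩
  · have h1 := norm_add_le (y t - z t) (z t - p t)
    rw [sub_add_sub_cancel] at h1
    linarith [hyz.1 t t.2, hp1 t t.2]
  · have h1 := hyz.2.add hp2
    simp only [sub_add_sub_cancel, add_halves] at h1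
    exact (holderWith_iff_holderBound (y := fun t => y t - p t)).2 h1

/-- A bound that is small in sup-norm and bounded in a Hölder norm is small in weaker Hölder
norms. -/
lemma exists_small_of_interpolation {α ν H : ℝ} (hα : 0 < α) (hαν : α < ν) (hH : 0 ≤ H) {ε : ℝ}
    (hε : 0 < ε) : ∃ ρ, 0 < ρ ∧ ∀ (a b : ℝ) (D : ℝ → E), (∀ t ∈ Icc a b, ‖D t‖ ≤ ρ) →
      HolderBound ν H a b D → HolderBall α ε a b D := by
  have hν := hα.trans hαν
  have hγ1 : 0 < 1 - α / ν := by rw [sub_pos, div_lt_one hν]; exact hαν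
  have hlim : Tendsto (fun ρ : ℝ => (2 * ρ) ^ (1 - α / ν) * H ^ (α / ν)) (𝓝 0) (𝓝 0) := by
    have hc : Continuous fun ρ : ℝ => (2 * ρ) ^ (1 - α / ν) * H ^ (α / ν) :=
      ((continuous_const.mul continuous_id).rpow_const fun _ => Or.inr hγ1.le).mul continuous_const
    simpa [Real.zero_rpow hγ1.ne'] using hc.tendsto 0
  obtain ⟨δ, hδ, hδε⟩ := Metric.eventually_nhds_iff.1 (hlim.eventually (gt_mem_nhds hε))
  refine ⟨min (δ / 2) ε, by positivity, fun a b D hD hDH => ⟨fun t ht => (hD t ht).trans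
    (min_le_right _ _), ?_⟩⟩
  have h1 := hDH.interpolate (γ := α / ν) (by positivity) hH (by positivity) (by linarith) hD
  rw [div_mul_cancel₀ _ hν.ne'] at h1
  refine h1.mono (hδε ?_).le le_rfl le_rfl
  rw [Real.dist_eq, sub_zero, abs_of_pos (by positivity)]
  exact (min_le_left _ _).trans_lt (by linarith)

/-- Mollification converges uniformly with bounded `ν`-Hölder constants, and interpolation upgrades
this to convergence in the weaker Hölder norm. -/
lemma memC0_of_holderBound [CompleteSpace E] {α : ℝ≥0} {ν H a b : ℝ} {y : ℝ → E} (hα : 0 < α)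
    (hαν : α < ν) (hab : a ≤ b) (hH : 0 ≤ H) (h : HolderBound ν H a b y) :
    MemC0 α a b (fun t : Icc a b => y t) := by
  have hα' : (0 : ℝ) < α := hα
  refine ⟨memHolder_iff_holderBound.2 ⟨_, by
    have : 0 ≤ b - a := sub_nonneg.2 hab
    positivity, h.of_exponent_le hα' hαν.le hH le_rfl⟩, fun ε hε => ?_⟩
  obtain ⟨ρ, hρ, hsmall⟩ := exists_small_of_interpolation (E := E) hα' hαν
    (by positivity : 0 ≤ H + H) (ε := ε) hε
  obtain ⟨p, hp, hp1, hp2⟩ := h.exists_contDiff (hα'.trans hαν) hab hH hρ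
  have h1 := hsmall a b (fun t => y t - p t) hp1 (h.sub hp2)
  exact ⟨p, hp, fun t => h1.1 t t.2, (holderWith_iff_holderBound (y := fun t => y t - p t)).2 h1.2⟩

lemma exists_holderBound_one_of_contDiff {p : ℝ → E} (hp : ContDiff ℝ 1 p) (a b : ℝ) :
    ∃ L, 0 ≤ L ∧ HolderBound 1 L a b p := by
  obtain ⟨M, hM⟩ := isCompact_Icc.exists_bound_of_continuousOn (s := Icc a b)
    (hp.continuous_deriv le_rfl).continuousOn
  refine ⟨|M|, abs_nonneg M, fun s t hs hst ht => ?_⟩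
  have := (convex_Icc a b).norm_image_sub_le_of_norm_deriv_le (f := p) (C := |M|)
    (fun u _ => (hp.differentiable one_ne_zero).differentiableAt)
    (fun u hu => (hM u hu).trans (le_abs_self M)) ⟨hs, hst.trans ht⟩ ⟨hs.trans hst, ht⟩
  rwa [Real.norm_of_nonneg (sub_nonneg.2 hst), ← Real.rpow_one (t - s)] at this

lemma memC0_of_contDiff {α : ℝ≥0} (hα : α ≤ 1) {p : ℝ → E} (hp : ContDiff ℝ (⊤ : ℕ∞) p) (a b : ℝ)
    (hα0 : 0 < α) : MemC0 α a b (fun t : Icc a b => p t) := by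
  refine ⟨?_, fun ε _ => ⟨p, hp, fun t => by simp, by
    simp only [sub_self]; exact HolderWith.const⟩⟩
  obtain ⟨L, hL, h⟩ := exists_holderBound_one_of_contDiff (hp.of_le (by exact_mod_cast le_top)) a b
  rcases le_total a b with hab | hba
  · have : 0 ≤ b - a := sub_nonneg.2 hab
    exact memHolder_iff_holderBound.2 ⟨_, by positivity,
      h.of_exponent_le (β := α) hα0 hα hL le_rfl⟩
  · refine memHolder_iff_holderBound.2 ⟨0, le_rfl, fun s t hs hst ht => ?_⟩
    obtain rfl : s = t := by linarith
    simp [hα0.ne']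

/-- Prolonging a `C^{0,α}` path by a more regular one. -/
lemma MemC0.trans_holderBound [CompleteSpace E] {α : ℝ≥0} {ν H a b c : ℝ} {y : ℝ → E} (hα : 0 < α)
    (hαν : α < ν) (hν : ν ≤ 1) (hab : a ≤ b) (hbc : b ≤ c) (hH : 0 ≤ H)
    (h : MemC0 α a b (fun t : Icc a b => y t)) (h' : HolderBound ν H b c y) :
    MemC0 α a c (fun t : Icc a c => y t) := by
  have hα' : (0 : ℝ) < α := hα
  have hν0 := hα'.trans hαν
  have hbc0 : 0 ≤ c - b := sub_nonneg.2 hbc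
  have hac0 : 0 ≤ c - a := by linarith
  obtain ⟨H₁, hH₁, h1⟩ := memHolder_iff_holderBound.1 h.1
  refine memC0_of_forall (memHolder_iff_holderBound.2 ⟨_, by positivity,
    h1.trans (h'.of_exponent_le hα' hαν.le hH le_rfl) hα'.le hH₁ (by positivity)⟩) fun ε hε => ?_
  obtain ⟨p, hp, hp1, hp2⟩ := h.exists_smooth hε
  obtain ⟨L, hL, hpL⟩ := exists_holderBound_one_of_contDiff (hp.of_le (by exact_mod_cast le_top)) a b
  -- Up to the constant `y b`, this glues the smooth approximation on `[a, b]` to `y` itself on `[b,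
  -- c]`, continuously. The error is `y - p` on the left and the constant `y b - p b` on the right,
  -- and `z` is `ν`-Hölder throughout.
  let z : ℝ → E := fun t => p (max a (min b t)) + y (max b (min c t))
  have hzH : HolderBound ν (L * (c - a) ^ (1 - ν) + H) a c z :=
    ((hpL.comp_clamp zero_le_one hab hL a c).of_exponent_le hν0 hν hL le_rfl).add
      (h'.comp_clamp hν0.le hbc hH a c)
  have hzH' : HolderBound ν (L * (c - a) ^ (1 - ν) + H) a c (fun t => z t - y b) :=
    fun s t hs hst ht => by
      rw [sub_sub_sub_cancel_right]
      exact hzH s t hs hst ht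
  have e1 : ∀ t ∈ Icc a b, y t - (z t - y b) = y t - p t := fun t ht => by
    simp only [z]
    rw [clamp_of_mem ht, min_eq_right (ht.2.trans hbc), max_eq_left ht.2]
    abel
  have e2 : ∀ t ∈ Icc b c, y t - (z t - y b) = y b - p b := fun t ht => by
    simp only [z]
    rw [clamp_of_mem ht, min_eq_left ht.1, max_eq_right hab]
    abel
  refine ⟨fun t => z t - y b, memC0_of_holderBound hα hαν (hab.trans hbc)
    (by positivity : 0 ≤ L * (c - a) ^ (1 - ν) + H) hzH', fun t ht => ?_, ?_⟩
  · rcases le_total t b with htb | hbt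
    · refine (congrArg norm (e1 t ⟨ht.1, htb⟩)).trans_le ?_
      exact hp1 t ⟨ht.1, htb⟩
    · refine (congrArg norm (e2 t ⟨hbt, ht.2⟩)).trans_le ?_
      exact hp1 b ⟨hab, le_rfl⟩
  · have h3 : HolderBound α 0 b c (fun t => y t - (z t - y b)) := fun s t hs hst ht => by
      simp only [e2 t ⟨hs.trans hst, ht⟩, e2 s ⟨hs, hst.trans ht⟩]
      simp
    have := (hp2.congr e1).trans h3 hα'.le hε.le le_rfl
    rwa [add_zero] at this

/-- Translations act continuously on `C^{0,α}`. -/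
lemma MemC0.exists_translation {α : ℝ≥0} (hα0 : 0 < α) (hα : α ≤ 1) {a b : ℝ} {y : ℝ → E}
    (h : MemC0 α a b (fun t : Icc a b => y t)) {ε : ℝ} (hε : 0 < ε) :
    ∃ κ, 0 < κ ∧ ∀ s t c d, |t - s| ≤ κ → a ≤ s + c → s + d ≤ b → a ≤ t + c → t + d ≤ b →
      HolderBall α ε c d (fun u => y (t + u) - y (s + u)) := by
  obtain ⟨p, hp, hp1, hp2⟩ := h.exists_smooth (ε := ε / 4) (by positivity)
  have hp' : ContDiff ℝ 1 (deriv p) :=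
    ((contDiff_succ_iff_deriv (n := 1)).1 (hp.of_le (by norm_cast))).2.2
  have hp0 : ContDiff ℝ 1 p := hp.of_le (by exact_mod_cast le_top)
  obtain ⟨L₁, hL₁, h1⟩ := exists_holderBound_one_of_contDiff hp0 a b
  obtain ⟨L₂, hL₂, h2⟩ := exists_holderBound_one_of_contDiff hp' a b
  set L := L₁ + L₂ * |b - a| ^ (1 - (α : ℝ)) with hL
  have hL0 : 0 ≤ L := by positivity
  have hα' : (0 : ℝ) < α := hα0
  refine ⟨ε / (2 * (L + 1)), by positivity, fun s t c d hst hsc hsd htc htd => ?_⟩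
  have hLκ : L * |t - s| ≤ ε / 2 := by
    calc L * |t - s| ≤ (L + 1) * (ε / (2 * (L + 1))) := by gcongr; linarith
      _ = ε / 2 := by field_simp
  have hd1 : ∀ u ∈ Icc c d, ‖p (t + u) - p (s + u)‖ ≤ L₁ * |t - s| := fun u hu => by
    have := h1.abs_bound (s := s + u) (t := t + u) ⟨by linarith [hu.1], by linarith [hu.2]⟩
      ⟨by linarith [hu.1], by linarith [hu.2]⟩
    rwa [Real.rpow_one, add_sub_add_right_eq_sub] at this
  -- For the smooth approximation the difference of translates has derivative at most `L₂ * |t -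
  -- s|`, so it is small even in the Lipschitz sense.
  have hd2 : HolderBound α (L * |t - s|) c d (fun u => p (t + u) - p (s + u)) := by
    have h3 : HolderBound 1 (L₂ * |t - s|) c d (fun u => p (t + u) - p (s + u)) :=
      fun u v hu huv hv => by
      have hder : ∀ w c : ℝ, HasDerivAt (fun w => p (c + w)) (deriv p (c + w)) w := fun w c => by
        simpa using ((hp0.differentiable one_ne_zero) (c + w)).hasDerivAt.comp_const_add c w
      have := (convex_Icc c d).norm_image_sub_le_of_norm_hasDerivWithin_le
        (f := fun u => p (t + u) - p (s + u)) (C := L₂ * |t - s|)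
        (fun w _ => ((hder w t).sub (hder w s)).hasDerivWithinAt)
        (fun w hw => by
          have := h2.abs_bound (s := s + w) (t := t + w)
            ⟨by linarith [hw.1], by linarith [hw.2]⟩ ⟨by linarith [hw.1], by linarith [hw.2]⟩
          rwa [Real.rpow_one, add_sub_add_right_eq_sub] at this)
        ⟨hu, huv.trans hv⟩ ⟨hu.trans huv, hv⟩
      rwa [Real.norm_of_nonneg (sub_nonneg.2 huv), ← Real.rpow_one (v - u)] at this
    refine (h3.of_exponent_le hα' hα (by positivity) (L := |b - a|) ?_).mono ?_ le_rfl le_rfl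
    · linarith [le_abs_self (b - a)]
    · rw [hL, mul_right_comm, add_mul]
      have : 0 ≤ L₁ * |t - s| := by positivity
      linarith
  have hd1' : ∀ u ∈ Icc c d, ‖p (t + u) - p (s + u)‖ ≤ ε / 2 := fun u hu => by
    refine (hd1 u hu).trans (le_trans ?_ hLκ)
    gcongr
    rw [hL]
    have : 0 ≤ L₂ * |b - a| ^ (1 - (α : ℝ)) := by positivity
    linarith
  have e : ∀ u, y (t + u) - y (s + u) = (p (t + u) - p (s + u))
      + ((y (t + u) - p (t + u)) - (y (s + u) - p (s + u))) := fun u => by abel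
  refine ⟨fun u hu => ?_, ?_⟩
  · refine (congrArg norm (e u)).trans_le ((norm_add_le _ _).trans ?_)
    have h3 := norm_sub_le (y (t + u) - p (t + u)) (y (s + u) - p (s + u))
    linarith [hd1' u hu, hp1 (t + u) ⟨by linarith [hu.1], by linarith [hu.2]⟩,
      hp1 (s + u) ⟨by linarith [hu.1], by linarith [hu.2]⟩]
  · have h3 := (hp2.comp_add t).mono le_rfl (by linarith : a - t ≤ c) (by linarith : d ≤ b - t)
    have h4 := (hp2.comp_add s).mono le_rfl (by linarith : a - s ≤ c) (by linarith : d ≤ b - s)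
    exact ((hd2.add (h3.sub h4)).mono (by linarith) le_rfl le_rfl).congr fun u _ => e u

end SmoothApprox

end YoungDelay

namespace YoungDelay

/-! ### The spaces `C^{0,α}`: compact sets and separability -/

section HolderSpace

variable {E : Type*} [NormedAddCommGroup E] [NormedSpace ℝ E] {α : ℝ≥0} {a b : ℝ}

namespace C0

/-- The element of `C^{0,α}([a,b])` given by the restriction of a path. -/
def mk (y : C(ℝ, E)) (h : MemC0 α a b (fun t : Icc a b => y t)) : C0 E α a b :=
  ⟨⟨fun t => y t, y.continuous.comp continuous_subtype_val⟩, h⟩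

lemma ext {η ζ : C0 E α a b} (h : ∀ t, η.toCM t = ζ.toCM t) : η = ζ :=
  Subtype.ext (ContinuousMap.ext h)

lemma toCM_sub (η ζ : C0 E α a b) : (η - ζ).toCM = η.toCM - ζ.toCM := rfl

lemma norm_toCM_le (η : C0 E α a b) : ‖η.toCM‖ ≤ ‖η‖ := by
  rw [norm_def]; exact le_add_of_nonneg_right NNReal.zero_le_coe

lemma norm_le_of_holderBound {η : C0 E α a b} {y : ℝ → E} {M H : ℝ}
    (hy : ∀ t : Icc a b, η.toCM t = y t) (hM0 : 0 ≤ M) (hH0 : 0 ≤ H)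
    (hM : ∀ t ∈ Icc a b, ‖y t‖ ≤ M) (hH : HolderBound α H a b y) : ‖η‖ ≤ M + H := by
  rw [norm_def]
  refine add_le_add ((ContinuousMap.norm_le _ hM0).2 fun t => by rw [hy]; exact hM t t.2) ?_
  have h1 : HolderWith ⟨H, hH0⟩ α η.toCM := by
    rw [show (η.toCM : Icc a b → E) = fun t : Icc a b => y t from funext hy]
    exact holderWith_iff_holderBound.2 hH
  exact_mod_cast h1.nnholderNorm_le

lemma norm_le_of_holderBall {η : C0 E α a b} {y : ℝ → E} {M : ℝ}
    (hy : ∀ t : Icc a b, η.toCM t = y t) (hM0 : 0 ≤ M) (h : HolderBall α M a b y) :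
    ‖η‖ ≤ 2 * M := by
  rw [two_mul]; exact norm_le_of_holderBound hy hM0 hM0 h.1 h.2

lemma holderBall {η : C0 E α a b} {y : ℝ → E} (hy : ∀ t : Icc a b, η.toCM t = y t) :
    HolderBall α ‖η‖ a b y := by
  refine ⟨fun t ht => ?_, ?_⟩
  · rw [← hy ⟨t, ht⟩]
    exact (η.toCM.norm_coe_le_norm _).trans η.norm_toCM_le
  · have h1 := η.memC0.1.holderWith
    rw [show (η.toCM : Icc a b → E) = fun t : Icc a b => y t from funext hy] at h1
    refine (holderWith_iff_holderBound.1 h1).mono ?_ le_rfl le_rfl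
    rw [norm_def, ← show (η.toCM : Icc a b → E) = fun t : Icc a b => y t from funext hy]
    exact le_add_of_nonneg_left (norm_nonneg _)

lemma continuous_toCM : Continuous (toCM : C0 E α a b → C(Icc a b, E)) :=
  (LipschitzWith.of_dist_le_mul (K := 1) fun η ζ => by
    rw [dist_eq_norm, dist_eq_norm, ← toCM_sub, NNReal.coe_one, one_mul]
    exact norm_toCM_le _).continuous

/-- The path that is frozen outside `[a,b]`. -/
def extend (hab : a ≤ b) (η : C0 E α a b) : C(ℝ, E) := η.toCM.IccExtend hab

lemma extend_apply (hab : a ≤ b) (η : C0 E α a b) (t : Icc a b) : η.extend hab t = η.toCM t :=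
  IccExtend_val hab _ t

/-- The paths with a given Hölder bound of higher order. -/
def holderSet (E : Type*) [NormedAddCommGroup E] [NormedSpace ℝ E] (α : ℝ≥0) (a b : ℝ) (ν : ℝ≥0)
    (R : ℝ≥0) : Set (C0 E α a b) :=
  {η | ‖η.toCM‖ ≤ R ∧ HolderWith R ν η.toCM}

/-- Arzelà–Ascoli gives compactness in the supremum norm. On paths with a common `ν`-Hölder bound,
interpolation makes the inclusion into `C^{0,α}` continuous for the supremum norm, so the set is a
continuous image of a compact one. -/
lemma isCompact_holderSet [ProperSpace E] [CompleteSpace E] {ν : ℝ≥0} (hα : 0 < α) (hαν : α < ν)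
    (hab : a ≤ b) (R : ℝ≥0) : IsCompact (holderSet E α a b ν R) := by
  have hν : 0 < ν := hα.trans hαν
  let A : Set C(Icc a b, E) := {v | ‖v‖ ≤ R ∧ HolderWith R ν v}
  have hA : IsCompact A := by
    refine ArzelaAscoli.isCompact_of_equicontinuous A ?_ ?_
    · have e : ContinuousMap.toFun '' A
          = (Set.univ.pi fun _ : Icc a b => Metric.closedBall (0 : E) R) ∩
            {v | ∀ s t, edist (v s) (v t) ≤ R * edist s t ^ (ν : ℝ)} := by
        ext v
        constructor
        · rintro ⟨u, hu, rfl⟩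
          exact ⟨fun t _ => mem_closedBall_zero_iff.2 ((u.norm_coe_le_norm t).trans hu.1),
            fun s t => hu.2 s t⟩
        · rintro ⟨h1, h2⟩
          have h3 : HolderWith R ν v := h2
          exact ⟨⟨v, h3.continuous hν⟩, ⟨(ContinuousMap.norm_le _ R.2).2 fun t =>
            mem_closedBall_zero_iff.1 (h1 t trivial), h3⟩, rfl⟩
      rw [e]
      refine (isCompact_univ_pi fun _ => isCompact_closedBall _ _).inter_right ?_
      simp only [Set.ofPred_forall]
      exact isClosed_iInter fun s => isClosed_iInter fun t => isClosed_le
        ((continuous_apply s).edist (continuous_apply t)) continuous_const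
    · refine UniformEquicontinuous.equicontinuous ?_
      rw [Metric.uniformEquicontinuous_iff]
      intro ε hε
      have hlim : Tendsto (fun δ : ℝ => (R : ℝ) * δ ^ (ν : ℝ)) (𝓝 0) (𝓝 0) := by
        have hc : Continuous fun δ : ℝ => (R : ℝ) * δ ^ (ν : ℝ) :=
          continuous_const.mul (continuous_id.rpow_const fun _ => Or.inr ν.2)
        simpa [Real.zero_rpow (NNReal.coe_pos.2 hν).ne'] using hc.tendsto 0
      obtain ⟨δ, hδ, h⟩ := Metric.eventually_nhds_iff.1 (hlim.eventually (gt_mem_nhds hε))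
      refine ⟨δ, hδ, fun s t hst v => (v.2.2.dist_le s t).trans_lt (h ?_)⟩
      rwa [Real.dist_eq, sub_zero, abs_of_nonneg dist_nonneg]
  have hext : ∀ v : C(Icc a b, E), HolderWith R ν v →
      HolderBound ν R a b (v.IccExtend hab) := fun v hv => by
    refine holderWith_iff_holderBound.1 ?_
    rwa [show (fun t : Icc a b => v.IccExtend hab t) = v from funext fun t => IccExtend_val hab _ t]
  let Φ : A → C0 E α a b := fun v => ⟨v.1, by
    have := memC0_of_holderBound hα (NNReal.coe_lt_coe.2 hαν) hab R.2 (hext v.1 v.2.2)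
    rwa [show (fun t : Icc a b => v.1.IccExtend hab t) = v.1 from
      funext fun t => IccExtend_val hab _ t] at this⟩
  have hΦ : Continuous Φ := by
    rw [Metric.continuous_iff]
    intro v ε hε
    obtain ⟨ρ, hρ, hs⟩ := exists_small_of_interpolation (E := E) (α := α) (ν := ν) (H := R + R) hα
      hαν (by positivity) (ε := ε / 3) (by positivity)
    refine ⟨ρ, hρ, fun u hu => ?_⟩
    have h1 := hs a b (fun t => u.1.IccExtend hab t - v.1.IccExtend hab t) (fun t ht => ?_)
      ((hext u.1 u.2.2).sub (hext v.1 v.2.2))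
    · rw [dist_eq_norm]
      have := norm_le_of_holderBall (η := Φ u - Φ v) (fun t => ?_) (by positivity) h1
      · linarith
      · rw [toCM_sub]
        change u.1 t - v.1 t = IccExtend hab u.1 t - IccExtend hab v.1 t
        rw [IccExtend_val, IccExtend_val]
    · change ‖IccExtend hab u.1 t - IccExtend hab v.1 t‖ ≤ ρ
      rw [IccExtend_of_mem hab _ ht, IccExtend_of_mem hab _ ht, ← dist_eq_norm]
      exact (ContinuousMap.dist_apply_le_dist _).trans hu.le
  have e : holderSet E α a b ν R = range Φ := by
    ext η
    constructor
    · intro h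
      exact ⟨⟨η.toCM, h⟩, rfl⟩
    · rintro ⟨v, rfl⟩
      exact v.2
  rw [e]
  have := isCompact_iff_compactSpace.1 hA
  exact isCompact_range hΦ

lemma exists_contDiff (hab : a ≤ b) (hα0 : 0 < α) (hα : α ≤ 1) (η : C0 E α a b) {ε : ℝ}
    (hε : 0 < ε) : ∃ (p : C(ℝ, E)) (hp : ContDiff ℝ (⊤ : ℕ∞) p),
      ‖η - mk p (memC0_of_contDiff hα hp a b hα0)‖ ≤ ε := by
  have h := η.memC0
  rw [← show (fun t : Icc a b => η.extend hab t) = η.toCM from funext fun t =>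
    η.extend_apply hab t] at h
  obtain ⟨p, hp, h1, h2⟩ := h.exists_smooth (ε := ε / 2) (by positivity)
  refine ⟨⟨p, hp.continuous⟩, hp, ?_⟩
  refine (norm_le_of_holderBall (y := fun t => η.extend hab t - p t) (M := ε / 2) (fun t => ?_)
    (by positivity) ⟨h1, h2⟩).trans (by linarith)
  rw [extend_apply]
  rfl

/-- Smooth paths are Lipschitz, hence lie in a countable union of compact Lipschitz balls, and they
are dense by the definition of `C^{0,α}`. -/
lemma separableSpace [ProperSpace E] [CompleteSpace E] (hα0 : 0 < α) (hα : α < 1) (hab : a ≤ b) :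
    TopologicalSpace.SeparableSpace (C0 E α a b) := by
  rw [← TopologicalSpace.isSeparable_univ_iff]
  have hs : TopologicalSpace.IsSeparable (⋃ n : ℕ, holderSet E α a b 1 n) :=
    TopologicalSpace.IsSeparable.iUnion fun n => (isCompact_holderSet hα0 hα hab n).isSeparable
  refine hs.closure.mono fun η _ => Metric.mem_closure_iff.2 fun ε hε => ?_
  obtain ⟨p, hp, h⟩ := η.exists_contDiff hab hα0 hα.le (half_pos hε)
  refine ⟨_, ?_, (dist_eq_norm _ _).trans_lt (h.trans_lt (half_lt_self hε))⟩
  obtain ⟨L, hL, hpL⟩ := exists_holderBound_one_of_contDiff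
    (hp.of_le (by exact_mod_cast le_top)) a b
  set ζ := mk p (memC0_of_contDiff hα.le hp a b hα0)
  obtain ⟨n, hn⟩ := exists_nat_ge (L + ‖ζ.toCM‖)
  have hn' : L ≤ n := (le_add_of_nonneg_right (norm_nonneg _)).trans hn
  refine mem_iUnion.2 ⟨n, ?_, ?_⟩
  · have : ‖ζ.toCM‖ ≤ n := by linarith
    exact_mod_cast this
  · refine (holderWith_iff_holderBound (y := p)).2 ?_
    exact_mod_cast hpL.mono hn' le_rfl le_rfl

end C0

end HolderSpace

end YoungDelay

namespace YoungDelay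

/-! ### Density of `C^{0,α}` in the continuous paths -/

section Density

variable {E G : Type*} [NormedAddCommGroup E] [NormedSpace ℝ E] [FiniteDimensional ℝ E]
  [NormedAddCommGroup G] {α : ℝ≥0} {a b : ℝ}

lemma C0.denseRange_toCM (hα0 : 0 < α) (hα : α ≤ 1) (hab : a ≤ b) :
    DenseRange (C0.toCM : C0 E α a b → C(Icc a b, E)) := fun ξ => by
  refine Metric.mem_closure_iff.2 fun ε hε => ?_
  obtain ⟨p, hp, hpξ, -⟩ := (ξ.continuous.Icc_extend' (h := hab)).exists_contDiff_approx ⊤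
    (ε := fun _ => ε / 2) continuous_const fun _ => half_pos hε
  refine ⟨_, ⟨C0.mk ⟨p, hp.continuous⟩ (memC0_of_contDiff hα hp a b hα0), rfl⟩, ?_⟩
  refine ((ContinuousMap.dist_le (half_pos hε).le).2 fun t => ?_).trans_lt (half_lt_self hε)
  have := (hpξ t).le
  rwa [IccExtend_val, dist_comm] at this

/-- A continuous map that is bounded on `C^{0,α}` is bounded. -/
lemma norm_le_of_forall_C0 (hα0 : 0 < α) (hα : α ≤ 1) (hab : a ≤ b) {g : C(Icc a b, E) → G}
    (hg : Continuous g) {K : ℝ} (hK : ∀ η : C0 E α a b, ‖g η.toCM‖ ≤ K) (ξ : C(Icc a b, E)) :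
    ‖g ξ‖ ≤ K :=
  (C0.denseRange_toCM hα0 hα hab).induction_on ξ
    (isClosed_le (hg.norm) continuous_const) hK

end Density

/-! ### The path space: continuity of the shift and subexponential growth -/

namespace PathSpace

variable {F : Type*} [NormedAddCommGroup F] [NormedSpace ℝ F] {ν : ℝ≥0}

lemma map_zero (x : PathSpace F ν) : x 0 = 0 := x.2.1

lemma ext {x z : PathSpace F ν} (h : ∀ t, x t = z t) : x = z := Subtype.ext (ContinuousMap.ext h)

lemma shift_apply (t : ℝ) (x : PathSpace F ν) (s : ℝ) : shift t x s = x (t + s) - x t := rfl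

lemma shift_zero : shift 0 = (id : PathSpace F ν → PathSpace F ν) := by
  funext x
  exact ext fun s => by rw [shift_apply, map_zero, zero_add, sub_zero]; rfl

lemma shift_add (t s : ℝ) : shift (t + s) = (shift t ∘ shift s : PathSpace F ν → _) := by
  funext x
  exact ext fun u => by
    simp only [Function.comp_apply, shift_apply]
    rw [show t + s + u = s + (t + u) by ring, add_comm t s]
    abel

lemma holderBall_restr (a b : ℝ) (x : PathSpace F ν) : HolderBall ν ‖restr a b x‖ a b x :=
  C0.holderBall fun _ => rfl

lemma holderBall_restr_sub (a b : ℝ) (x z : PathSpace F ν) :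
    HolderBall ν ‖restr a b x - restr a b z‖ a b (fun t => x t - z t) :=
  C0.holderBall fun _ => rfl

lemma norm_restr_sub_le {a b M : ℝ} {x z : PathSpace F ν} (hM : 0 ≤ M)
    (h : HolderBall ν M a b (fun t => x t - z t)) : ‖restr a b x - restr a b z‖ ≤ 2 * M :=
  C0.norm_le_of_holderBall (fun _ => rfl) hM h

lemma continuous_restr (a b : ℝ) : Continuous (restr a b : PathSpace F ν → C0 F ν a b) := by
  obtain ⟨n, hn⟩ := exists_nat_ge (max (-a) b)
  have h1 : Continuous (restr (-(n : ℝ)) n : PathSpace F ν → _) :=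
    continuous_iInf_dom (i := n) continuous_induced_dom
  refine continuous_iff_continuousAt.2 fun x => ?_
  rw [ContinuousAt, tendsto_iff_norm_sub_tendsto_zero]
  have h2 := (tendsto_iff_norm_sub_tendsto_zero.1 (h1.tendsto x)).const_mul 2
  rw [mul_zero] at h2
  refine squeeze_zero (fun _ => norm_nonneg _) (fun z => ?_) h2
  exact norm_restr_sub_le (norm_nonneg _) ((holderBall_restr_sub _ _ _ _).mono le_rfl
    (by linarith [le_max_left (-a) b]) (by linarith [le_max_right (-a) b]))

lemma continuousAt_iff {X : Type*} [TopologicalSpace X] {u : X → PathSpace F ν} {p : X} :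
    ContinuousAt u p ↔ ∀ n : ℕ, ContinuousAt (fun q => restr (-(n : ℝ)) n (u q)) p := by
  refine ⟨fun h n => (continuous_restr _ _).continuousAt.comp h, fun h => ?_⟩
  rw [ContinuousAt, nhds_iInf, tendsto_iInf]
  intro n
  rw [nhds_induced, tendsto_comap_iff]
  exact h n

/-- The difference `shift t x - shift t₀ x₀` splits into the distance of `x` and `x₀` on a larger
interval and the difference of two translates of the fixed path `x₀`. The latter is small because
`x₀` is a limit of smooth paths. -/
lemma continuous_shift (hν0 : 0 < ν) (hν : ν ≤ 1) :
    Continuous (fun p : ℝ × PathSpace F ν => shift p.1 p.2) := by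
  refine continuous_iff_continuousAt.2 fun ⟨t₀, x₀⟩ => continuousAt_iff.2 fun n => ?_
  obtain ⟨N, hN⟩ := exists_nat_ge (|t₀| + 1 + n)
  rw [ContinuousAt, tendsto_iff_norm_sub_tendsto_zero]
  refine Metric.tendsto_nhds.2 fun ε hε => ?_
  obtain ⟨κ, hκ, htr⟩ := (x₀.2.2 (-N) N).exists_translation hν0 hν (ε := ε / 16) (by positivity)
  have h1 : ∀ᶠ p : ℝ × PathSpace F ν in 𝓝 (t₀, x₀), |p.1 - t₀| < min κ 1 :=
    (continuous_fst.tendsto (t₀, x₀)).eventually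
      (Metric.ball_mem_nhds t₀ (lt_min hκ one_pos))
  have h2 : ∀ᶠ p : ℝ × PathSpace F ν in 𝓝 (t₀, x₀),
      ‖restr (-(N : ℝ)) N p.2 - restr (-(N : ℝ)) N x₀‖ < ε / 16 := by
    have h := ((continuous_restr (-(N : ℝ)) N).comp continuous_snd).tendsto (t₀, x₀)
    have := h.eventually (Metric.ball_mem_nhds _ (by positivity : 0 < ε / 16))
    filter_upwards [this] with p hp
    exact mem_ball_iff_norm.1 hp
  filter_upwards [h1, h2] with ⟨t, x⟩ ht hx
  dsimp only at ht hx ⊢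
  have hn : (0 : ℝ) ≤ n := n.cast_nonneg
  have ht1 := abs_lt.1 (ht.trans_le (min_le_right _ _))
  have ht0 := abs_le.1 (le_refl |t₀|)
  have ha : ∀ u ∈ Icc (-(n : ℝ)) n, t + u ∈ Icc (-(N : ℝ)) N := fun u hu =>
    ⟨by linarith [hu.1, ht1.1, ht0.1], by linarith [hu.2, ht1.2, ht0.2]⟩
  have hb0 := holderBall_restr_sub (-(N : ℝ)) N x x₀
  have hb1 : HolderBound ν (ε / 16) (-(n : ℝ)) n (fun u => x (t + u) - x₀ (t + u)) :=
    (hb0.2.comp_add t).mono hx.le (by linarith [ht1.1, ht0.1]) (by linarith [ht1.2, ht0.2])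
  have hb2 : ∀ u ∈ Icc (-(n : ℝ)) n, ‖x (t + u) - x₀ (t + u)‖ ≤ ε / 16 := fun u hu =>
    (hb0.1 _ (ha u hu)).trans hx.le
  have hb3 := htr t₀ t (-n) n (ht.le.trans (min_le_left _ _)) (by linarith [ht0.1])
    (by linarith [ht0.2]) (by linarith [ht1.1, ht0.1]) (by linarith [ht1.2, ht0.2])
  have h0 : (0 : ℝ) ∈ Icc (-(n : ℝ)) n := ⟨by linarith, hn⟩
  have e : ∀ u, shift t x u - shift t₀ x₀ u = ((x (t + u) - x₀ (t + u))
      + (x₀ (t + u) - x₀ (t₀ + u))) - ((x t - x₀ t) + (x₀ t - x₀ t₀)) := fun u => by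
    simp only [shift_apply]; abel
  have hb4 : HolderBall ν (ε / 4) (-(n : ℝ)) n (fun u => shift t x u - shift t₀ x₀ u) := by
    refine ⟨fun u hu => (congrArg norm (e u)).trans_le ?_, ?_⟩
    · have h3 := hb2 0 h0
      have h4 := hb3.1 0 h0
      have h5 := hb2 u hu
      have h6 := hb3.1 u hu
      simp only [add_zero] at h3 h4
      refine (norm_sub_le _ _).trans ?_
      linarith [norm_add_le (x (t + u) - x₀ (t + u)) (x₀ (t + u) - x₀ (t₀ + u)),
        norm_add_le (x t - x₀ t) (x₀ t - x₀ t₀)]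
    · refine HolderBound.congr (y := fun u => ((x (t + u) - x₀ (t + u))
        + (x₀ (t + u) - x₀ (t₀ + u))) - ((x t - x₀ t) + (x₀ t - x₀ t₀))) ?_ fun u _ => e u
      intro u v hu huv hv
      rw [sub_sub_sub_cancel_right]
      exact ((hb1.add hb3.2).mono (by linarith) le_rfl le_rfl) u v hu huv hv
  have := norm_restr_sub_le (by positivity) hb4
  rw [Real.dist_eq, sub_zero, abs_of_nonneg (norm_nonneg _)]
  linarith

lemma measurable_shift (hν0 : 0 < ν) (hν : ν ≤ 1) (t : ℝ) :
    Measurable (shift t : PathSpace F ν → PathSpace F ν) :=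
  ((continuous_shift hν0 hν).comp (Continuous.prodMk_right t)).measurable

lemma isMetricDynamicalSystem (hν0 : 0 < ν) (hν : ν ≤ 1) {P : Measure (PathSpace F ν)}
    (hP : ∀ t : ℝ, P.map (shift t) = P) : IsMetricDynamicalSystem P shift where
  measurable := (continuous_shift hν0 hν).measurable
  preserving t := ⟨measurable_shift hν0 hν t, hP t⟩
  zero := shift_zero
  add := shift_add

lemma norm_restr_shift_le {t a b a' b' : ℝ} (x : PathSpace F ν) (ha : a' ≤ t + a) (hb : t + b ≤ b')
    (hat : a' ≤ t) (htb : t ≤ b') : ‖restr a b (shift t x)‖ ≤ 3 * ‖restr a' b' x‖ := by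
  have h := holderBall_restr a' b' x
  have h1 := C0.norm_le_of_holderBound (η := restr a b (shift t x)) (y := shift t x)
    (M := 2 * ‖restr a' b' x‖) (H := ‖restr a' b' x‖) (fun _ => rfl) (by positivity)
    (norm_nonneg _) (fun u hu => ?_) (fun u v hu huv hv => ?_)
  · linarith
  · rw [shift_apply]
    refine (norm_sub_le _ _).trans ?_
    linarith [h.1 (t + u) ⟨by linarith [hu.1], by linarith [hu.2]⟩, h.1 t ⟨hat, htb⟩]
  · rw [shift_apply, shift_apply, sub_sub_sub_cancel_right]
    have := h.2 (t + u) (t + v) (by linarith) (by linarith) (by linarith)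
    rwa [add_sub_add_left_eq_sub] at this

/-- The paths whose Hölder norms on `[-Nr, Nr]` grow at most exponentially with rate `ε`. -/
def subexpPaths (F : Type*) [NormedAddCommGroup F] [NormedSpace ℝ F] (ν : ℝ≥0) (r ε : ℝ) :
    Set (PathSpace F ν) :=
  {x | ∃ C : ℕ, ∀ N : ℕ, ‖restr (-(N * r)) (N * r) x‖ ≤ C * Real.exp (ε * N)}

/-- The constant in `subexpPaths` ranges over `ℕ`, which makes this a countable union of closed
sets. -/
lemma measurableSet_subexpPaths (r ε : ℝ) : MeasurableSet (subexpPaths F ν r ε) := by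
  simp only [subexpPaths, Set.ofPred_exists, Set.ofPred_forall]
  exact MeasurableSet.iUnion fun C => MeasurableSet.iInter fun N =>
    (isClosed_le (continuous_restr _ _).norm continuous_const).measurableSet

/-- A shift by `t` enlarges the observation window by a fixed number of cells, which only changes
the constant. The set is thus invariant under every shift, not merely up to null sets. -/
lemma shift_mem_subexpPaths {r ε : ℝ} (hr : 0 < r) {x : PathSpace F ν}
    (hx : x ∈ subexpPaths F ν r ε) (t : ℝ) : shift t x ∈ subexpPaths F ν r ε := by
  obtain ⟨C, hC⟩ := hx
  obtain ⟨k, hk⟩ := exists_nat_ge (|t| / r)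
  rw [div_le_iff₀ hr] at hk
  obtain ⟨C', hC'⟩ := exists_nat_ge (3 * (C * Real.exp (ε * k)))
  refine ⟨C', fun N => ?_⟩
  have h0 := abs_le.1 (le_refl |t|)
  have hNr : 0 ≤ (N : ℝ) * r := by positivity
  have h1 := norm_restr_shift_le (t := t) (a := -(N * r)) (b := N * r) (a' := -((N + k : ℕ) * r))
    (b' := (N + k : ℕ) * r) x (by push_cast; linarith) (by push_cast; linarith)
    (by push_cast; linarith) (by push_cast; linarith)
  refine h1.trans ?_
  have h2 := hC (N + k)
  have e : Real.exp (ε * (N + k : ℕ)) = Real.exp (ε * k) * Real.exp (ε * N) := by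
    rw [← Real.exp_add]; push_cast; ring_nf
  rw [e] at h2
  calc _ ≤ 3 * (C * (Real.exp (ε * k) * Real.exp (ε * N))) := by gcongr
    _ = 3 * (C * Real.exp (ε * k)) * Real.exp (ε * N) := by ring
    _ ≤ C' * Real.exp (ε * N) := by gcongr

/-- Cell bounds add up over `2 * N` cells, and passing to the supremum norm costs another factor of
order `N`. Each of the two polynomial factors is absorbed by one more `exp (c * N)`, whence the rate
`3 * c`. -/
lemma subexpPaths_of_holderBound {r c : ℝ} (hr : 0 < r) (hc : 0 < c) (hν0 : 0 < ν) (hν : ν ≤ 1)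
    {x : PathSpace F ν} {C : ℝ} (hC : 0 ≤ C)
    (h1 : ∀ i : ℕ, HolderBound ν (C * Real.exp (c * i)) (-r) r (shift (i * r) x))
    (h2 : ∀ i : ℕ, HolderBound ν (C * Real.exp (c * i)) (-r) r (shift (-(i * r)) x)) :
    x ∈ subexpPaths F ν r (3 * c) := by
  have hν0' : (0 : ℝ) < ν := hν0
  have hν1' : (ν : ℝ) ≤ 1 := hν
  have key : ∀ N k : ℕ, k ≤ N →
      HolderBound ν (k * (2 * (C * Real.exp (c * N)))) (-(k * r)) (k * r) x := by
    intro N k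
    induction k with
    | zero =>
      intro _ s t hs hst ht
      simp only [Nat.cast_zero, zero_mul, neg_zero] at hs ht
      obtain rfl : s = t := by linarith
      simp
    | succ k ih =>
      intro hk
      have he : C * Real.exp (c * k) ≤ C * Real.exp (c * N) := by
        have : (k : ℝ) ≤ N := by exact_mod_cast (by omega : k ≤ N)
        gcongr
      have hpos : 0 ≤ C * Real.exp (c * N) := by positivity
      have hr1 : HolderBound ν (C * Real.exp (c * N)) (k * r) ((k + 1) * r) x :=
        fun s t hs hst ht => by
          have := (h1 k).mono he le_rfl le_rfl (s - k * r) (t - k * r) (by linarith) (by linarith)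
            (by linarith)
          simpa [shift_apply] using this
      have hr2 : HolderBound ν (C * Real.exp (c * N)) (-((k + 1) * r)) (-(k * r)) x :=
        fun s t hs hst ht => by
          have := (h2 k).mono he le_rfl le_rfl (s + k * r) (t + k * r) (by linarith) (by linarith)
            (by linarith)
          rw [shift_apply, shift_apply] at this
          simpa [show ∀ u : ℝ, -(k * r) + (u + k * r) = u from fun u => by ring] using this
      have h3 := (hr2.trans (ih (by omega)) ν.2 hpos (by positivity)).trans hr1 ν.2
        (by positivity) hpos
      push_cast
      exact h3.mono (by linarith) le_rfl le_rfl
  obtain ⟨C', hC'⟩ := exists_nat_ge (2 * C * (1 / c * (2 + r / c)))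
  refine ⟨C', fun N => ?_⟩
  have hNr : 0 ≤ (N : ℝ) * r := by positivity
  set H := (N : ℝ) * (2 * (C * Real.exp (c * N))) with hH
  have hH0 : 0 ≤ H := by positivity
  have hb := key N N le_rfl
  have hpow : ((N : ℝ) * r) ^ (ν : ℝ) ≤ 1 + N * r := by
    rcases le_total ((N : ℝ) * r) 1 with h | h
    · exact (Real.rpow_le_one hNr h hν0'.le).trans (by linarith)
    · exact (Real.rpow_le_rpow_of_exponent_le h hν1').trans (by rw [Real.rpow_one]; linarith)
  have hsup : ∀ t ∈ Icc (-(N * r)) (N * r), ‖x t‖ ≤ H * (1 + N * r) := fun t ht => by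
    have := hb.abs_bound (s := 0) (t := t) ⟨by linarith, hNr⟩ ht
    rw [map_zero, sub_zero, sub_zero] at this
    refine this.trans (mul_le_mul_of_nonneg_left ?_ hH0)
    exact (Real.rpow_le_rpow (abs_nonneg _) (abs_le.2 ht) hν0'.le).trans hpow
  have hn := C0.norm_le_of_holderBound (η := restr (-(N * r)) (N * r) x) (y := x) (fun _ => rfl)
    (by positivity) hH0 hsup hb
  have hcN : (N : ℝ) ≤ 1 / c * Real.exp (c * N) := by
    rw [one_div, ← div_eq_inv_mul, le_div_iff₀ hc]
    linarith [Real.add_one_le_exp (c * N)]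
  have he1 : 1 ≤ Real.exp (c * N) := Real.one_le_exp (by positivity)
  calc ‖restr (-(N * r)) (N * r) x‖ ≤ H * (1 + N * r) + H := hn
    _ = 2 * C * ((N : ℝ) * (2 + N * r)) * Real.exp (c * N) := by rw [hH]; ring
    _ ≤ 2 * C * ((1 / c * Real.exp (c * N)) * (2 * Real.exp (c * N)
          + 1 / c * Real.exp (c * N) * r)) * Real.exp (c * N) := by gcongr; linarith
    _ = 2 * C * (1 / c * (2 + r / c)) * (Real.exp (c * N) * Real.exp (c * N) * Real.exp (c * N)) := by
        ring
    _ ≤ C' * (Real.exp (c * N) * Real.exp (c * N) * Real.exp (c * N)) := by gcongr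
    _ = C' * Real.exp (3 * c * N) := by rw [← Real.exp_add, ← Real.exp_add]; ring_nf

end PathSpace

/-- Stationary random variables with a finite moment grow subexponentially. -/
lemma ae_exists_le_exp_of_moment {Ω : Type*} [MeasurableSpace Ω] {P : Measure Ω} {h : Ω → ℝ≥0∞}
    (hm : Measurable h) {q : ℝ} (hq : 0 < q) (hmom : ∫⁻ x, h x ^ q ∂P < ∞) {T : ℕ → Ω → Ω}
    (hT : ∀ i, MeasurePreserving (T i) P P) {c : ℝ} (hc : 0 < c) :
    ∀ᵐ x ∂P, ∃ C : ℝ≥0, ∀ i : ℕ, h (T i x) ≤ ENNReal.ofReal (C * Real.exp (c * i)) := by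
  -- By stationarity the weighted sum of the `q`-th powers has finite expectation, so it is almost
  -- surely finite. Its value bounds each single term, and the `q`-th root gives the constant.
  let w : ℕ → ℝ≥0∞ := fun i => ENNReal.ofReal (Real.exp (-(c * q) * i))
  have hw : ∑' i, w i ≠ ∞ := by
    have hs : Summable fun i : ℕ => Real.exp (-(c * q) * i) := by
      have h1 : Real.exp (-(c * q)) < 1 := Real.exp_lt_one_iff.2 (by
        have : 0 < c * q := by positivity
        linarith)
      refine (summable_geometric_of_lt_one (Real.exp_pos _).le h1).congr fun i => ?_
      rw [← Real.exp_nat_mul]; ring_nf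
    exact hs.tsum_ofReal_ne_top
  have hmT : ∀ i, Measurable fun x => h (T i x) ^ q := fun i =>
    (hm.comp (hT i).measurable).pow_const q
  have hint : ∫⁻ x, ∑' i, w i * h (T i x) ^ q ∂P ≠ ∞ := by
    rw [lintegral_tsum fun i => ((hmT i).const_mul _).aemeasurable]
    have : ∀ i, ∫⁻ x, w i * h (T i x) ^ q ∂P = w i * ∫⁻ x, h x ^ q ∂P := fun i => by
      rw [lintegral_const_mul _ (hmT i), (hT i).lintegral_comp (hm.pow_const q)]
    simp only [this, ENNReal.tsum_mul_right]
    exact ENNReal.mul_ne_top hw hmom.ne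
  filter_upwards [ae_lt_top (Measurable.tsum fun i => (hmT i).const_mul _) hint] with x hx
  set S := ∑' i, w i * h (T i x) ^ q with hS
  refine ⟨(S ^ (1 / q)).toNNReal, fun i => ?_⟩
  have h1 : w i * h (T i x) ^ q ≤ S := ENNReal.le_tsum i
  have hSfin : S ^ (1 / q) ≠ ∞ := ENNReal.rpow_ne_top_of_nonneg (by positivity) hx.ne
  have h2 := ENNReal.rpow_le_rpow h1 (by positivity : 0 ≤ 1 / q)
  rw [ENNReal.mul_rpow_of_nonneg _ _ (by positivity), ← ENNReal.rpow_mul, mul_one_div_cancel hq.ne',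
    ENNReal.rpow_one, ENNReal.ofReal_rpow_of_pos (Real.exp_pos _), ← Real.exp_mul] at h2
  rw [ENNReal.ofReal_mul NNReal.zero_le_coe, ENNReal.ofReal_coe_nnreal, ENNReal.coe_toNNReal hSfin]
  have h3 : ENNReal.ofReal (Real.exp (-(c * q) * i * (1 / q))) * ENNReal.ofReal (Real.exp (c * i))
      = 1 := by
    rw [← ENNReal.ofReal_mul (Real.exp_pos _).le, ← Real.exp_add,
      show -(c * q) * i * (1 / q) + c * i = 0 by field_simp; ring, Real.exp_zero,
      ENNReal.ofReal_one]
  calc h (T i x) = (ENNReal.ofReal (Real.exp (-(c * q) * i * (1 / q)))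
        * ENNReal.ofReal (Real.exp (c * i))) * h (T i x) := by rw [h3, one_mul]
    _ = (ENNReal.ofReal (Real.exp (-(c * q) * i * (1 / q))) * h (T i x))
        * ENNReal.ofReal (Real.exp (c * i)) := by ring
    _ ≤ S ^ (1 / q) * ENNReal.ofReal (Real.exp (c * i)) := by gcongr

namespace PathSpace

variable {F : Type*} [NormedAddCommGroup F] [NormedSpace ℝ F] {ν : ℝ≥0}

lemma ae_mem_subexpPaths {r ε q : ℝ} (hr : 0 < r) (hε : 0 < ε) (hq : 0 < q) (hν0 : 0 < ν)
    (hν : ν ≤ 1) {P : Measure (PathSpace F ν)} (hP : IsMetricDynamicalSystem P shift)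
    (hΓ : ∫⁻ x : PathSpace F ν, (eHolderNorm ν (fun t : Icc (-r) r => x t)) ^ q ∂P < ∞) :
    ∀ᵐ x ∂P, x ∈ subexpPaths F ν r ε := by
  -- The seminorm is a difference of two continuous functions of the path; this gives its
  -- measurability.
  have e : ∀ x : PathSpace F ν, eHolderNorm ν (fun t : Icc (-r) r => x t)
      = ENNReal.ofReal (‖restr (-r) r x‖ - ‖(restr (-r) r x).toCM‖) := fun x => by
    rw [C0.norm_def, add_sub_cancel_left, ENNReal.ofReal_coe_nnreal,
      (restr (-r) r x).memC0.1.coe_nnHolderNorm_eq_eHolderNorm]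
    rfl
  have hm : Measurable fun x : PathSpace F ν => eHolderNorm ν (fun t : Icc (-r) r => x t) := by
    simp only [e]
    exact ((continuous_restr (-r) r).norm.sub
      (C0.continuous_toCM.comp (continuous_restr (-r) r)).norm).measurable.ennreal_ofReal
  have hb : ∀ (t C : ℝ) (x : PathSpace F ν), 0 ≤ C →
      eHolderNorm ν (fun u : Icc (-r) r => shift t x u) ≤ ENNReal.ofReal C →
      HolderBound ν C (-r) r (shift t x) := fun t C x hC h => by
    rw [e, ENNReal.ofReal_le_ofReal_iff hC, C0.norm_def, add_sub_cancel_left] at h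
    have h1 := (restr (-r) r (shift t x)).memC0.1.holderWith
    exact (holderWith_iff_holderBound (y := shift t x).1 h1).mono h le_rfl le_rfl
  have hc : 0 < ε / 3 := by positivity
  filter_upwards [ae_exists_le_exp_of_moment hm hq hΓ (T := fun i : ℕ => shift (i * r))
      (fun i => hP.preserving _) hc,
    ae_exists_le_exp_of_moment hm hq hΓ (T := fun i : ℕ => shift (-(i * r)))
      (fun i => hP.preserving _) hc] with x ⟨C₁, h1⟩ ⟨C₂, h2⟩
  rw [show ε = 3 * (ε / 3) by ring]
  refine subexpPaths_of_holderBound hr hc hν0 hν (C := C₁ + C₂) (by positivity)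
    (fun i => (hb _ _ x (by positivity) (h1 i)).mono ?_ le_rfl le_rfl)
    fun i => (hb _ _ x (by positivity) (h2 i)).mono ?_ le_rfl le_rfl
  · gcongr; exact le_add_of_nonneg_right C₂.2
  · gcongr; exact le_add_of_nonneg_left C₁.2

end PathSpace

end YoungDelay

namespace YoungDelay

/-! ### Regularity and translation of solutions -/

section SolutionSegments

variable {E F : Type*} [NormedAddCommGroup E] [NormedSpace ℝ E] [NormedAddCommGroup F]
  [NormedSpace ℝ F] {r : ℝ} {B : E →L[ℝ] E} {f : C(Icc (-r) 0, E) → E}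
  {g : C(Icc (-r) 0, E) → F →L[ℝ] E} {Cf : ℝ≥0} {Cg : ℝ}

lemma MemC0.comp_add {α : ℝ≥0} {a b c d t : ℝ} {y : ℝ → E}
    (h : MemC0 α a b (fun s : Icc a b => y s)) (hc : a ≤ t + c) (hd : t + d ≤ b) :
    MemC0 α c d (fun s : Icc c d => y (t + s)) := by
  have key : ∀ {H : ℝ} {u : ℝ → E}, HolderBound α H a b u →
      HolderBound α H c d (fun s => u (t + s)) := fun hu =>
    (hu.comp_add t).mono le_rfl (by linarith) (by linarith)
  obtain ⟨H, hH, hy⟩ := memHolder_iff_holderBound.1 h.1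
  refine ⟨memHolder_iff_holderBound.2 ⟨H, hH, key hy⟩, fun ε hε => ?_⟩
  obtain ⟨p, hp, h1, h2⟩ := h.exists_smooth (ε := ε) hε
  exact ⟨fun s => p (t + s), hp.comp (contDiff_const.add contDiff_id),
    fun s => h1 (t + s) ⟨by linarith [s.2.1], by linarith [s.2.2]⟩,
    (holderWith_iff_holderBound (y := fun s => y (t + s) - p (t + s))).2 (key h2)⟩

/-- Solutions inherit the regularity of the driving path. -/
lemma IsDavieSolution.exists_holderBound [CompleteSpace E] (hc : RegularCoeff r f g Cf Cg)
    {β₀ ν T : ℝ} (he : YoungExponents β₀ ν) (hT : 0 ≤ T) {x : ℝ → F} {y : C(ℝ, E)}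
    (hy : IsDavieSolution r β₀ ν B f g x T y) (hx : ∃ H, 0 ≤ H ∧ HolderBound ν H 0 T x) :
    ∃ H, 0 ≤ H ∧ HolderBound ν H 0 T y := by
  obtain ⟨H, hH0, hH⟩ := hx
  obtain ⟨C, hC⟩ := hy.expansion
  have hν := he.pos.trans he.lt
  obtain ⟨K, hK⟩ := isCompact_Icc.exists_bound_of_continuousOn (s := Icc 0 T)
    (hc.continuous_g y).continuousOn
  obtain ⟨D, hD⟩ := isCompact_Icc.exists_bound_of_continuousOn (s := Icc 0 T)
    (continuous_drift (B := B) hc.lip.continuous y).continuousOn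
  have h1 := (hC.mono (le_abs_self C) le_rfl le_rfl).of_order_le (abs_nonneg C) (θ' := ν) hν
    (by linarith [he.pos])
  have hT0 : 0 ≤ T - 0 := by linarith
  have h2 : HolderBound ν (|C| * (T - 0) ^ (β₀ + ν - ν) + |K| * H) 0 T (driftFree r B f y) :=
    fun s t hs hst ht => by
    have h3 := h1 s t hs hst ht
    have h4 : ‖youngGerm (fun u => g (segment r y u)) x s t‖ ≤ |K| * (H * (t - s) ^ ν) := by
      refine (ContinuousLinearMap.le_opNorm _ _).trans ?_
      have h5 := (hK s ⟨hs, hst.trans ht⟩).trans (le_abs_self K)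
      have h6 := hH s t hs hst ht
      gcongr
    have h7 := norm_add_le (driftFree r B f y t - driftFree r B f y s
      - youngGerm (fun u => g (segment r y u)) x s t) (youngGerm (fun u => g (segment r y u)) x s t)
    rw [sub_add_cancel] at h7
    linarith
  refine ⟨_, ?_, holderBound_of_driftFree hc.lip.continuous (D := |D|)
    (fun u hu => (hD u hu).trans (le_abs_self D)) h2 hν le_rfl he.le_one (by positivity) hT le_rfl⟩
  positivity

lemma IsDavieSolution.memC0 [CompleteSpace E] (hc : RegularCoeff r f g Cf Cg)
    {β₀ ν : ℝ≥0} {T : ℝ} (he : YoungExponents β₀ ν) (hT : 0 ≤ T) {x : ℝ → F} {y : C(ℝ, E)}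
    (hy : IsDavieSolution r β₀ ν B f g x T y) (hx : ∃ H, 0 ≤ H ∧ HolderBound ν H 0 T x)
    (h0 : MemC0 β₀ (-r) 0 (segment r y 0)) : MemC0 β₀ (-r) T (fun t : Icc (-r) T => y t) := by
  obtain ⟨H, hH0, hH⟩ := hy.exists_holderBound hc he hT hx
  have hr := hc.r_pos
  refine MemC0.trans_holderBound he.pos he.lt he.le_one (by linarith) hT hH0 ?_ hH
  rw [show (segment r y 0 : Icc (-r) 0 → E) = fun t : Icc (-r) 0 => y t from
    funext fun t => by simp] at h0
  exact h0

/-- The path `y(s + ·)`. -/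
def translate (s : ℝ) (y : C(ℝ, E)) : C(ℝ, E) :=
  ⟨fun t => y (s + t), y.continuous.comp (continuous_const.add continuous_id)⟩

lemma translate_apply (s : ℝ) (y : C(ℝ, E)) (t : ℝ) : translate s y t = y (s + t) := rfl

lemma segment_translate (s : ℝ) (y : C(ℝ, E)) (t : ℝ) :
    segment r (translate s y) t = segment r y (s + t) :=
  ContinuousMap.ext fun u => by simp [translate_apply, add_assoc]

/-- The germ uses only increments of the driver, so the constant `c` is free; `c = x s` yields the
shifted path. -/
lemma IsDavieSolution.translate (hf : Continuous f) {β₀ ν s T : ℝ} (hs : 0 ≤ s) {x : ℝ → F}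
    {y : C(ℝ, E)} (hy : IsDavieSolution r β₀ ν B f g x (s + T) y) (c : F) :
    IsDavieSolution r β₀ ν B f g (fun t => x (s + t) - c) T (YoungDelay.translate s y) := by
  obtain ⟨⟨H, hH0, hH⟩, ⟨C, hC⟩⟩ := hy
  refine ⟨⟨H, hH0, (hH.comp_add s).mono le_rfl (by linarith) (by linarith)⟩, C, ?_⟩
  intro a b ha hab hb
  have h1 := hC (s + a) (s + b) (by linarith) (by linarith) (by linarith)
  rw [driftFree_sub hf] at h1 ⊢
  rw [← intervalIntegral.integral_comp_add_left (fun u => drift r B f y u)] at h1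
  simp only [youngGerm, segment_translate, translate_apply, drift, sub_sub_sub_cancel_right,
    add_sub_add_left_eq_sub] at h1 ⊢
  exact h1

end SolutionSegments

/-! ### The continuous random dynamical system -/

section Flow

variable {E F : Type*} [NormedAddCommGroup E] [NormedSpace ℝ E] [NormedAddCommGroup F]
  [NormedSpace ℝ F] [CompleteSpace E] {r : ℝ} {B : E →L[ℝ] E} {f : C(Icc (-r) 0, E) → E}
  {g : C(Icc (-r) 0, E) → F →L[ℝ] E} {Cf : ℝ≥0} {Cg : ℝ} {β₀ ν : ℝ≥0} {K CA lam : ℝ}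

lemma PathSpace.exists_holderBound (x : PathSpace F ν) (a b : ℝ) :
    ∃ H, 0 ≤ H ∧ HolderBound ν H a b x :=
  ⟨_, norm_nonneg _, (x.holderBall_restr a b).2⟩

namespace IsDissipative

/-- The solution of the delay equation with driving path `x` and initial segment `η`. -/
def solution (h : IsDissipative r β₀ ν B f g Cf Cg K CA lam) (x : PathSpace F ν)
    (η : C0 E β₀ (-r) 0) : C(ℝ, E) := (h.exists_solution x.2.2 η.memC0.1).choose

variable (h : IsDissipative r β₀ ν B f g Cf Cg K CA lam)

lemma segment_solution_zero (x : PathSpace F ν) (η : C0 E β₀ (-r) 0) :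
    segment r (h.solution x η) 0 = η.toCM := (h.exists_solution x.2.2 η.memC0.1).choose_spec.1

lemma isDavieSolution_solution (x : PathSpace F ν) (η : C0 E β₀ (-r) 0) (T : ℝ) :
    IsDavieSolution r β₀ ν B f g x T (h.solution x η) :=
  (h.exists_solution x.2.2 η.memC0.1).choose_spec.2 T

lemma solution_eq_toCM (x : PathSpace F ν) (η : C0 E β₀ (-r) 0) (t : Icc (-r) 0) :
    η.toCM t = h.solution x η t := by
  rw [← h.segment_solution_zero x η]; simp

lemma memC0_solution (x : PathSpace F ν) (η : C0 E β₀ (-r) 0) {T : ℝ} (hT : 0 ≤ T) :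
    MemC0 β₀ (-r) T (fun t : Icc (-r) T => h.solution x η t) :=
  (h.isDavieSolution_solution x η T).memC0 h.reg h.exps hT (x.exists_holderBound 0 T)
    (by rw [h.segment_solution_zero]; exact η.memC0)

end IsDissipative

/-- The solution flow on segments. -/
def IsDissipative.flow (h : IsDissipative r β₀ ν B f g Cf Cg K CA lam) (t : ℝ≥0)
    (x : PathSpace F ν) (η : C0 E β₀ (-r) 0) : C0 E β₀ (-r) 0 :=
  ⟨segment r (h.solution x η) t, (h.memC0_solution x η t.2).comp_add (by linarith [t.2]) (by simp)⟩

namespace IsDissipative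

variable (h : IsDissipative r β₀ ν B f g Cf Cg K CA lam)

lemma toCM_flow (t : ℝ≥0) (x : PathSpace F ν) (η : C0 E β₀ (-r) 0) :
    (h.flow t x η).toCM = segment r (h.solution x η) t := rfl

lemma solution_eqOn {x : PathSpace F ν} {η : C0 E β₀ (-r) 0} {z : C(ℝ, E)}
    (hz : ∀ T, IsDavieSolution r β₀ ν B f g x T z) (h0 : segment r z 0 = η.toCM) :
    EqOn z (h.solution x η) (Ici (-r)) := fun t ht =>
  (hz (max t 0)).eqOn h.reg h.exps (le_max_right _ _) (h.isDavieSolution_solution x η _)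
    (x.exists_holderBound _ _) (h0.trans (h.segment_solution_zero x η).symm)
    ⟨ht, le_max_left _ _⟩

lemma toCM_flow_eq {x : PathSpace F ν} {η : C0 E β₀ (-r) 0} {z : C(ℝ, E)}
    (hz : ∀ T, IsDavieSolution r β₀ ν B f g x T z) (h0 : segment r z 0 = η.toCM) (t : ℝ≥0) :
    (h.flow t x η).toCM = segment r z t :=
  ContinuousMap.ext fun s => (h.solution_eqOn hz h0 (by
    rw [mem_Ici]
    linarith [s.2.1, t.2])).symm

theorem isGeneratedBy : IsGeneratedBy r β₀ ν B f g h.flow := fun x η => by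
  refine ⟨h.solution x η, ?_, fun z hz => ?_, fun t => rfl⟩
  · have := isSolution_of_isDavieSolution h.reg h.exps (fun T => (x.2.2 0 T).1)
      fun T _ => h.isDavieSolution_solution x η T
    rwa [h.segment_solution_zero] at this
  · exact h.solution_eqOn (fun T => hz.isDavieSolution h.reg h.exps (x.2.2 0 T)) hz.initial

lemma flow_zero (x : PathSpace F ν) : h.flow 0 x = id := by
  funext η
  refine C0.ext fun t => ?_
  rw [toCM_flow, NNReal.coe_zero, h.segment_solution_zero]
  rfl

/-- The translated solution solves the equation driven by the shifted path with initial segment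
`h.flow s x η`; uniqueness identifies it with the flow. -/
lemma flow_add (t s : ℝ≥0) (x : PathSpace F ν) :
    h.flow (t + s) x = h.flow t (PathSpace.shift s x) ∘ h.flow s x := by
  funext η
  refine C0.ext fun u => ?_
  have hz : ∀ T, IsDavieSolution r β₀ ν B f g (PathSpace.shift s x) T
      (translate s (h.solution x η)) := fun T =>
    (h.isDavieSolution_solution x η (s + T)).translate h.reg.lip.continuous s.2 (x s)
  rw [Function.comp_apply, h.toCM_flow_eq hz
    (by rw [segment_translate, add_zero, toCM_flow]) t, segment_translate, toCM_flow,
    NNReal.coe_add, add_comm (t : ℝ)]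

/-- Lipschitz dependence of the flow on the driving path and on the initial segment. -/
lemma exists_flow_lipschitz (n : ℕ) {Q : ℝ} (hQ : 0 ≤ Q) :
    ∃ C, 0 ≤ C ∧ ∀ (x x' : PathSpace F ν) (η η' : C0 E β₀ (-r) 0),
      ‖PathSpace.restr 0 (n * r) x‖ ≤ Q → ‖PathSpace.restr 0 (n * r) x'‖ ≤ Q → ‖η‖ ≤ Q →
      ‖η'‖ ≤ Q → ∀ t : ℝ≥0, t ≤ n * r → ‖h.flow t x η - h.flow t x' η'‖
        ≤ C * (‖η - η'‖ + ‖PathSpace.restr 0 (n * r) x - PathSpace.restr 0 (n * r) x'‖) := by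
  have hr := h.reg.r_pos
  have hT : 0 ≤ (n : ℝ) * r := by positivity
  obtain ⟨M, hM0, hM⟩ := h.exists_holderBall_bound n Q Q hQ
  obtain ⟨C, hC0, hC⟩ := exists_stability_const h.reg h.exps B hT (by positivity : 0 ≤ M + Q)
  refine ⟨2 * C, by positivity, fun x x' η η' hx hx' hη hη' t ht => ?_⟩
  have hx1 := ((x.holderBall_restr 0 (n * r)).mono hx le_rfl le_rfl).2
  have hx1' := ((x'.holderBall_restr 0 (n * r)).mono hx' le_rfl le_rfl).2
  have hb : ∀ (x : PathSpace F ν) (η : C0 E β₀ (-r) 0), ‖η‖ ≤ Q →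
      HolderBound ν Q 0 (n * r) x → HolderBall β₀ (M + Q) (-r) (n * r) (h.solution x η) :=
    fun x η hη hx => (hM x _ (h.isDavieSolution_solution x η _) hx
      ((C0.holderBall (h.solution_eq_toCM x η)).mono hη le_rfl le_rfl)).mono (by linarith) le_rfl
        le_rfl
  have h1 := hC x x' _ _ ‖η - η'‖
    ‖PathSpace.restr 0 (n * r) x - PathSpace.restr 0 (n * r) x'‖
    (h.isDavieSolution_solution x η _) (h.isDavieSolution_solution x' η' _) (hb x η hη hx1)
    (hb x' η' hη' hx1') (hx1.mono (by linarith) le_rfl le_rfl)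
    (PathSpace.holderBall_restr_sub 0 (n * r) x x').2 (norm_nonneg _)
    (C0.holderBall fun t => by
      rw [C0.toCM_sub, ← h.solution_eq_toCM, ← h.solution_eq_toCM]; rfl)
  rw [mul_assoc]
  refine C0.norm_le_of_holderBall (y := fun s => h.solution x η (t + s)
    - h.solution x' η' (t + s)) (fun s => rfl) (by positivity) ⟨fun s hs => ?_, ?_⟩
  · exact h1.1 (t + s) ⟨by linarith [hs.1, t.2], by linarith [hs.2]⟩
  · exact (h1.2.comp_add t).mono le_rfl (by linarith [t.2]) (by linarith)

lemma continuousAt_flow_time (x : PathSpace F ν) (η : C0 E β₀ (-r) 0) (t₀ : ℝ≥0) :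
    Tendsto (fun t => ‖h.flow t x η - h.flow t₀ x η‖) (𝓝 t₀) (𝓝 0) := by
  have hβ1 : β₀ ≤ 1 := by
    have := h.exps.lt.le.trans h.exps.le_one
    exact_mod_cast this
  have hβ0 : 0 < β₀ := by exact_mod_cast h.exps.pos
  have ht₀ : (0 : ℝ) ≤ t₀ := t₀.2
  refine Metric.tendsto_nhds.2 fun ε hε => ?_
  -- Continuity in time relies on the whole solution lying in `C^{0,β₀}`: translations are not
  -- continuous on general Hölder paths.
  obtain ⟨κ, hκ, htr⟩ := (h.memC0_solution x η (T := t₀ + 1) (by positivity)).exists_translation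
    hβ0 hβ1 (ε := ε / 3) (by positivity)
  filter_upwards [Metric.ball_mem_nhds t₀ (lt_min hκ one_pos)] with t ht
  rw [Metric.mem_ball, NNReal.dist_eq] at ht
  have ht1 := abs_lt.1 (ht.trans_le (min_le_right _ _))
  have h1 := htr t₀ t (-r) 0 (ht.le.trans (min_le_left _ _)) (by linarith) (by linarith)
    (by linarith [t.2]) (by linarith)
  have h2 := C0.norm_le_of_holderBall (η := h.flow t x η - h.flow t₀ x η) (fun s => rfl)
    (by positivity) h1
  rw [Real.dist_eq, sub_zero, abs_of_nonneg (norm_nonneg _)]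
  linarith

/-- The flow is jointly continuous. -/
theorem continuous_flow :
    Continuous (fun p : ℝ≥0 × PathSpace F ν × C0 E β₀ (-r) 0 => h.flow p.1 p.2.1 p.2.2) := by
  refine continuous_iff_continuousAt.2 fun ⟨t₀, x₀, η₀⟩ => ?_
  rw [ContinuousAt, tendsto_iff_norm_sub_tendsto_zero]
  have hr := h.reg.r_pos
  obtain ⟨n, hn⟩ := exists_nat_ge ((t₀ + 1) / r)
  rw [div_le_iff₀ hr] at hn
  set ρ := PathSpace.restr (E := F) (ν := ν) 0 (n * r) with hρ
  obtain ⟨C, hC0, hC⟩ := h.exists_flow_lipschitz n (Q := ‖ρ x₀‖ + ‖η₀‖ + 1) (by positivity)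
  have hcx : Tendsto (fun p : ℝ≥0 × PathSpace F ν × C0 E β₀ (-r) 0 => ρ p.2.1)
      (𝓝 (t₀, x₀, η₀)) (𝓝 (ρ x₀)) :=
    (((PathSpace.continuous_restr 0 (n * r)).comp continuous_fst).comp continuous_snd).tendsto
      (t₀, x₀, η₀)
  have hcη : Tendsto (fun p : ℝ≥0 × PathSpace F ν × C0 E β₀ (-r) 0 => p.2.2)
      (𝓝 (t₀, x₀, η₀)) (𝓝 η₀) := (continuous_snd.comp continuous_snd).tendsto (t₀, x₀, η₀)
  have hct : Tendsto (fun p : ℝ≥0 × PathSpace F ν × C0 E β₀ (-r) 0 => p.1)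
      (𝓝 (t₀, x₀, η₀)) (𝓝 t₀) := continuous_fst.tendsto (t₀, x₀, η₀)
  have hlim : Tendsto (fun p : ℝ≥0 × PathSpace F ν × C0 E β₀ (-r) 0 =>
      C * (‖p.2.2 - η₀‖ + ‖ρ p.2.1 - ρ x₀‖) + ‖h.flow p.1 x₀ η₀ - h.flow t₀ x₀ η₀‖)
      (𝓝 (t₀, x₀, η₀)) (𝓝 0) := by
    have := (((tendsto_iff_norm_sub_tendsto_zero.1 hcη).add
      (tendsto_iff_norm_sub_tendsto_zero.1 hcx)).const_mul C).add
      ((h.continuousAt_flow_time x₀ η₀ t₀).comp hct)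
    simpa using this
  refine squeeze_zero' (Eventually.of_forall fun _ => norm_nonneg _) ?_ hlim
  filter_upwards [hcx.eventually (Metric.ball_mem_nhds _ one_pos),
    hcη.eventually (Metric.ball_mem_nhds _ one_pos),
    hct.eventually (Metric.ball_mem_nhds _ one_pos)] with ⟨t, x, η⟩ hx hη ht
  dsimp only at hx hη ht ⊢
  rw [dist_eq_norm] at hx hη
  rw [NNReal.dist_eq] at ht
  have h1 := hC x x₀ η η₀ (by linarith [norm_sub_norm_le (ρ x) (ρ x₀), norm_nonneg η₀])
    (by linarith [norm_nonneg η₀]) (by linarith [norm_sub_norm_le η η₀, norm_nonneg (ρ x₀)])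
    (by linarith [norm_nonneg (ρ x₀)]) t (by linarith [(abs_lt.1 ht).2])
  refine (norm_sub_le_norm_sub_add_norm_sub _ (h.flow t x₀ η₀) _).trans ?_
  linarith

end IsDissipative

/-- Joint measurability follows from joint continuity because `C^{0,β₀}` is second countable, so
that Borel sets of the product space are measurable for the product `σ`-algebra. -/
theorem IsDissipative.isContinuousRDS [FiniteDimensional ℝ E]
    (h : IsDissipative r β₀ ν B f g Cf Cg K CA lam) {P : Measure (PathSpace F ν)}
    (hP : ∀ t : ℝ, P.map (PathSpace.shift t) = P) :
    IsContinuousRDS P PathSpace.shift h.flow := by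
  have hβ1 : β₀ < 1 := by
    have := h.exps.lt.trans_le h.exps.le_one
    exact_mod_cast this
  have hν0 : 0 < ν := by
    have := h.exps.pos.trans h.exps.lt
    exact_mod_cast this
  have hν1 : ν ≤ 1 := by exact_mod_cast h.exps.le_one
  have : ProperSpace E := FiniteDimensional.proper ℝ E
  have := C0.separableSpace (E := E) (α := β₀) (a := -r) (b := 0)
    (by exact_mod_cast h.exps.pos) hβ1 (by linarith [h.reg.r_pos])
  have := UniformSpace.secondCountable_of_separable (C0 E β₀ (-r) 0)
  exact
    { base := PathSpace.isMetricDynamicalSystem hν0 hν1 hP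
      measurable := h.continuous_flow.measurable
      continuous := fun x => h.continuous_flow.comp
        (continuous_fst.prodMk (continuous_const.prodMk continuous_snd))
      zero := h.flow_zero
      cocycle := h.flow_add }

end Flow

end YoungDelay

namespace YoungDelay

/-! ### Abstract contracting systems: absorbing balls and their pullback images -/

section Contracting

variable {Ω S : Type*} [MeasurableSpace Ω] [NormedAddCommGroup S] [NormedSpace ℝ S]
  [MeasurableSpace S]

/-- A continuous random dynamical system whose time-`τ` map contracts norms up to a random
constant `Q` of slow exponential growth, and maps balls into compact sets. -/
structure IsContractingRDS (P : Measure Ω) (θ : ℝ → Ω → Ω) (φ : ℝ≥0 → Ω → S → S) (τ : ℝ≥0)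
    (a c : ℝ) (Q : Ω → ℝ) (Ω₀ : Set Ω) (𝒦 : ℕ → Set S) : Prop where
  rds : IsContinuousRDS P θ φ
  pos : 0 < τ
  rate_pos : 0 < a
  rate_lt : Real.exp (a * τ) < 2
  c_nonneg : 0 ≤ c
  measurable_Q : Measurable Q
  Q_nonneg : ∀ x, 0 ≤ Q x
  measurableSet : MeasurableSet Ω₀
  ae_mem : ∀ᵐ x ∂P, x ∈ Ω₀
  invariant : ∀ x ∈ Ω₀, ∀ t, θ t x ∈ Ω₀
  growth : ∀ x ∈ Ω₀, ∃ C, ∀ t, 0 ≤ t → Q (θ (-t) x) ≤ C * Real.exp (a * t)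
  contract : ∀ x η, ‖φ τ x η‖ ≤ 1 / 2 * ‖η‖ + Q x
  bound : ∀ (t : ℝ≥0) x η, t ≤ τ → ‖φ t x η‖ ≤ c * (‖η‖ + Q x)
  isCompact : ∀ N, IsCompact (𝒦 N)
  mem_compact : ∀ x η (N : ℕ), 1 / 2 * ‖η‖ + Q x ≤ N → φ τ x η ∈ 𝒦 N

/-- The radius of the absorbing ball. -/
def absorbRadius (θ : ℝ → Ω → Ω) (τ : ℝ≥0) (Q : Ω → ℝ) (x : Ω) : ℝ :=
  1 + ∑' i : ℕ, (1 / 2) ^ i * Q (θ (-((i + 1) * τ)) x)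

/-- The image at the present time of the absorbing ball at time `-nτ`. -/
def pullbackImage (θ : ℝ → Ω → Ω) (φ : ℝ≥0 → Ω → S → S) (τ : ℝ≥0) (Q : Ω → ℝ) (n : ℕ) (x : Ω) :
    Set S :=
  φ (n * τ) (θ (-(n * τ)) x) '' Metric.closedBall 0 (absorbRadius θ τ Q (θ (-(n * τ)) x))

open Classical in
/-- The omega-limit set of the absorbing balls. -/
def pullbackLimit (θ : ℝ → Ω → Ω) (φ : ℝ≥0 → Ω → S → S) (τ : ℝ≥0) (Q : Ω → ℝ) (Ω₀ : Set Ω)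
    (x : Ω) : Set S :=
  if x ∈ Ω₀ then ⋂ n : ℕ, closure (pullbackImage θ φ τ Q n x) else {0}

namespace IsContractingRDS

variable {P : Measure Ω} {θ : ℝ → Ω → Ω} {φ : ℝ≥0 → Ω → S → S} {τ : ℝ≥0} {a c : ℝ} {Q : Ω → ℝ}
  {Ω₀ : Set Ω} {𝒦 : ℕ → Set S}

lemma shift_shift (h : IsContractingRDS P θ φ τ a c Q Ω₀ 𝒦) (s t : ℝ) (x : Ω) :
    θ s (θ t x) = θ (s + t) x := by rw [h.rds.base.add]; rfl

lemma shift_zero (h : IsContractingRDS P θ φ τ a c Q Ω₀ 𝒦) (x : Ω) : θ 0 x = x := by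
  rw [h.rds.base.zero]; rfl

lemma cocycle (h : IsContractingRDS P θ φ τ a c Q Ω₀ 𝒦) (t s : ℝ≥0) (x : Ω) (η : S) :
    φ t (θ s x) (φ s x η) = φ (t + s) x η := by rw [h.rds.cocycle]; rfl

lemma continuous_map (h : IsContractingRDS P θ φ τ a c Q Ω₀ 𝒦) (t : ℝ≥0) (x : Ω) :
    Continuous (φ t x) := (h.rds.continuous x).comp (Continuous.prodMk_right t)

/-- The noise grows by at most `exp (a * τ) < 2` per step backwards, which the discount `1 / 2`
outweighs. -/
lemma summable_radius (h : IsContractingRDS P θ φ τ a c Q Ω₀ 𝒦) {x : Ω} (hx : x ∈ Ω₀) :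
    Summable fun i : ℕ => (1 / 2 : ℝ) ^ i * Q (θ (-((i + 1) * τ)) x) := by
  obtain ⟨C, hC⟩ := h.growth x hx
  have hs : Summable fun i : ℕ => C * Real.exp (a * τ) * (1 / 2 * Real.exp (a * τ)) ^ i :=
    (summable_geometric_of_lt_one (by positivity) (by linarith [h.rate_lt])).mul_left _
  refine hs.of_nonneg_of_le (fun i => mul_nonneg (by positivity) (h.Q_nonneg _)) fun i => ?_
  have h1 := hC ((i + 1) * τ) (by positivity)
  have e : Real.exp (a * ((i + 1) * τ)) = Real.exp (a * τ) * Real.exp (a * τ) ^ i := by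
    rw [← Real.exp_nat_mul, ← Real.exp_add]; ring_nf
  rw [e] at h1
  calc _ ≤ (1 / 2 : ℝ) ^ i * (C * (Real.exp (a * τ) * Real.exp (a * τ) ^ i)) := by gcongr
    _ = _ := by rw [mul_pow]; ring

lemma one_le_radius (h : IsContractingRDS P θ φ τ a c Q Ω₀ 𝒦) (x : Ω) :
    1 ≤ absorbRadius θ τ Q x :=
  le_add_of_nonneg_right (tsum_nonneg fun i => mul_nonneg (by positivity) (h.Q_nonneg _))

/-- The radius is built to be stationary for the recursion `R ↦ R / 2 + Q + 1 / 2`. The surplus `1 /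
2` over the contraction estimate makes the balls strictly absorbing. -/
lemma radius_shift (h : IsContractingRDS P θ φ τ a c Q Ω₀ 𝒦) {x : Ω} (hx : x ∈ Ω₀) :
    absorbRadius θ τ Q (θ τ x) = 1 / 2 + Q x + 1 / 2 * absorbRadius θ τ Q x := by
  have h1 := h.summable_radius (h.invariant x hx τ)
  have e : ∀ i : ℕ, (1 / 2 : ℝ) ^ (i + 1) * Q (θ (-(((i + 1 : ℕ) + 1) * τ)) (θ τ x))
      = 1 / 2 * ((1 / 2) ^ i * Q (θ (-((i + 1) * τ)) x)) := fun i => by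
    rw [h.shift_shift, show -(((i + 1 : ℕ) + 1) * (τ : ℝ)) + τ = -((i + 1) * τ) by push_cast; ring]
    ring
  rw [absorbRadius, h1.tsum_eq_zero_add, tsum_congr e, tsum_mul_left, absorbRadius, h.shift_shift]
  simp only [pow_zero, one_mul, Nat.cast_zero, zero_add, neg_add_cancel, h.shift_zero]
  ring

lemma radius_le (h : IsContractingRDS P θ φ τ a c Q Ω₀ 𝒦) {x : Ω} (hx : x ∈ Ω₀) :
    ∃ C, ∀ k : ℕ, absorbRadius θ τ Q (θ (-(k * τ)) x) ≤ C * Real.exp (a * (k * τ)) := by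
  obtain ⟨C, hC⟩ := h.growth x hx
  have hC0 : 0 ≤ C := by
    have := hC 0 le_rfl
    rw [mul_zero, Real.exp_zero, mul_one] at this
    exact (h.Q_nonneg _).trans this
  set κ := Real.exp (a * τ) with hκ
  have hs : Summable fun i : ℕ => (1 / 2 * κ) ^ i :=
    summable_geometric_of_lt_one (by positivity) (by linarith [h.rate_lt])
  refine ⟨1 + C * κ * ∑' i : ℕ, (1 / 2 * κ) ^ i, fun k => ?_⟩
  have h1 : ∀ i : ℕ, (1 / 2 : ℝ) ^ i * Q (θ (-((i + 1) * τ)) (θ (-(k * τ)) x))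
      ≤ Real.exp (a * (k * τ)) * (C * κ) * (1 / 2 * κ) ^ i := fun i => by
    have h2 := hC ((i + 1) * τ + k * τ) (by positivity)
    have e : Real.exp (a * ((i + 1) * τ + k * τ)) = Real.exp (a * (k * τ)) * (κ * κ ^ i) := by
      rw [hκ, ← Real.exp_nat_mul, ← Real.exp_add, ← Real.exp_add]; ring_nf
    rw [h.shift_shift, ← neg_add]
    rw [e] at h2
    calc _ ≤ (1 / 2 : ℝ) ^ i * (C * (Real.exp (a * (k * τ)) * (κ * κ ^ i))) := by gcongr
      _ = _ := by rw [mul_pow]; ring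
  have h3 := (h.summable_radius (h.invariant x hx (-(k * τ)))).tsum_le_tsum h1 (hs.mul_left _)
  rw [tsum_mul_left] at h3
  have h4 : 1 ≤ Real.exp (a * (k * τ)) := Real.one_le_exp (by
    have := h.rate_pos
    positivity)
  rw [absorbRadius, add_mul, one_mul]
  calc _ ≤ Real.exp (a * (k * τ)) + Real.exp (a * (k * τ)) * (C * κ) * ∑' i : ℕ, (1 / 2 * κ) ^ i :=
        add_le_add h4 h3
    _ = _ := by ring

/-- The `1` on the left is the accumulated slack of the radius: once `(1 / 2) ^ k * ‖η‖ ≤ 1`, the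
orbit is inside the absorbing ball, not just close to it. -/
lemma norm_iterate_le (h : IsContractingRDS P θ φ τ a c Q Ω₀ 𝒦) {x : Ω} (hx : x ∈ Ω₀) (k : ℕ)
    (η : S) : ‖φ (k * τ) x η‖ + 1 ≤ (1 / 2) ^ k * ‖η‖ + absorbRadius θ τ Q (θ (k * τ) x) := by
  induction k with
  | zero =>
    simp only [Nat.cast_zero, zero_mul, h.rds.zero, id, pow_zero, one_mul, h.shift_zero]
    linarith [h.one_le_radius x]
  | succ k ih =>
    have e1 : ((k + 1 : ℕ) : ℝ≥0) * τ = τ + k * τ := by push_cast; ring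
    have e2 : θ ((k + 1 : ℕ) * τ) x = θ τ (θ (k * τ) x) := by
      rw [h.shift_shift]; congr 1; push_cast; ring
    have h1 := h.contract (θ (k * τ) x) (φ (k * τ) x η)
    have h2 := h.cocycle τ (k * τ) x η
    rw [NNReal.coe_mul, NNReal.coe_natCast] at h2
    rw [e1, e2, h.radius_shift (h.invariant x hx _), ← h2, pow_succ]
    linarith

lemma image_pullbackImage (h : IsContractingRDS P θ φ τ a c Q Ω₀ 𝒦) (n k : ℕ) (x : Ω) :
    φ (k * τ) x '' pullbackImage θ φ τ Q n x = pullbackImage θ φ τ Q (n + k) (θ (k * τ) x) := by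
  have e : θ (-((n + k : ℕ) * τ)) (θ (k * τ) x) = θ (-(n * τ)) x := by
    rw [h.shift_shift]; congr 1; push_cast; ring
  rw [pullbackImage, pullbackImage, e, image_image]
  refine image_congr fun η _ => ?_
  have h1 := h.cocycle (k * τ) (n * τ) (θ (-(n * τ)) x) η
  rw [h.shift_shift, NNReal.coe_mul, NNReal.coe_natCast, add_neg_cancel, h.shift_zero] at h1
  rw [h1]; congr 2; push_cast; ring

lemma maps_ball (h : IsContractingRDS P θ φ τ a c Q Ω₀ 𝒦) {x : Ω} (hx : x ∈ Ω₀) :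
    φ τ x '' Metric.closedBall 0 (absorbRadius θ τ Q x)
      ⊆ Metric.closedBall 0 (absorbRadius θ τ Q (θ τ x)) := by
  rintro _ ⟨η, hη, rfl⟩
  rw [mem_closedBall_zero_iff] at hη ⊢
  rw [h.radius_shift hx]
  linarith [h.contract x η]

/-- The ball at time `-(n + 1) * τ` is mapped in one step into the ball at time `-n * τ`;
transporting this inclusion to the present by the cocycle property gives monotonicity. -/
lemma pullbackImage_antitone (h : IsContractingRDS P θ φ τ a c Q Ω₀ 𝒦) {x : Ω} (hx : x ∈ Ω₀) :
    Antitone fun n => pullbackImage θ φ τ Q n x := by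
  refine antitone_nat_of_succ_le fun n => ?_
  have h0 : ∀ y, pullbackImage θ φ τ Q 0 y
      = Metric.closedBall 0 (absorbRadius θ τ Q y) := fun y => by
    simp [pullbackImage, h.rds.zero, h.shift_zero]
  have h1 := h.maps_ball (h.invariant x hx (-((n + 1 : ℕ) * τ)))
  have h2 := h.image_pullbackImage 0 1 (θ (-((n + 1 : ℕ) * τ)) x)
  rw [← h0, ← h0] at h1
  have h3 := h.image_pullbackImage 1 n (θ (-(n * τ)) x)
  have h4 := h.image_pullbackImage 0 n (θ (-(n * τ)) x)
  simp only [h.shift_shift, add_neg_cancel, h.shift_zero, zero_add] at h3 h4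
  simp only [Nat.cast_one, one_mul, h.shift_shift, zero_add] at h2 h1
  rw [h2] at h1
  rw [show (τ : ℝ) + -((n + 1 : ℕ) * τ) = -(n * τ) by push_cast; ring] at h1
  have h5 := image_mono (f := φ (n * τ) (θ (-(n * τ)) x)) h1
  rw [h3, h4, add_comm 1 n] at h5
  exact h5

end IsContractingRDS

end Contracting

end YoungDelay

namespace YoungDelay

/-! ### Abstract contracting systems: the limit set and its properties -/

section Contracting

variable {Ω S : Type*} [MeasurableSpace Ω] [NormedAddCommGroup S] [NormedSpace ℝ S]
  [MeasurableSpace S] {P : Measure Ω} {θ : ℝ → Ω → Ω} {φ : ℝ≥0 → Ω → S → S} {τ : ℝ≥0} {a c : ℝ}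
  {Q : Ω → ℝ} {Ω₀ : Set Ω} {𝒦 : ℕ → Set S}

namespace IsContractingRDS

lemma pullbackLimit_of_mem {x : Ω} (hx : x ∈ Ω₀) :
    pullbackLimit θ φ τ Q Ω₀ x = ⋂ n : ℕ, closure (pullbackImage θ φ τ Q n x) := if_pos hx

lemma pullbackLimit_of_notMem {x : Ω} (hx : x ∉ Ω₀) : pullbackLimit θ φ τ Q Ω₀ x = {0} := if_neg hx

lemma nonempty_pullbackImage (h : IsContractingRDS P θ φ τ a c Q Ω₀ 𝒦) (n : ℕ) (x : Ω) :
    (pullbackImage θ φ τ Q n x).Nonempty :=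
  (Metric.nonempty_closedBall.2 (zero_le_one.trans (h.one_le_radius _))).image _

lemma closure_antitone (h : IsContractingRDS P θ φ τ a c Q Ω₀ 𝒦) {x : Ω} (hx : x ∈ Ω₀) :
    Antitone fun n => closure (pullbackImage θ φ τ Q n x) := fun _ _ hmn =>
  closure_mono (h.pullbackImage_antitone hx hmn)

lemma exists_closure_subset (h : IsContractingRDS P θ φ τ a c Q Ω₀ 𝒦) (x : Ω) :
    ∃ N, closure (pullbackImage θ φ τ Q 1 x) ⊆ 𝒦 N := by
  obtain ⟨N, hN⟩ := exists_nat_ge (1 / 2 * absorbRadius θ τ Q (θ (-τ) x) + Q (θ (-τ) x))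
  refine ⟨N, closure_minimal ?_ (h.isCompact N).isClosed⟩
  rintro _ ⟨η, hη, rfl⟩
  simp only [Nat.cast_one, one_mul, mem_closedBall_zero_iff] at hη ⊢
  exact h.mem_compact _ _ _ (by linarith)

/-- The image with index `0` is a full ball, which is not compact in general. One time step suffices
for compactness, hence the index `n + 1` here and below. -/
lemma isCompact_closure (h : IsContractingRDS P θ φ τ a c Q Ω₀ 𝒦) {x : Ω} (hx : x ∈ Ω₀) (n : ℕ) :
    IsCompact (closure (pullbackImage θ φ τ Q (n + 1) x)) := by
  obtain ⟨N, hN⟩ := h.exists_closure_subset x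
  exact (h.isCompact N).of_isClosed_subset isClosed_closure
    ((h.closure_antitone hx (by omega : 1 ≤ n + 1)).trans hN)

lemma iInter_closure_succ (h : IsContractingRDS P θ φ τ a c Q Ω₀ 𝒦) {x : Ω} (hx : x ∈ Ω₀) :
    ⋂ n : ℕ, closure (pullbackImage θ φ τ Q (n + 1) x) = pullbackLimit θ φ τ Q Ω₀ x := by
  rw [pullbackLimit_of_mem hx]
  exact (h.closure_antitone hx).iInter_nat_add 1

lemma isCompact_pullbackLimit (h : IsContractingRDS P θ φ τ a c Q Ω₀ 𝒦) (x : Ω) :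
    IsCompact (pullbackLimit θ φ τ Q Ω₀ x) := by
  by_cases hx : x ∈ Ω₀
  · rw [← h.iInter_closure_succ hx]
    exact (h.isCompact_closure hx 0).of_isClosed_subset (isClosed_iInter fun _ => isClosed_closure)
      (iInter_subset _ 0)
  · rw [pullbackLimit_of_notMem hx]; exact isCompact_singleton

lemma nonempty_pullbackLimit (h : IsContractingRDS P θ φ τ a c Q Ω₀ 𝒦) (x : Ω) :
    (pullbackLimit θ φ τ Q Ω₀ x).Nonempty := by
  by_cases hx : x ∈ Ω₀
  · rw [← h.iInter_closure_succ hx]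
    exact IsCompact.nonempty_iInter_of_sequence_nonempty_isCompact_isClosed _
      (fun n => h.closure_antitone hx (by omega)) (fun n => (h.nonempty_pullbackImage _ x).closure)
      (h.isCompact_closure hx 0) fun _ => isClosed_closure
  · rw [pullbackLimit_of_notMem hx]; exact singleton_nonempty _

lemma exists_pullbackLimit_subset (h : IsContractingRDS P θ φ τ a c Q Ω₀ 𝒦) {x : Ω} (hx : x ∈ Ω₀) :
    ∃ N, pullbackLimit θ φ τ Q Ω₀ x ⊆ 𝒦 N := by
  obtain ⟨N, hN⟩ := h.exists_closure_subset x
  refine ⟨N, Subset.trans ?_ hN⟩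
  rw [pullbackLimit_of_mem hx]
  exact iInter_subset _ 1

/-- The pullback images of the absorbing balls shrink to the limit set. -/
lemma exists_pullbackImage_subset (h : IsContractingRDS P θ φ τ a c Q Ω₀ 𝒦) {x : Ω} (hx : x ∈ Ω₀)
    {ε : ℝ} (hε : 0 < ε) : ∃ m, ∀ n, m ≤ n → closure (pullbackImage θ φ τ Q n x)
      ⊆ Metric.thickening ε (pullbackLimit θ φ τ Q Ω₀ x) := by
  obtain ⟨m, hm⟩ := exists_subset_nhds_of_isCompact
    (V := fun n : ℕ => closure (pullbackImage θ φ τ Q (n + 1) x))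
    (U := Metric.thickening ε (pullbackLimit θ φ τ Q Ω₀ x))
    (Antitone.directed_ge fun m n hmn => h.closure_antitone hx (by omega))
    (h.isCompact_closure hx) fun η hη => Metric.isOpen_thickening.mem_nhds
      (Metric.self_subset_thickening hε _ (by rwa [h.iInter_closure_succ hx] at hη))
  exact ⟨m + 1, fun n hn => (h.closure_antitone hx hn).trans hm⟩

/-- Pullback images are mapped onto each other exactly. Continuity gives one inclusion; for the
other, a preimage of a limit point is found in each compact image, and nested compactness provides a
common one. -/
lemma image_pullbackLimit_nat (h : IsContractingRDS P θ φ τ a c Q Ω₀ 𝒦) {x : Ω} (hx : x ∈ Ω₀)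
    (k : ℕ) : φ (k * τ) x '' pullbackLimit θ φ τ Q Ω₀ x
      = pullbackLimit θ φ τ Q Ω₀ (θ (k * τ) x) := by
  have hcont := h.continuous_map (k * τ) x
  have hkx := h.invariant x hx (k * τ)
  refine Subset.antisymm ?_ fun ζ hζ => ?_
  · rintro _ ⟨η, hη, rfl⟩
    rw [pullbackLimit_of_mem hkx]
    rw [pullbackLimit_of_mem hx] at hη
    refine mem_iInter.2 fun n => h.closure_antitone hkx (Nat.le_add_right n k) ?_
    dsimp only
    rw [← h.image_pullbackImage]
    exact image_closure_subset_closure_image hcont (mem_image_of_mem _ (mem_iInter.1 hη n))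
  · rw [pullbackLimit_of_mem hkx] at hζ
    have h1 : ∀ n : ℕ, (closure (pullbackImage θ φ τ Q (n + 1) x) ∩ φ (k * τ) x ⁻¹' {ζ}).Nonempty :=
      fun n => by
      have h2 := mem_iInter.1 hζ (n + 1 + k)
      rw [← h.image_pullbackImage] at h2
      have h3 := closure_minimal (image_mono subset_closure)
        ((h.isCompact_closure hx n).image hcont).isClosed h2
      obtain ⟨η, hη, hηζ⟩ := h3
      exact ⟨η, hη, hηζ⟩
    have hcl : IsClosed (φ (k * τ) x ⁻¹' {ζ}) := isClosed_singleton.preimage hcont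
    obtain ⟨η, hη⟩ := IsCompact.nonempty_iInter_of_sequence_nonempty_isCompact_isClosed _
      (fun n => inter_subset_inter_left _ (h.closure_antitone hx (by omega))) h1
      ((h.isCompact_closure hx 0).inter_right hcl) fun _ => isClosed_closure.inter hcl
    rw [mem_iInter] at hη
    refine ⟨η, ?_, (hη 0).2⟩
    rw [← h.iInter_closure_succ hx]
    exact mem_iInter.2 fun n => (hη n).1

/-- Initial conditions in the distant past of slow exponential growth are absorbed. -/
lemma absorb (h : IsContractingRDS P θ φ τ a c Q Ω₀ 𝒦) {x : Ω} (hx : x ∈ Ω₀) (C : ℝ) (m : ℕ) :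
    ∀ᶠ t : ℝ≥0 in atTop, ∀ η, ‖η‖ ≤ C * Real.exp (a * t) →
      φ t (θ (-t) x) η ∈ pullbackImage θ φ τ Q m x := by
  obtain ⟨C', hC'⟩ := h.growth x hx
  have hτ : (0 : ℝ) < τ := h.pos
  have ha := h.rate_pos
  have hc := h.c_nonneg
  set κ := Real.exp (a * τ) with hκ
  have hκ1 : 1 ≤ κ := Real.one_le_exp (by positivity)
  have hlim : Tendsto (fun k : ℕ => c * ((|C| + |C'|) * κ ^ (m + 1)) * (κ / 2) ^ k) atTop (𝓝 0) := by
    simpa using (tendsto_pow_atTop_nhds_zero_of_lt_one (by positivity)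
      (by linarith [h.rate_lt] : κ / 2 < 1)).const_mul _
  obtain ⟨k₀, hk₀⟩ := eventually_atTop.1 (hlim.eventually (ge_mem_nhds one_pos))
  filter_upwards [eventually_ge_atTop ((m + k₀ : ℕ) * τ : ℝ≥0)] with t ht η hη
  -- Write `t = s + k * τ + m * τ`. The remainder `s < τ` is controlled by the crude bound, the next
  -- `k` steps beat the exponential growth at rate `κ / 2 < 1` and enter the absorbing ball at time
  -- `-m * τ`, and the last `m` steps produce the image with index `m`.
  set N := ⌊t / τ⌋₊ with hN
  have hN1 : (N : ℝ≥0) * τ ≤ t := by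
    rw [← le_div_iff₀ h.pos]; exact Nat.floor_le zero_le
  have hN2 : t < (N + 1) * τ := by
    rw [← div_lt_iff₀ h.pos]; exact Nat.lt_floor_add_one _
  have hN3 : m + k₀ ≤ N := Nat.le_floor (by rw [le_div_iff₀ h.pos]; exact ht)
  obtain ⟨k, hk⟩ := Nat.exists_eq_add_of_le ((Nat.le_add_right m k₀).trans hN3)
  have hkk : k₀ ≤ k := by omega
  obtain ⟨s, hs⟩ := exists_add_of_le hN1
  have hsτ : s ≤ τ := by
    have : (N : ℝ≥0) * τ + s < N * τ + τ := by rw [← hs]; linarith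
    exact (lt_of_add_lt_add_left this).le
  have htr : (t : ℝ) = N * τ + s := by rw [hs]; push_cast; ring
  have hNr : (N : ℝ) = m + k := by rw [hk]; push_cast; ring
  set z := θ (-(N * τ)) x with hz
  have hzm : θ (k * τ) z = θ (-(m * τ)) x := by
    rw [hz, h.shift_shift, hNr]; congr 1; ring
  have hzs : θ s (θ (-t) x) = z := by
    rw [hz, h.shift_shift, htr]; congr 1; ring
  set ξ := φ s (θ (-t) x) η with hξ
  have hξ1 : ‖ξ‖ ≤ c * ((|C| + |C'|) * κ ^ (N + 1)) := by
    have h1 := h.bound s (θ (-t) x) η hsτ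
    have h2 := hC' t t.2
    have h3 : Real.exp (a * t) ≤ κ ^ (N + 1) := by
      rw [hκ, ← Real.exp_nat_mul]
      refine Real.exp_le_exp.2 ?_
      have : (t : ℝ) ≤ (N + 1) * τ := by exact_mod_cast hN2.le
      push_cast
      calc a * t ≤ a * ((N + 1) * τ) := by gcongr
        _ = _ := by ring
    refine h1.trans (mul_le_mul_of_nonneg_left ?_ hc)
    have h4 : C * Real.exp (a * t) ≤ |C| * κ ^ (N + 1) := by
      gcongr; exact le_abs_self C
    have h5 : C' * Real.exp (a * t) ≤ |C'| * κ ^ (N + 1) := by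
      gcongr; exact le_abs_self C'
    rw [add_mul]
    linarith
  have hξ2 : (1 / 2) ^ k * ‖ξ‖ ≤ 1 := by
    refine le_trans ?_ (hk₀ k hkk)
    calc (1 / 2 : ℝ) ^ k * ‖ξ‖ ≤ (1 / 2) ^ k * (c * ((|C| + |C'|) * κ ^ (N + 1))) := by gcongr
      _ = c * ((|C| + |C'|) * κ ^ (m + 1)) * (κ / 2) ^ k := by
        rw [hk, div_pow, div_pow, one_pow, show m + k + 1 = m + 1 + k by ring, pow_add κ (m + 1)]
        ring
  have hζ := h.norm_iterate_le (h.invariant x hx (-(N * τ))) k ξ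
  rw [← hz, hzm] at hζ
  refine ⟨φ (k * τ) z ξ, mem_closedBall_zero_iff.2 (by linarith), ?_⟩
  have e1 := h.cocycle (m * τ) (k * τ) z ξ
  rw [NNReal.coe_mul, NNReal.coe_natCast, hzm] at e1
  have e2 := h.cocycle (m * τ + k * τ) s (θ (-t) x) η
  rw [hzs] at e2
  rw [e1, e2, hs, hk]
  congr 1; push_cast; ring

/-- A point of the limit set comes from limit sets arbitrarily far in the past, whose radii grow
slowly. Its image at the arbitrary time `t` is therefore absorbed into every pullback image over `θ
t x`. -/
lemma image_pullbackLimit_subset (h : IsContractingRDS P θ φ τ a c Q Ω₀ 𝒦) {x : Ω} (hx : x ∈ Ω₀)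
    (t : ℝ≥0) : φ t x '' pullbackLimit θ φ τ Q Ω₀ x ⊆ pullbackLimit θ φ τ Q Ω₀ (θ t x) := by
  rintro _ ⟨η, hη, rfl⟩
  have htx := h.invariant x hx t
  obtain ⟨C, hC⟩ := h.radius_le hx
  rw [pullbackLimit_of_mem htx]
  refine mem_iInter.2 fun m => subset_closure ?_
  have htend : Tendsto (fun k : ℕ => t + k * τ) atTop atTop :=
    tendsto_atTop_mono (fun k => le_add_self)
      (tendsto_natCast_atTop_atTop.atTop_mul_const h.pos)
  obtain ⟨k, hk⟩ := (htend.eventually (h.absorb htx |C| m)).exists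
  have hkx := h.invariant x hx (-(k * τ))
  have h1 := h.image_pullbackLimit_nat hkx k
  rw [h.shift_shift, add_neg_cancel, h.shift_zero] at h1
  rw [← h1] at hη
  obtain ⟨ξ, hξ, rfl⟩ := hη
  have h2 : ‖ξ‖ ≤ absorbRadius θ τ Q (θ (-(k * τ)) x) := by
    rw [pullbackLimit_of_mem hkx] at hξ
    have h3 := mem_iInter.1 hξ 0
    simp only [pullbackImage, Nat.cast_zero, zero_mul, neg_zero, h.shift_zero, h.rds.zero,
      image_id, Metric.isClosed_closedBall.closure_eq] at h3
    exact mem_closedBall_zero_iff.1 h3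
  have h4 := hk ξ ?_
  · have e1 : θ (-((t + k * τ : ℝ≥0) : ℝ)) (θ t x) = θ (-(k * τ)) x := by
      rw [h.shift_shift]; congr 1; push_cast; ring
    rw [e1] at h4
    have e2 := h.cocycle t (k * τ) (θ (-(k * τ)) x) ξ
    rw [NNReal.coe_mul, NNReal.coe_natCast, h.shift_shift, add_neg_cancel, h.shift_zero] at e2
    rwa [e2]
  · refine h2.trans ((hC k).trans ?_)
    have ha := h.rate_pos
    have : ((t + k * τ : ℝ≥0) : ℝ) = t + k * τ := by push_cast; ring
    rw [this]
    have ht := t.2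
    gcongr
    · exact le_abs_self C
    · exact le_add_of_nonneg_left ht

/-- The limit set is invariant. -/
lemma image_pullbackLimit (h : IsContractingRDS P θ φ τ a c Q Ω₀ 𝒦) {x : Ω} (hx : x ∈ Ω₀)
    (t : ℝ≥0) : φ t x '' pullbackLimit θ φ τ Q Ω₀ x = pullbackLimit θ φ τ Q Ω₀ (θ t x) := by
  refine Subset.antisymm (h.image_pullbackLimit_subset hx t) ?_
  -- The converse inclusion reduces to multiples of `τ`: with `k * τ = t + s`, start from the limit
  -- set over `θ (-s) x`, flow for time `s` into the limit set over `x`, then for time `t`.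
  obtain ⟨k, hk⟩ := exists_nat_ge (t / τ)
  rw [div_le_iff₀ h.pos] at hk
  obtain ⟨s, hs⟩ := exists_add_of_le hk
  have hsr : (k * τ : ℝ) = t + s := by exact_mod_cast hs
  have h1 := h.image_pullbackLimit_nat (h.invariant x hx (-s)) k
  have h2 := h.image_pullbackLimit_subset (h.invariant x hx (-s)) s
  rw [h.shift_shift, hsr, add_neg_cancel_right] at h1
  rw [h.shift_shift, add_neg_cancel, h.shift_zero] at h2
  rw [← h1]
  refine Subset.trans ?_ (image_mono h2)
  rw [image_image]
  refine (image_congr fun η _ => ?_).subset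
  have e := h.cocycle t s (θ (-s) x) η
  rw [h.shift_shift, add_neg_cancel, h.shift_zero] at e
  rw [e, hs]

/-- Tempered sets are attracted by the limit set. -/
lemma tendsto_semiDist (h : IsContractingRDS P θ φ τ a c Q Ω₀ 𝒦) {D : Ω → Set S}
    (hD : D ∈ temperedUniverse P θ) : ∀ᵐ x ∂P, Tendsto
      (fun t : ℝ≥0 => semiDist (φ t (θ (-t) x) '' D (θ (-t) x)) (pullbackLimit θ φ τ Q Ω₀ x))
      atTop (𝓝 0) := by
  obtain ⟨-, ρ, hρ, hDρ⟩ := hD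
  filter_upwards [h.ae_mem, hρ.limit_atBot, hDρ] with x hx hlim hsub
  rw [ENNReal.tendsto_nhds_zero]
  intro ε hε
  obtain ⟨δ, hδ, hδε⟩ := ENNReal.lt_iff_exists_nnreal_btwn.1 hε
  have hδ0 : 0 < δ := by exact_mod_cast hδ
  obtain ⟨m, hm⟩ := h.exists_pullbackImage_subset hx (ε := δ) hδ0
  have hneg : Tendsto (fun t : ℝ≥0 => -(t : ℝ)) atTop atBot :=
    tendsto_neg_atTop_atBot.comp (NNReal.tendsto_coe_atTop.2 tendsto_id)
  -- Temperedness at `-∞` bounds the radius at time `-t` by `exp (a * t)` eventually, which is the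
  -- growth allowed in `absorb`.
  have h1 := (hlim.comp hneg).eventually (lt_mem_nhds (neg_lt_zero.2 h.rate_pos))
  filter_upwards [h1, h.absorb hx 1 m, eventually_gt_atTop 0] with t ht habs ht0
  have ht0' : (0 : ℝ) < t := ht0
  refine iSup₂_le fun ζ hζ => ?_
  obtain ⟨η, hη, rfl⟩ := hζ
  have h2 : ‖η‖ ≤ 1 * Real.exp (a * t) := by
    have h3 := mem_closedBall_zero_iff.1 (hsub (-t) hη)
    have h4 : Real.posLog (ρ (θ (-t) x)) ≤ a * t := by
      simp only [Function.comp_apply] at ht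
      rw [inv_neg, neg_mul, neg_lt_neg_iff, ← div_eq_inv_mul, div_lt_iff₀ ht0'] at ht
      exact ht.le
    rw [one_mul]
    refine h3.trans ?_
    rcases (hρ.nonneg (θ (-t) x)).eq_or_lt with h5 | h5
    · rw [← h5]; exact (Real.exp_pos _).le
    · rw [← Real.log_le_iff_le_exp h5]
      exact (le_max_right _ _).trans h4
  have h6 := hm m le_rfl (subset_closure (habs η h2))
  have h7 := Metric.mem_thickening_iff_infEDist_lt.1 h6
  rw [ENNReal.ofReal_coe_nnreal] at h7
  exact (h7.trans hδε).le

/-! ### Measurability of the limit set -/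

section Measurability

variable [BorelSpace S] [SecondCountableTopology S]

lemma measurable_radius (h : IsContractingRDS P θ φ τ a c Q Ω₀ 𝒦) :
    Measurable (absorbRadius θ τ Q) := by
  have h1 : ∀ i : ℕ, Measurable fun x => (1 / 2 : ℝ) ^ i * Q (θ (-((i + 1) * τ)) x) := fun i =>
    (h.measurable_Q.comp (h.rds.base.preserving _).measurable).const_mul _
  exact (Measurable.tsum h1).const_add 1

/-- The absorbing ball is the unit ball scaled by a measurable radius. A fixed dense sequence of the
unit ball thus gives countably many measurable points dense in the image, and the distance is a
countable infimum. -/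
lemma measurable_infEDist_pullbackImage (h : IsContractingRDS P θ φ τ a c Q Ω₀ 𝒦) (n : ℕ) (η : S) :
    Measurable fun x => Metric.infEDist η (closure (pullbackImage θ φ τ Q n x)) := by
  let u : ℕ → Metric.closedBall (0 : S) 1 :=
    have : Nonempty (Metric.closedBall (0 : S) 1) := ⟨⟨0, by simp⟩⟩
    TopologicalSpace.denseSeq _
  have hu : DenseRange u :=
    have : Nonempty (Metric.closedBall (0 : S) 1) := ⟨⟨0, by simp⟩⟩
    TopologicalSpace.denseRange_denseSeq _
  let y : Ω → Ω := θ (-(n * τ))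
  let p : ℕ → Ω → S := fun k x => φ (n * τ) (y x) (absorbRadius θ τ Q (y x) • (u k : S))
  have hy : Measurable y := (h.rds.base.preserving _).measurable
  have hp : ∀ k, Measurable (p k) := fun k => by
    have h1 : Measurable fun x => ((n * τ : ℝ≥0), y x, absorbRadius θ τ Q (y x) • (u k : S)) :=
      measurable_const.prodMk (hy.prodMk ((h.measurable_radius.comp hy).smul_const _))
    exact h.rds.measurable.comp h1
  have e : ∀ x, closure (pullbackImage θ φ τ Q n x) = closure (range fun k => p k x) := fun x => by
    set R := absorbRadius θ τ Q (y x) with hR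
    have hR0 : 0 < R := zero_lt_one.trans_le (h.one_le_radius _)
    have hcont : Continuous fun v : Metric.closedBall (0 : S) 1 => φ (n * τ) (y x) (R • (v : S)) :=
      (h.continuous_map _ _).comp (continuous_subtype_val.const_smul R)
    have e1 : pullbackImage θ φ τ Q n x
        = range fun v : Metric.closedBall (0 : S) 1 => φ (n * τ) (y x) (R • (v : S)) := by
      ext ζ
      constructor
      · rintro ⟨ξ, hξ, rfl⟩
        rw [mem_closedBall_zero_iff] at hξ
        refine ⟨⟨R⁻¹ • ξ, ?_⟩, ?_⟩
        · rw [mem_closedBall_zero_iff, norm_smul, Real.norm_of_nonneg (inv_nonneg.2 hR0.le),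
            inv_mul_le_iff₀ hR0, mul_one]
          exact hξ
        · simp only [smul_smul, mul_inv_cancel₀ hR0.ne', one_smul]; rfl
      · rintro ⟨v, rfl⟩
        refine ⟨R • (v : S), ?_, rfl⟩
        rw [mem_closedBall_zero_iff, norm_smul, Real.norm_of_nonneg hR0.le]
        have := mem_closedBall_zero_iff.1 v.2
        calc R * ‖(v : S)‖ ≤ R * 1 := by gcongr
          _ = R := mul_one R
    rw [e1]
    refine Subset.antisymm (closure_minimal ?_ isClosed_closure) (closure_mono ?_)
    · exact hcont.range_subset_closure_image_dense hu |>.trans (by rw [← range_comp]; rfl)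
    · rintro _ ⟨k, rfl⟩
      exact ⟨u k, rfl⟩
  have e2 : ∀ x, Metric.infEDist η (closure (pullbackImage θ φ τ Q n x))
      = ⨅ k, edist η (p k x) := fun x => by
    rw [e, Metric.infEDist_closure, Metric.infEDist, iInf_range]
  simp only [e2]
  exact Measurable.iInf fun k => measurable_const.edist (hp k)

/-- The images decrease to the limit set and eventually lie in each of its neighbourhoods, so
distances to them increase to the distance to the limit set. -/
lemma measurable_infEDist (h : IsContractingRDS P θ φ τ a c Q Ω₀ 𝒦) (η : S) :
    Measurable fun x => Metric.infEDist η (pullbackLimit θ φ τ Q Ω₀ x) := by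
  classical
  have hlim : ∀ x, Tendsto (fun n : ℕ => if x ∈ Ω₀ then
      Metric.infEDist η (closure (pullbackImage θ φ τ Q n x)) else Metric.infEDist η {0}) atTop
      (𝓝 (Metric.infEDist η (pullbackLimit θ φ τ Q Ω₀ x))) := fun x => by
    by_cases hx : x ∈ Ω₀
    · simp only [if_pos hx]
      have hle : ∀ n, Metric.infEDist η (closure (pullbackImage θ φ τ Q n x))
          ≤ Metric.infEDist η (pullbackLimit θ φ τ Q Ω₀ x) := fun n => by
        rw [pullbackLimit_of_mem hx]
        exact Metric.infEDist_anti (iInter_subset _ n)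
      have hsup : ⨆ n, Metric.infEDist η (closure (pullbackImage θ φ τ Q n x))
          = Metric.infEDist η (pullbackLimit θ φ τ Q Ω₀ x) := by
        refine le_antisymm (iSup_le hle) (ENNReal.le_of_forall_pos_le_add fun δ hδ _ => ?_)
        obtain ⟨m, hm⟩ := h.exists_pullbackImage_subset hx (ε := δ) hδ
        refine le_trans ?_ (add_le_add_left (le_iSup _ m) _)
        rw [← tsub_le_iff_right]
        refine Metric.le_infEDist.2 fun ζ hζ => ?_
        rw [tsub_le_iff_right, add_comm]
        have h1 := Metric.mem_thickening_iff_infEDist_lt.1 (hm m le_rfl hζ)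
        rw [ENNReal.ofReal_coe_nnreal] at h1
        exact Metric.infEDist_le_infEDist_add_edist.trans (add_le_add_left h1.le _)
      rw [← hsup]
      exact tendsto_atTop_iSup fun m n hmn =>
        Metric.infEDist_anti (h.closure_antitone hx hmn)
    · simp only [if_neg hx, pullbackLimit_of_notMem hx]
      exact tendsto_const_nhds
  refine measurable_of_tendsto_metrizable (fun n => ?_) (tendsto_pi_nhds.2 hlim)
  exact Measurable.ite h.measurableSet (h.measurable_infEDist_pullbackImage n η) measurable_const

/-- The distance function is measurable in `x` and continuous in `η`, hence jointly measurable; for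
closed values the graph is its zero set. -/
lemma isCompactRandomSet (h : IsContractingRDS P θ φ τ a c Q Ω₀ 𝒦) :
    IsCompactRandomSet (pullbackLimit θ φ τ Q Ω₀) := by
  have hm : ∀ η, Measurable fun x => Metric.infDist η (pullbackLimit θ φ τ Q Ω₀ x) := fun η =>
    (h.measurable_infEDist η).ennreal_toReal
  refine ⟨?_, h.isCompact_pullbackLimit, h.nonempty_pullbackLimit, hm⟩
  have h1 : Measurable (Function.uncurry fun (η : S) (x : Ω) =>
      Metric.infDist η (pullbackLimit θ φ τ Q Ω₀ x)) :=
    measurable_uncurry_of_continuous_of_measurable (fun x => Metric.continuous_infDist_pt _) hm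
  have h2 : {p : Ω × S | p.2 ∈ pullbackLimit θ φ τ Q Ω₀ p.1} = Prod.swap ⁻¹'
      ((Function.uncurry fun (η : S) (x : Ω) =>
        Metric.infDist η (pullbackLimit θ φ τ Q Ω₀ x)) ⁻¹' {0}) := by
    ext ⟨x, η⟩
    exact (h.isCompact_pullbackLimit x).isClosed.mem_iff_infDist_zero (h.nonempty_pullbackLimit x)
  rw [IsRandomSet, h2]
  exact measurable_swap (h1 (measurableSet_singleton 0))

/-- A contracting random dynamical system has a random pullback attractor. -/
theorem isRandomPullbackAttractor (h : IsContractingRDS P θ φ τ a c Q Ω₀ 𝒦) :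
    IsRandomPullbackAttractor P θ φ (temperedUniverse P θ) (pullbackLimit θ φ τ Q Ω₀) where
  compact := h.isCompactRandomSet
  invariant := by
    filter_upwards [h.ae_mem] with x hx using h.image_pullbackLimit hx
  attracts _ hD := h.tendsto_semiDist hD

end Measurability

end IsContractingRDS

end Contracting

end YoungDelay

namespace YoungDelay

/-! ### The delay equation as a contracting system -/

section Dissipative

variable {E F : Type*} [NormedAddCommGroup E] [NormedSpace ℝ E] [NormedAddCommGroup F]
  [NormedSpace ℝ F] [CompleteSpace E] {r : ℝ} {B : E →L[ℝ] E} {f : C(Icc (-r) 0, E) → E}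
  {g : C(Icc (-r) 0, E) → F →L[ℝ] E} {Cf : ℝ≥0} {Cg : ℝ} {β₀ ν : ℝ≥0} {K CA lam : ℝ}

namespace IsDissipative

/-- Over a sufficiently long time step the flow contracts norms up to a polynomial of the noise,
and regularizes. -/
lemma exists_contraction (h : IsDissipative r β₀ ν B f g Cf Cg K CA lam) :
    ∃ (n : ℕ) (p C c : ℝ), 0 < n ∧ 1 ≤ p ∧ 0 < C ∧ 0 ≤ c ∧
      ∀ (x : PathSpace F ν) (η : C0 E β₀ (-r) 0) (q : ℝ),
        q = C * (1 + ‖PathSpace.restr 0 (n * r) x‖) ^ p →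
        (∀ t : ℝ≥0, t = n * r → ‖h.flow t x η‖ ≤ 1 / 2 * ‖η‖ + q ∧
          ∀ N : ℕ, 1 / 2 * ‖η‖ + q ≤ N → h.flow t x η ∈ C0.holderSet E β₀ (-r) 0 ν N) ∧
        ∀ t : ℝ≥0, t ≤ n * r → ‖h.flow t x η‖ ≤ c * (‖η‖ + q) := by
  obtain ⟨Γ, μ, p, hΓ, hμ, hp, hap⟩ := exists_apriori_bound h.reg h.exps h.g_le h.CA_nonneg
    h.lam_pos h.decay h.small
  have hr := h.reg.r_pos
  -- The number of cells is taken so large that the weight of the last one beats `Γ`. The factor `2`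
  -- accounts for the supremum and the Hölder part of the norm, and `exp (μ * r)` for evaluating the
  -- weight at the left end of the last cell.
  obtain ⟨n, hn0, hn⟩ : ∃ n : ℕ, 0 < n ∧
      2 * (Real.exp (μ * r) * (Real.exp (-μ * (n * r)) * Γ)) ≤ 1 / 2 := by
    have hlim : Tendsto (fun n : ℕ => 2 * (Real.exp (μ * r) * (Real.exp (-μ * (n * r)) * Γ))) atTop
        (𝓝 0) := by
      have h1 : Tendsto (fun n : ℕ => -μ * ((n : ℝ) * r)) atTop atBot :=
        (tendsto_natCast_atTop_atTop.atTop_mul_const hr).const_mul_atTop_of_neg (by linarith)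
      simpa using (((Real.tendsto_exp_atBot.comp h1).mul_const Γ).const_mul
        (Real.exp (μ * r))).const_mul 2
    exact ((eventually_gt_atTop 0).and
      (hlim.eventually (ge_mem_nhds (by norm_num : (0 : ℝ) < 1 / 2)))).exists
  set T := (n : ℝ) * r with hT
  set κ := Real.exp (μ * r) * (Real.exp (-μ * T) * Γ) with hκ
  have hκ0 : 0 ≤ κ := by positivity
  have hT0 : 0 ≤ T := by positivity
  refine ⟨n, p, Real.exp (μ * T), 2 * ((Real.exp (μ * r) + (n + 1)) * Γ), hn0, hp, by positivity,
    by positivity, fun x η q hq => ?_⟩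
  have hq0 : 0 ≤ q := by rw [hq]; positivity
  have hx := (x.holderBall_restr 0 T).2
  have hη := C0.holderBall (h.solution_eq_toCM x η)
  obtain ⟨hW, hν⟩ := hap n x (h.solution x η) ‖PathSpace.restr 0 T x‖ (‖η‖ + q)
    (h.isDavieSolution_solution x η T) (norm_nonneg _) hx
    (hη.mono (by linarith) le_rfl le_rfl) (by rw [← hq]; linarith [norm_nonneg η])
  have hX : 0 ≤ ‖η‖ + q := by positivity
  -- The segment at the final time is exactly the last grid cell `j = m`, so a single cell bound
  -- gives its Hölder norms.
  obtain ⟨m, rfl⟩ := Nat.exists_eq_succ_of_ne_zero hn0.ne'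
  have hTm : T = (m + 1) * r := by rw [hT]; push_cast; ring
  have hexp : Real.exp (-μ * (r * m)) = Real.exp (μ * r) * Real.exp (-μ * T) := by
    rw [← Real.exp_add, hTm]; ring_nf
  have hconst : Real.exp (-μ * (r * m)) * (Γ * (‖η‖ + q)) = κ * (‖η‖ + q) := by
    rw [hexp, hκ]; ring
  have hsup : ∀ t ∈ Icc (-r) 0, ‖h.solution x η (T + t)‖ ≤ κ * (‖η‖ + q) := fun t ht => by
    refine (hW.1 (T + t) ⟨by linarith [ht.1], by linarith [ht.2]⟩).trans ?_
    have h1 : Real.exp (-μ * (T + t)) ≤ Real.exp (-μ * (r * m)) :=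
      Real.exp_le_exp.2 (by rw [hTm]; nlinarith [ht.1])
    rw [← hconst]
    calc _ ≤ Γ * (‖η‖ + q) * Real.exp (-μ * (r * m)) := by gcongr
      _ = _ := by ring
  have hhalf : κ * (‖η‖ + q) + κ * (‖η‖ + q) ≤ 1 / 2 * ‖η‖ + q := by nlinarith [norm_nonneg η]
  refine ⟨fun t ht => ⟨?_, fun N hN => ⟨?_, ?_⟩⟩, fun t ht => ?_⟩
  · refine (C0.norm_le_of_holderBound (y := fun s => h.solution x η (T + s)) (fun s => ?_)
      (by positivity) (by positivity) hsup ?_).trans hhalf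
    · rw [h.toCM_flow, segment_apply, ht]
    · have h1 := (hW.2.2 m (by omega)).comp_add T
      rw [div_one, hconst] at h1
      exact h1.mono le_rfl (by rw [hTm]; linarith) (by rw [hTm]; linarith)
  · refine (ContinuousMap.norm_le _ N.cast_nonneg).2 fun s => ?_
    rw [h.toCM_flow, segment_apply, ht]
    have : 0 ≤ κ * (‖η‖ + q) := by positivity
    exact (hsup s s.2).trans (by linarith)
  · have h1 := (hν m (by omega)).comp_add T
    rw [hconst] at h1
    have : 0 ≤ κ * (‖η‖ + q) := by positivity
    have h2 : HolderBound ν ((N : ℝ≥0) : ℝ) (-r) 0 (fun s => h.solution x η (T + s)) :=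
      h1.mono (by push_cast; linarith) (by rw [hTm]; linarith) (by rw [hTm]; linarith)
    rw [hT, ← ht] at h2
    exact holderWith_iff_holderBound.2 h2
  · have h1 := hW.holderBall hr β₀.2 hμ (by positivity)
    refine (C0.norm_le_of_holderBall (y := fun s => h.solution x η (t + s)) (fun s => rfl)
      (by positivity) ⟨fun s hs => h1.1 _ ⟨by linarith [hs.1, t.2], by linarith [hs.2]⟩,
        (h1.2.comp_add t).mono le_rfl (by linarith [t.2]) (by linarith)⟩).trans_eq ?_
    ring

/-- Under subexponential growth of the noise the flow is a contracting random dynamical system. -/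
theorem exists_isContractingRDS [FiniteDimensional ℝ E]
    (h : IsDissipative r β₀ ν B f g Cf Cg K CA lam) {P : Measure (PathSpace F ν)}
    (hP : ∀ t : ℝ, P.map (PathSpace.shift t) = P)
    (hsub : ∀ ε, 0 < ε → ∀ᵐ x ∂P, x ∈ PathSpace.subexpPaths F ν r ε) :
    ∃ (τ : ℝ≥0) (a c : ℝ) (Q : PathSpace F ν → ℝ) (Ω₀ : Set (PathSpace F ν)),
      IsContractingRDS P PathSpace.shift h.flow τ a c Q Ω₀
        fun N => C0.holderSet E β₀ (-r) 0 ν N := by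
  obtain ⟨n, p, C, c, hn0, hp, hC, hc, hstep⟩ := h.exists_contraction
  have hr := h.reg.r_pos
  have hT : 0 < (n : ℝ) * r := by positivity
  -- With this rate `exp (a * τ)` is the square root of `2`, hence below `2`.
  set a := Real.log 2 / (2 * (n * r)) with ha
  have ha0 : 0 < a := by have := Real.log_pos one_lt_two; positivity
  have hp0 : 0 < p := by linarith
  obtain ⟨τ, hτ⟩ : ∃ τ : ℝ≥0, (τ : ℝ) = n * r := ⟨⟨n * r, hT.le⟩, rfl⟩
  refine ⟨τ, a, c, fun x => C * (1 + ‖PathSpace.restr 0 (n * r) x‖) ^ p,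
    PathSpace.subexpPaths F ν r (a * r / p), ?_⟩
  exact
    { rds := h.isContinuousRDS hP
      pos := by rw [← NNReal.coe_pos, hτ]; exact hT
      rate_pos := ha0
      rate_lt := by
        have e : a * (n * r) = Real.log 2 / 2 := by rw [ha]; field_simp
        rw [hτ, e, ← Real.lt_log_iff_exp_lt two_pos]
        linarith [Real.log_pos one_lt_two]
      c_nonneg := hc
      measurable_Q := by
        refine Continuous.measurable (continuous_const.mul ?_)
        exact (continuous_const.add (PathSpace.continuous_restr 0 (n * r)).norm).rpow_const
          fun x => Or.inr hp0.le
      Q_nonneg := fun x => by positivity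
      measurableSet := PathSpace.measurableSet_subexpPaths _ _
      ae_mem := hsub _ (by positivity)
      invariant := fun x hx t => PathSpace.shift_mem_subexpPaths hr hx t
      growth := fun x hx => by
        obtain ⟨D, hD⟩ := hx
        set ε := a * r / p with hε
        have hε0 : 0 < ε := by positivity
        refine ⟨C * (1 + 3 * (D * Real.exp (ε * (n + 1)))) ^ p, fun t ht => ?_⟩
        -- The window `[-t, -t + n * r]` seen by the shifted path lies in `[-(N * r), N * r]`. Since
        -- `Q` is a `p`-th power of the norm and `N` is about `t / r`, the path needs growth rate `a
        -- * r / p` for `Q` to have rate `a`.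
        set N := ⌊t / r⌋₊ + 1 + n with hN
        have h1 : t ≤ (⌊t / r⌋₊ + 1) * r := by
          rw [← div_le_iff₀ hr]; exact (Nat.lt_floor_add_one _).le
        have h2 : (N : ℝ) * r = (⌊t / r⌋₊ + 1) * r + n * r := by rw [hN]; push_cast; ring
        have h3 : (N : ℝ) ≤ t / r + (n + 1) := by
          have := Nat.floor_le (by positivity : 0 ≤ t / r)
          rw [hN]; push_cast; linarith
        have h4 := (PathSpace.norm_restr_shift_le (t := -t) (a := 0) (b := n * r)
          (a' := -(N * r)) (b' := N * r) x (by linarith) (by linarith) (by linarith)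
          (by linarith)).trans (mul_le_mul_of_nonneg_left (hD N) (by norm_num))
        have h5 : Real.exp (ε * N) ≤ Real.exp (ε * (n + 1)) * Real.exp (ε * (t / r)) := by
          rw [← Real.exp_add, ← mul_add]
          exact Real.exp_le_exp.2 (mul_le_mul_of_nonneg_left (by linarith) hε0.le)
        have h6 : 1 ≤ Real.exp (ε * (t / r)) := Real.one_le_exp (by positivity)
        have h7 : 1 + ‖PathSpace.restr 0 (n * r) (PathSpace.shift (-t) x)‖
            ≤ (1 + 3 * (D * Real.exp (ε * (n + 1)))) * Real.exp (ε * (t / r)) := by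
          have h8 : 3 * (D * Real.exp (ε * N))
              ≤ 3 * (D * (Real.exp (ε * (n + 1)) * Real.exp (ε * (t / r)))) := by gcongr
          rw [add_mul]
          linarith
        have h9 : Real.exp (ε * (t / r)) ^ p = Real.exp (a * t) := by
          rw [← Real.exp_mul, hε]; congr 1; field_simp
        calc _ ≤ C * ((1 + 3 * (D * Real.exp (ε * (n + 1)))) * Real.exp (ε * (t / r))) ^ p := by
              gcongr
          _ = _ := by rw [Real.mul_rpow (by positivity) (by positivity), h9]; ring
      contract := fun x η => ((hstep x η _ rfl).1 _ hτ).1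
      bound := fun t x η ht => (hstep x η _ rfl).2 t (hτ ▸ NNReal.coe_le_coe.2 ht)
      isCompact := fun N => by
        have : ProperSpace E := FiniteDimensional.proper ℝ E
        exact C0.isCompact_holderSet (by exact_mod_cast h.exps.pos) (by exact_mod_cast h.exps.lt)
          (by linarith) _
      mem_compact := fun x η N hN => ((hstep x η _ rfl).1 _ hτ).2 N hN }

end IsDissipative

end Dissipative

lemma C0.memHolder_of_mem_holderSet {E : Type*} [NormedAddCommGroup E] [NormedSpace ℝ E]
    {α β ν R : ℝ≥0} {a b : ℝ} (hab : a ≤ b) (hβ : 0 < β) (hβν : β ≤ ν) {η : C0 E α a b}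
    (h : η ∈ C0.holderSet E α a b ν R) : MemHolder β η.toCM := by
  have e : (η.toCM : Icc a b → E) = fun t : Icc a b => η.extend hab t :=
    funext fun t => (η.extend_apply hab t).symm
  have h1 := h.2
  rw [e] at h1 ⊢
  have h0 : 0 ≤ b - a := sub_nonneg.2 hab
  exact memHolder_iff_holderBound.2 ⟨_, by positivity, (holderWith_iff_holderBound.1
    h1).of_exponent_le (by exact_mod_cast hβ) (by exact_mod_cast hβν) R.2 le_rfl⟩

end YoungDelay

end

/-! ### Assembly of the theorem -/

theorem theorem4p7 {d m : ℕ} (r : ℝ) (hr : 0 < r)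
    (ν β₀ β : ℝ≥0) (hν : (1 / 2 : ℝ) < ν) (hν1 : ν ≤ 1)
    (hβ₀ : (1 : ℝ) - ν < β₀) (hβ : β₀ < β) (hβν : β < ν)
    (A : Matrix (Fin d) (Fin d) ℝ)
    (f : C(Icc (-r) 0, EuclideanSpace ℝ (Fin d)) → EuclideanSpace ℝ (Fin d))
    (g : C(Icc (-r) 0, EuclideanSpace ℝ (Fin d)) →
      EuclideanSpace ℝ (Fin m) →L[ℝ] EuclideanSpace ℝ (Fin d))
    -- the law of the noise on the canonical path space: stationary increments, ergodic,
    -- and the moment condition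
    (P : Measure (YoungDelay.PathSpace (EuclideanSpace ℝ (Fin m)) ν)) [IsProbabilityMeasure P]
    (hstat : ∀ t : ℝ, P.map (YoungDelay.PathSpace.shift t) = P)
    (herg : YoungDelay.IsErgodicFlow P YoungDelay.PathSpace.shift)
    (hΓ : ∫⁻ x, (eHolderNorm ν (fun t : Icc (-r) r => x t)) ^ (1 / ((ν : ℝ) - β)) ∂P < ∞)
    -- all eigenvalues of `A` have negative real parts
    (H1 : ∀ z ∈ spectrum ℂ (A.map (algebraMap ℝ ℂ)), z.re < 0)
    -- `f` is globally Lipschitz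
    (Cf : ℝ≥0) (H2 : LipschitzWith Cf f)
    -- `g` is `C¹` with bounded and locally Lipschitz derivative
    (hg : ContDiff ℝ 1 g) (Cg : ℝ) (hCg : ∀ ξ, ‖fderiv ℝ g ξ‖ ≤ Cg)
    (hLg : ∀ M : ℝ, 0 < M → ∃ L : ℝ, ∀ ξ η, ‖ξ‖ ≤ M → ‖η‖ ≤ M →
      ‖fderiv ℝ g ξ - fderiv ℝ g η‖ ≤ L * ‖ξ - η‖)
    -- exponential decay of `exp (tA)` and smallness of the Lipschitz constant of `f`
    (CA lam : ℝ) (hCA : 0 < CA) (hlam : 0 < lam)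
    (hΦ : ∀ t : ℝ, 0 ≤ t → ‖NormedSpace.exp (t • Matrix.toEuclideanCLM (n := Fin d) (𝕜 := ℝ) A)‖
      ≤ CA * Real.exp (-lam * t))
    (hsmall : CA * Cf < lam * Real.exp (-lam * r))
    -- `g` is bounded
    (hgb : ∃ K : ℝ, ∀ η : YoungDelay.C0 (EuclideanSpace ℝ (Fin d)) β₀ (-r) 0, ‖g η.toCM‖ ≤ K) :
    ∃ φ : ℝ≥0 → YoungDelay.PathSpace (EuclideanSpace ℝ (Fin m)) ν →
        YoungDelay.C0 (EuclideanSpace ℝ (Fin d)) β₀ (-r) 0 →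
        YoungDelay.C0 (EuclideanSpace ℝ (Fin d)) β₀ (-r) 0,
      YoungDelay.IsGeneratedBy r β₀ ν (Matrix.toEuclideanCLM (n := Fin d) (𝕜 := ℝ) A) f g φ ∧
      YoungDelay.IsContinuousRDS P YoungDelay.PathSpace.shift φ ∧
      ∃ 𝒜 : YoungDelay.PathSpace (EuclideanSpace ℝ (Fin m)) ν →
          Set (YoungDelay.C0 (EuclideanSpace ℝ (Fin d)) β₀ (-r) 0),
        YoungDelay.IsRandomPullbackAttractor P YoungDelay.PathSpace.shift φ
          (YoungDelay.temperedUniverse P YoungDelay.PathSpace.shift) 𝒜 ∧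
        ∀ x, ∀ η ∈ 𝒜 x, MemHolder β η.toCM := by
  obtain ⟨K, hK⟩ := hgb
  have hν0 : (0 : ℝ) < ν := by linarith
  have hν1' : (ν : ℝ) ≤ 1 := by exact_mod_cast hν1
  have hβ' : (β₀ : ℝ) < β := by exact_mod_cast hβ
  have hβν' : (β : ℝ) < ν := by exact_mod_cast hβν
  have hβ₀0 : (0 : ℝ) < β₀ := by linarith
  have hd : YoungDelay.IsDissipative r β₀ ν (Matrix.toEuclideanCLM (n := Fin d) (𝕜 := ℝ) A) f g Cf
      Cg K CA lam :=
    { reg := ⟨hr, H2, hg.differentiable one_ne_zero, hCg, hLg⟩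
      exps := ⟨hβ₀0, hβ'.trans hβν', hν1', by linarith⟩
      -- Boundedness of `g` on `C^{0,β₀}` extends to all continuous segments by density.
      g_le := YoungDelay.norm_le_of_forall_C0 (by exact_mod_cast hβ₀0)
        (by exact_mod_cast (hβ'.trans hβν').le.trans hν1') (by linarith) hg.continuous hK
      CA_nonneg := hCA.le
      lam_pos := hlam
      decay := hΦ
      -- The factor `exp (-lam * r)` is at most one, so the assumption implies `CA * Cf < lam`.
      small := hsmall.trans_le (mul_le_of_le_one_right hlam.le (Real.exp_le_one_iff.2 (by nlinarith))) }
  have hνn : 0 < ν := by exact_mod_cast hν0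
  obtain ⟨τ, a, c, Q, Ω₀, hcon⟩ := hd.exists_isContractingRDS hstat fun ε hε =>
    YoungDelay.PathSpace.ae_mem_subexpPaths hr hε (by rw [one_div, inv_pos]; linarith) hνn hν1
      (YoungDelay.PathSpace.isMetricDynamicalSystem hνn hν1 hstat) hΓ
  have : ProperSpace (EuclideanSpace ℝ (Fin d)) := inferInstance
  have := YoungDelay.C0.separableSpace (E := EuclideanSpace ℝ (Fin d)) (α := β₀) (a := -r) (b := 0)
    (by exact_mod_cast hβ₀0) (by exact_mod_cast (hβ'.trans hβν').trans_le hν1') (by linarith)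
  have := UniformSpace.secondCountable_of_separable
    (YoungDelay.C0 (EuclideanSpace ℝ (Fin d)) β₀ (-r) 0)
  refine ⟨hd.flow, hd.isGeneratedBy, hcon.rds, _, hcon.isRandomPullbackAttractor, fun x η hη => ?_⟩
  -- On `Ω₀` the attractor lies in a bounded set of `ν`-Hölder paths, and `β < ν`; elsewhere it is
  -- `{0}`. Both cases give regularity for every path, not only almost surely.
  by_cases hx : x ∈ Ω₀
  · obtain ⟨N, hN⟩ := hcon.exists_pullbackLimit_subset hx
    exact YoungDelay.C0.memHolder_of_mem_holderSet (by linarith) (by exact_mod_cast hβ₀0.trans hβ')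
      hβν.le (hN hη)
  · rw [YoungDelay.IsContractingRDS.pullbackLimit_of_notMem hx, mem_singleton_iff] at hη
    rw [hη]
    exact memHolder_zero
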